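/- Let $p\in(2,\infty)$. An immersed curve $\gamma\in W^{2,p}(0,1;\mathbf R^2)$ (that is, $\gamma'(t)\ne0$ for all $t\in[0,1]$) is a $p$-elastica if there is $\lambda\in\mathbf R$ such that $\frac{d}{d\varepsilon}\big(\mathcal B_p[\gamma+\varepsilon\eta]+\lambda\mathcal L[\gamma+\varepsilon\eta]\big)\big|_{\varepsilon=0}=0$ for all $\eta\in C_c^\infty(0,1;\mathbf R^2)$, where $\mathcal B_p[\gamma]=\int_\gamma|k|^p\,ds$, $k$ is the signed curvature, $s$ the arclength and $\mathcal L$ the length. For $q\in[0,1)$ and $x\in\mathbf R$ put $$\mathrm F_{1,p}(x,q)=\int_0^x\frac{|\cos\theta|^{1-2/p}}{\sqrt{1-q^2\sin^2\theta}}\,d\theta,\qquad \mathrm F_{2,p}(x,q)=\int_0^x\frac{d\theta}{(1-q^2\sin^2\theta)^{1/p}},$$ and $\mathrm F_{1,p}(x,1)=\mathrm F_{2,p}(x,1)=\int_0^x|\cos\theta|^{-2/p}\,d\theta$, $\mathrm K_p(1)=\int_0^{\pi/2}(\cos\theta)^{-2/p}\,d\theta$. For $r>1$ and $q\in[0,1]$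 put $$\mathrm E_{1,r}(x,q)=\int_0^x\sqrt{1-q^2\sin^2\theta}\,|\cos\theta|^{1-2/r}\,d\theta,\qquad \mathrm E_{2,r}(x,q)=\int_0^x(1-q^2\sin^2\theta)^{1/r}\,d\theta.$$ Let $\mathrm{am}_{i,p}(\cdot,q)$ be the inverse function of $\mathrm F_{i,p}(\cdot,q)$ on $\mathbf R$, and $\mathrm{sn}_p=\sin\mathrm{am}_{1,p}$, $\mathrm{cn}_p=|\cos\mathrm{am}_{1,p}|^{2/p-1}\cos\mathrm{am}_{1,p}$ (read as $0$ where $\cos\mathrm{am}_{1,p}=0$), $\mathrm{dn}_p=(1-q^2\sin^2\mathrm{am}_{2,p})^{1/p}$. Let $\mathrm{sech}_p\,x=\mathrm{cn}_p(x,1)$ for $|x|<\mathrm K_p(1)$ and $\mathrm{sech}_p\,x=0$ otherwise, and $\tanh_p x=\int_0^x(\mathrm{sech}_p\,t)^p\,dt$. For curves $\gamma_j:[a_j,b_j]\to\mathbf R^2$ with $L_j=b_j-a_j\ge0$, let $\gamma_1\oplus\gamma_2:[0,L_1+L_2]\to\mathbf R^2$ be $\gamma_1(s+a_1)$ for $s\in[0,L_1]$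 and $\gamma_2(s+a_2-L_1)+\gamma_1(b_1)-\gamma_2(a_2)$ for $s\in[L_1,L_1+L_2]$; iterated concatenations $\bigoplus$ are formed from the left. **Theorem.** Let $p\in(2,\infty)$ and let $\gamma$ be a $p$-elastica in $\mathbf R^2$. Then there are a similarity $\Phi(x)=rUx+b$ ($r>0$, $U$ orthogonal, $b\in\mathbf R^2$) and $s_0\in\mathbf R$ such that the arclength parameterization $\tilde\gamma:[0,\ell]\to\mathbf R^2$ of $\Phi\circ\gamma$ is $\tilde\gamma(s)=\gamma_*(s+s_0)$, where either $\gamma_*:\mathbf R\to\mathbf R^2$ is one of the following: * (Linear) $\gamma_\ell(s)=(s,0)$; * (Wavelike) for some $q\in(0,1)$, $\gamma_w(s,q)=\big(2\mathrm E_{1,p}(\mathrm{am}_{1,p}(s,q),q)-s,\ -q\tfrac p{p-1}|\mathrm{cn}_p(s,q)|^{p-2}\mathrm{cn}_p(s,q)\big)$; * (Orbitlike) for some $q\in(0,1)$, $\gamma_o(s,q)=\frac1{q^2}\big(2\mathrm E_{2,\frac p{p-1}}(\mathrm{am}_{2,p}(s,q),q)+(q^2-2)s,\ -\tfrac p{p-1}\mathrm{dn}_p(s,q)^{p-1}\big)$;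 * (Circular) $\gamma_c(s)=(\cos s,\sin s)$; or $\gamma_*=\gamma_f:[0,L]\to\mathbf R^2$, with $[s_0,s_0+\ell]\subset[0,L]$, is * (Flat-core) $\gamma_f=\bigoplus_{j=1}^N(\gamma_\ell^{L_j}\oplus\gamma_b^{\sigma_j})$ for some integer $N\ge1$, signs $\sigma_j\in\{+,-\}$ and numbers $L_j\ge0$, where $\gamma_\ell^{L_j}(s)=(-s,0)$ on $[0,L_j]$ and $\gamma_b^\pm(s)=\big(2\tanh_p s-s,\ \mp\tfrac p{p-1}(\mathrm{sech}_p\,s)^{p-1}\big)$ on $[-\mathrm K_p(1),\mathrm K_p(1)]$. All these curves $\gamma_*$ are parameterized by arclength, and $L=2N\mathrm K_p(1)+\sum_jL_j$. With $\partial_s\gamma=(\cos\theta,\sin\theta)$ and $k=\partial_s\theta$, their tangential angles and signed curvatures are: $\theta_\ell=0$, $k_\ell\equiv0$; $\theta_w=2\arcsin(q\,\mathrm{sn}_p(s,q))$, $k_w=2q\,\mathrm{cn}_p(s,q)$; $\theta_o=2\,\mathrm{am}_{2,p}(s,q)$, $k_o=2\,\mathrm{dn}_p(s,q)$; $\theta_c=s+\tfrac\pi2$,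 $k_c\equiv1$; and, for $s\in[-\mathrm K_p(1),\mathrm K_p(1)]$, $\theta_b^\pm=\pm2\,\mathrm{am}_{1,p}(s,1)=\pm2\,\mathrm{am}_{2,p}(s,1)$, $k_b^\pm=\pm2\,\mathrm{sech}_p\,s$. -/

import Mathlib

open Real Set MeasureTheory
open scoped ContDiff

namespace PElastica

noncomputable section

/-- The Euclidean plane. -/
abbrev Plane : Type := EuclideanSpace ℝ (Fin 2)

/-! ### Curves of class `W^{2,p}`, energies, `p`-elasticae -/

/-- `g` is the weak (distributional) derivative of `f` on the interval `(0, 1)`. -/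
def HasWeakDeriv (f g : ℝ → Plane) : Prop :=
  ∀ φ : ℝ → ℝ, ContDiff ℝ ∞ φ → HasCompactSupport φ → tsupport φ ⊆ Ioo 0 1 →
    ∫ t in Ioo (0 : ℝ) 1, deriv φ t • f t = -∫ t in Ioo (0 : ℝ) 1, φ t • g t

/-- `f ∈ L^p(0, 1; ℝ²)`. -/
def MemLpUnit (p : ℝ) (f : ℝ → Plane) : Prop :=
  MemLp f (ENNReal.ofReal p) (volume.restrict (Ioo (0 : ℝ) 1))

/-- `γ ∈ W^{2,p}(0, 1; ℝ²)`: the function and its first two weak derivatives are in `L^p`.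
As usual in one dimension, `γ` is taken to be the representative that is continuous on `[0, 1]`
(it is then automatically `C¹` on `[0, 1]`). Only the values of `γ` on `[0, 1]` matter. -/
def MemW2p (p : ℝ) (γ : ℝ → Plane) : Prop :=
  ContinuousOn γ (Icc 0 1) ∧
    ∃ γ₁ γ₂ : ℝ → Plane, HasWeakDeriv γ γ₁ ∧ HasWeakDeriv γ₁ γ₂ ∧
      MemLpUnit p γ ∧ MemLpUnit p γ₁ ∧ MemLpUnit p γ₂

/-- `γ` is an immersed curve of class `W^{2,p}`: `γ'(t) ≠ 0` for all `t ∈ [0, 1]`, the derivative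
being one-sided at the end points. -/
def IsImmersedW2p (p : ℝ) (γ : ℝ → Plane) : Prop :=
  MemW2p p γ ∧ ∀ t ∈ Icc (0 : ℝ) 1, derivWithin γ (Icc 0 1) t ≠ 0

/-- The (counterclockwise) signed curvature `det(γ', γ'') / |γ'|³`. For `γ` of class `W^{2,p}`
the classical derivative of `γ'` exists almost everywhere in `(0, 1)` and is the weak one. -/
def signedCurvature (γ : ℝ → Plane) (t : ℝ) : ℝ :=
  (deriv γ t 0 * deriv (deriv γ) t 1 - deriv γ t 1 * deriv (deriv γ) t 0) / ‖deriv γ t‖ ^ 3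

/-- The arclength `s(t)` of the part of `γ` that is parameterized by `[0, t]`. -/
def arclength (γ : ℝ → Plane) (t : ℝ) : ℝ := ∫ u in (0 : ℝ)..t, ‖deriv γ u‖

/-- The length of `γ : [0, 1] → ℝ²`. -/
def length (γ : ℝ → Plane) : ℝ := arclength γ 1

/-- The `p`-bending energy `∫_γ |k|^p ds` of `γ : [0, 1] → ℝ²`. -/
def bendingEnergy (p : ℝ) (γ : ℝ → Plane) : ℝ :=
  ∫ t in (0 : ℝ)..1, |signedCurvature γ t| ^ p * ‖deriv γ t‖

/-- `γ` is a `p`-elastica: an immersed `W^{2,p}` curve that is, for some `μ ∈ ℝ`, a critical point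
of (bending energy) + `μ` (length) with respect to perturbations in `C_c^∞(0, 1; ℝ²)`. -/
def IsPElastica (p : ℝ) (γ : ℝ → Plane) : Prop :=
  IsImmersedW2p p γ ∧ ∃ μ : ℝ, ∀ η : ℝ → Plane,
    ContDiff ℝ ∞ η → HasCompactSupport η → tsupport η ⊆ Ioo 0 1 →
      HasDerivAt (fun ε : ℝ => bendingEnergy p (γ + ε • η) + μ * length (γ + ε • η)) 0 0

/-! ### `p`-elliptic integrals and functions

All of these are used for `p > 2` and `q ∈ [0, 1]` only (`p / (p - 1)` also occurs as the exponent
of the second integral of the second kind). -/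

/-- Incomplete `p`-elliptic integral of the first kind `F_{1,p}(x, q)`. -/
def F₁ (p x q : ℝ) : ℝ :=
  if q = 1 then ∫ θ in (0 : ℝ)..x, 1 / |cos θ| ^ (2 / p)
  else ∫ θ in (0 : ℝ)..x, |cos θ| ^ (1 - 2 / p) / √(1 - q ^ 2 * sin θ ^ 2)

/-- Incomplete `p`-elliptic integral of the first kind `F_{2,p}(x, q)`. -/
def F₂ (p x q : ℝ) : ℝ :=
  if q = 1 then ∫ θ in (0 : ℝ)..x, 1 / |cos θ| ^ (2 / p)
  else ∫ θ in (0 : ℝ)..x, 1 / (1 - q ^ 2 * sin θ ^ 2) ^ (1 / p)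

/-- The complete `p`-elliptic integral `K_p(1)`, which is finite and positive for `p > 2`. -/
def K (p : ℝ) : ℝ := ∫ θ in (0 : ℝ)..(π / 2), 1 / cos θ ^ (2 / p)

/-- Incomplete `p`-elliptic integral of the second kind `E_{1,p}(x, q)`. -/
def E₁ (p x q : ℝ) : ℝ :=
  ∫ θ in (0 : ℝ)..x, √(1 - q ^ 2 * sin θ ^ 2) * |cos θ| ^ (1 - 2 / p)

/-- Incomplete `p`-elliptic integral of the second kind `E_{2,p}(x, q)`. -/
def E₂ (p x q : ℝ) : ℝ := ∫ θ in (0 : ℝ)..x, (1 - q ^ 2 * sin θ ^ 2) ^ (1 / p)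

/-- The amplitude `am_{1,p}(·, q)`, the inverse of `F_{1,p}(·, q)`, which is an increasing
bijection of `ℝ` for `p > 2` and `q ∈ [0, 1]`. -/
def am₁ (p x q : ℝ) : ℝ := Function.invFun (fun y => F₁ p y q) x

/-- The amplitude `am_{2,p}(·, q)`, the inverse of `F_{2,p}(·, q)`, which is an increasing
bijection of `ℝ` for `p > 2` and `q ∈ [0, 1]`. -/
def am₂ (p x q : ℝ) : ℝ := Function.invFun (fun y => F₂ p y q) x

/-- The `p`-elliptic sine. -/
def sn (p x q : ℝ) : ℝ := sin (am₁ p x q)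

/-- The `p`-elliptic cosine. -/
def cn (p x q : ℝ) : ℝ := |cos (am₁ p x q)| ^ (2 / p - 1) * cos (am₁ p x q)

/-- The `p`-delta amplitude. -/
def dn (p x q : ℝ) : ℝ := (1 - q ^ 2 * sin (am₂ p x q) ^ 2) ^ (1 / p)

/-- The `p`-hyperbolic secant for `p > 2`: `cn_p(x, 1)` (which is `dn_p(x, 1)`) on
`(-K_p(1), K_p(1))` and zero elsewhere. -/
def sech (p x : ℝ) : ℝ := if x ∈ Ioo (-K p) (K p) then cn p x 1 else 0

/-- The `p`-hyperbolic tangent. -/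
def tanh (p x : ℝ) : ℝ := ∫ t in (0 : ℝ)..x, sech p t ^ p

/-! ### The profile curves -/

/-- The linear profile. -/
def linearCurve (s : ℝ) : Plane := !₂[s, 0]

/-- The wavelike profile with modulus `q`. -/
def wavelikeCurve (p q s : ℝ) : Plane :=
  !₂[2 * E₁ p (am₁ p s q) q - s, -q * (p / (p - 1)) * (|cn p s q| ^ (p - 2) * cn p s q)]

/-- The orbitlike profile with modulus `q`. -/
def orbitlikeCurve (p q s : ℝ) : Plane :=
  (1 / q ^ 2) • !₂[2 * E₂ (p / (p - 1)) (am₂ p s q) q + (q ^ 2 - 2) * s,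
    -(p / (p - 1)) * dn p s q ^ (p - 1)]

/-- The circular profile. -/
def circularCurve (s : ℝ) : Plane := !₂[cos s, sin s]

/-- The borderline loop `γ_b^σ` with sign `σ = ±1`, to be considered on `[-K_p(1), K_p(1)]`. -/
def borderlineCurve (p σ s : ℝ) : Plane :=
  !₂[2 * tanh p s - s, -σ * (p / (p - 1)) * sech p s ^ (p - 1)]

/-- A curve on a compact interval `[left, right]`; the values of `toFun` outside are irrelevant. -/
structure Arc where
  left : ℝ
  right : ℝ
  toFun : ℝ → Plane

/-- The concatenation `γ₁ ⊕ γ₂`, defined on `[0, L₁ + L₂]`. -/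
def Arc.concat (c₁ c₂ : Arc) : Arc where
  left := 0
  right := (c₁.right - c₁.left) + (c₂.right - c₂.left)
  toFun s :=
    if s ≤ c₁.right - c₁.left then c₁.toFun (s + c₁.left)
    else c₂.toFun (s + c₂.left - (c₁.right - c₁.left)) + c₁.toFun c₁.right - c₂.toFun c₂.left

/-- The iterated concatenation `((c₀ ⊕ c₁) ⊕ ⋯) ⊕ cₙ` of `n + 1` curves. -/
def Arc.bigConcat : (n : ℕ) → (Fin (n + 1) → Arc) → Arc
  | 0, c => c 0
  | n + 1, c => (Arc.bigConcat n fun i => c i.castSucc).concat (c (Fin.last (n + 1)))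

/-- The straight segment `γ_ℓ^ℓ(s) = (-s, 0)` on `[0, ℓ]`. -/
def segmentArc (ℓ : ℝ) : Arc := ⟨0, ℓ, fun s => !₂[-s, 0]⟩

/-- The borderline loop `γ_b^σ` on `[-K_p(1), K_p(1)]`. -/
def loopArc (p σ : ℝ) : Arc := ⟨-K p, K p, borderlineCurve p σ⟩

/-- The flat-core curve `⨁_j (γ_ℓ^{L_j} ⊕ γ_b^{σ_j})` with `n + 1` summands. -/
def flatCore (p : ℝ) (n : ℕ) (L σ : Fin (n + 1) → ℝ) : Arc :=
  Arc.bigConcat n fun j => (segmentArc (L j)).concat (loopArc p (σ j))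

/-! ### Comparison of curves -/

/-- Up to a similarity `x ↦ r U x + b` (`r > 0`, `U` orthogonal) and reparameterization by
arclength, `γ : [0, 1] → ℝ²` is `s ↦ γ_*(s + s₀)`, where `γ_*` is defined on `I`. Here
`r * arclength γ t` is the arclength parameter of the similar curve `r U γ + b`. -/
def IsRepresentedBy (γ γstar : ℝ → Plane) (I : Set ℝ) : Prop :=
  ∃ r : ℝ, 0 < r ∧ ∃ (U : Plane ≃ₗᵢ[ℝ] Plane) (b : Plane) (s₀ : ℝ), ∀ t ∈ Icc (0 : ℝ) 1,
    r * arclength γ t + s₀ ∈ I ∧ r • U (γ t) + b = γstar (r * arclength γ t + s₀)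

/-- On `I`, the curve `γ` is parameterized by arclength with tangential angle `θ`, that is
`γ' = (cos θ, sin θ)`, and signed curvature `k = θ'`. -/
def HasAngleCurvatureOn (γ : ℝ → Plane) (θ k : ℝ → ℝ) (I : Set ℝ) : Prop :=
  ∀ s ∈ I, HasDerivWithinAt γ !₂[cos (θ s), sin (θ s)] I s ∧ HasDerivWithinAt θ (k s) I s

end

end PElastica

/-! Both energies depend only on `γ'` and `γ''`, so the weak Euler-Lagrange equation can be
integrated once. The constants of integration form a conserved vector `c = (c₀, c₁)`
(`integrated_euler_lagrange`). Its components normal and tangential to the curve say that the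
bending moment `p |k|^(p-2) k` is continuously differentiable, with arclength derivative `c₀ sin θ -
c₁ cos θ`, and that `(1 - p) |k|^p + μ = c₀ cos θ + c₁ sin θ` (`exists_euler_lagrange`,
`exists_arclength_data`). The curvature thus has a continuous representative although `γ''` is only
in `L^p`.

If `c = 0`, the curvature is constant and the curve is a line or a circular arc. Otherwise a
rotation and a dilation give `ϑ' = 2κ` and `cos ϑ = A + B |κ|^p`, with `A = -μ / |c|` and any
prescribed `B > 0` (`normalize`). The value of `A` decides the type. For `A ≥ 1` the curve is
straight. For `A < -1` the curvature never vanishes, and `ϑ / 2` is the orbitlike amplitude up to a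
shift of arclength. For `-1 < A < 1` the bending moment has only simple zeros; a signed power of `κ`
and `sin (ϑ / 2)`, suitably scaled, lie on the unit circle, and their polar angle is the wavelike
amplitude. In place of uniqueness for ODEs, each case uses quadrature: if `φ' = 1 / f(φ)` off a
countable set, then `F(φ(s)) - s` is constant (`F_sub_eq`).

For `A = -1` one has `|κ|^p = cos² (ϑ / 2)`. Since `2 / p < 1`, the equation is not Lipschitz at `κ
= 0`, a borderline loop takes the finite length `2 K p`, and the curve may stay straight for any
length before it leaves with either sign. Points of nonzero curvature lie on translates of the loop
(`exists_center`), distinct loops do not overlap, and a compact interval meets finitely many.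
Completing the loops cut off at the two ends gives a flat-core concatenation (`exists_flatCore`).

The angle and curvature formulas follow by differentiating the closed forms through the amplitudes
(`hasDerivAt_comp`). The derivative may be unavailable at the countably many zeros of the cosine,
but its continuous extension supplies it there. -/

namespace PElastica

/-! ### Test functions, weak derivatives and the du Bois-Reymond lemma -/

/-- Smooth real functions with compact support in `(0, 1)`. -/
structure IsTest (φ : ℝ → ℝ) : Prop where
  contDiff : ContDiff ℝ ∞ φ
  hasCompactSupport : HasCompactSupport φ
  tsupport_subset : tsupport φ ⊆ Ioo 0 1

namespace IsTest

variable {φ ψ : ℝ → ℝ}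

theorem continuous (h : IsTest φ) : Continuous φ := h.contDiff.continuous

theorem eq_zero (h : IsTest φ) {t : ℝ} (ht : t ∉ Ioo (0 : ℝ) 1) : φ t = 0 :=
  image_eq_zero_of_notMem_tsupport fun h' => ht (h.tsupport_subset h')

theorem differentiable (h : IsTest φ) : Differentiable ℝ φ :=
  h.contDiff.differentiable (by simp)

theorem hasDerivAt (h : IsTest φ) (t : ℝ) : HasDerivAt φ (deriv φ t) t :=
  (h.differentiable t).hasDerivAt

theorem deriv (h : IsTest φ) : IsTest (deriv φ) where
  contDiff := ((contDiff_infty_iff_deriv).1 h.contDiff).2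
  hasCompactSupport := h.hasCompactSupport.deriv
  tsupport_subset := tsupport_deriv_subset.trans h.tsupport_subset

theorem const_mul (h : IsTest φ) (c : ℝ) : IsTest fun t => c * φ t where
  contDiff := contDiff_const.mul h.contDiff
  hasCompactSupport := h.hasCompactSupport.mul_left
  tsupport_subset := (tsupport_mul_subset_right (f := fun _ => c) (g := φ)).trans h.tsupport_subset

theorem sub (h : IsTest φ) (h' : IsTest ψ) : IsTest fun t => φ t - ψ t where
  contDiff := h.contDiff.sub h'.contDiff
  hasCompactSupport := h.hasCompactSupport.sub h'.hasCompactSupport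
  tsupport_subset := (tsupport_sub φ ψ).trans (union_subset h.tsupport_subset h'.tsupport_subset)

theorem exists_bound (h : IsTest φ) : ∃ C, ∀ t, |φ t| ≤ C := by
  simpa using h.hasCompactSupport.exists_bound_of_continuous h.continuous

theorem integral_eq (h : IsTest φ) (f : ℝ → ℝ) :
    ∫ t in Ioo (0 : ℝ) 1, φ t * f t = ∫ t, φ t * f t :=
  setIntegral_eq_integral_of_forall_compl_eq_zero fun t ht => by simp [h.eq_zero ht]

theorem integrableOn_mul (h : IsTest φ) {f : ℝ → ℝ} (hf : IntegrableOn f (Ioo 0 1)) :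
    IntegrableOn (fun t => φ t * f t) (Ioo 0 1) := by
  obtain ⟨C, hC⟩ := h.exists_bound
  exact hf.bdd_mul h.continuous.aestronglyMeasurable (Filter.Eventually.of_forall hC)

theorem support_subset_Icc (h : IsTest φ) :
    ∃ a b : ℝ, 0 < a ∧ b < 1 ∧ a ≤ b ∧ Function.support φ ⊆ Icc a b := by
  by_cases hne : (tsupport φ).Nonempty
  · obtain ⟨a, ha, ha'⟩ := h.hasCompactSupport.isCompact.exists_isLeast hne
    obtain ⟨b, hb, hb'⟩ := h.hasCompactSupport.isCompact.exists_isGreatest hne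
    exact ⟨a, b, (h.tsupport_subset ha).1, (h.tsupport_subset hb).2, ha' hb,
      fun x hx => ⟨ha' (subset_tsupport _ hx), hb' (subset_tsupport _ hx)⟩⟩
  · refine ⟨1 / 2, 1 / 2, by norm_num, by norm_num, le_rfl, fun x hx => ?_⟩
    exact (hne ⟨x, subset_tsupport _ hx⟩).elim

/-- The primitive from 0 is constant to the right of the support, and mean zero makes that constant
0. The first variation is stated through `Φ'` and `Φ''`; this lemma allows any mean-zero test
function to play the role of `Φ'`. -/
theorem exists_primitive (h : IsTest φ) (h0 : ∫ t in Ioo (0 : ℝ) 1, φ t = 0) :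
    ∃ Φ : ℝ → ℝ, IsTest Φ ∧ _root_.deriv Φ = φ := by
  obtain ⟨a, b, ha, hb, hab, hs⟩ := h.support_subset_Icc
  have hz : ∀ t, t ∉ Icc a b → φ t = 0 := fun t ht => by
    by_contra hne
    exact ht (hs hne)
  have hd : ∀ t, HasDerivAt (fun t => ∫ u in (0 : ℝ)..t, φ u) (φ t) t := fun t =>
    (h.continuous.integral_hasStrictDerivAt 0 t).hasDerivAt
  have hd' : _root_.deriv (fun t => ∫ u in (0 : ℝ)..t, φ u) = φ := funext fun t => (hd t).deriv
  have hsupp : Function.support (fun t => ∫ u in (0 : ℝ)..t, φ u) ⊆ Icc a b := by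
    intro t ht
    by_contra hne
    apply ht
    rcases not_and_or.1 hne with h1 | h1
    · push Not at h1
      refine intervalIntegral.integral_zero_ae (Filter.Eventually.of_forall fun u hu => hz u ?_)
      rintro ⟨h2, -⟩
      have := hu.2
      rcases le_max_iff.1 this with h3 | h3 <;> linarith
    · push Not at h1
      have e1 : ∫ u in (0 : ℝ)..1, φ u = 0 := by
        rw [intervalIntegral.integral_of_le zero_le_one, integral_Ioc_eq_integral_Ioo, h0]
      have e2 : ∫ u in (1 : ℝ)..t, φ u = 0 := by
        refine intervalIntegral.integral_zero_ae (Filter.Eventually.of_forall fun u hu => hz u ?_)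
        rintro ⟨-, h2⟩
        have := hu.1
        rcases min_lt_iff.1 this with h3 | h3 <;> linarith
      have := intervalIntegral.integral_add_adjacent_intervals
        (h.continuous.intervalIntegrable 0 1) (h.continuous.intervalIntegrable 1 t) (μ := volume)
      change ∫ u in (0 : ℝ)..t, φ u = 0
      rw [← this, e1, e2, add_zero]
  have hts : tsupport (fun t => ∫ u in (0 : ℝ)..t, φ u) ⊆ Icc a b :=
    closure_minimal hsupp isClosed_Icc
  refine ⟨fun t => ∫ u in (0 : ℝ)..t, φ u, ⟨?_, ?_, ?_⟩, hd'⟩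
  · rw [contDiff_infty_iff_deriv, hd']
    exact ⟨fun t => (hd t).differentiableAt, h.contDiff⟩
  · exact HasCompactSupport.of_support_subset_isCompact isCompact_Icc hsupp
  · exact fun t ht => ⟨ha.trans_le (hts ht).1, (hts ht).2.trans_lt hb⟩

theorem absolutelyContinuousOnInterval (h : IsTest φ) (a b : ℝ) :
    AbsolutelyContinuousOnInterval φ a b :=
  (h.contDiff.of_le (by simp)).contDiffOn.absolutelyContinuousOnInterval

theorem exists_integral_eq_one : ∃ ρ, IsTest ρ ∧ ∫ t in Ioo (0 : ℝ) 1, ρ t = 1 := by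
  let f : ContDiffBump (1 / 2 : ℝ) := ⟨1 / 8, 1 / 4, by norm_num, by norm_num⟩
  have hf : IsTest (f.normed volume) := by
    refine ⟨f.contDiff_normed, f.hasCompactSupport_normed, ?_⟩
    rw [f.tsupport_normed_eq]
    intro x hx
    rw [Metric.mem_closedBall, Real.dist_eq, abs_le] at hx
    simp only [f] at hx
    constructor <;> linarith
  refine ⟨_, hf, ?_⟩
  have := hf.integral_eq fun _ => 1
  simp only [mul_one] at this
  rw [this, f.integral_normed]

end IsTest

/-- The **du Bois-Reymond lemma**. -/
theorem ae_eq_const_of_integral_deriv_mul_eq_zero {f : ℝ → ℝ} (hf : IntegrableOn f (Ioo 0 1))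
    (h : ∀ φ, IsTest φ → ∫ t in Ioo (0 : ℝ) 1, deriv φ t * f t = 0) :
    ∃ a, ∀ᵐ t, t ∈ Ioo (0 : ℝ) 1 → f t = a := by
  obtain ⟨ρ, hρ, hρ1⟩ := IsTest.exists_integral_eq_one
  set a := ∫ t in Ioo (0 : ℝ) 1, ρ t * f t with ha
  have hone : IntegrableOn (fun _ => (1 : ℝ)) (Ioo (0 : ℝ) 1) := by simp
  have hint : ∀ ψ, IsTest ψ → IntegrableOn ψ (Ioo 0 1) := fun ψ hψ => by
    simpa using hψ.integrableOn_mul hone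
  refine ⟨a, ?_⟩
  have key := isOpen_Ioo.ae_eq_zero_of_integral_contDiff_smul_eq_zero (μ := volume)
    (U := Ioo (0 : ℝ) 1) (f := fun t => f t - a)
    (hf.sub (integrableOn_const (by simp) (by simp))).locallyIntegrableOn ?_
  · filter_upwards [key] with t ht h't
    linarith [ht h't]
  · intro ψ h1 h2 h3
    have hψ : IsTest ψ := ⟨h1, h2, h3⟩
    simp only [smul_eq_mul]
    rw [← hψ.integral_eq]
    set m := ∫ t in Ioo (0 : ℝ) 1, ψ t with hm
    -- Subtracting `m ρ` removes the mean, so the difference is the derivative of a test function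
    -- and the hypothesis applies to it.
    have hχ : IsTest fun t => ψ t - m * ρ t := hψ.sub (hρ.const_mul m)
    obtain ⟨Φ, hΦ, hΦ'⟩ := hχ.exists_primitive (by
      rw [integral_sub (hint _ hψ) ((hint _ hρ).const_mul m), integral_const_mul, hρ1, ← hm]
      ring)
    have h4 := h Φ hΦ
    rw [hΦ'] at h4
    have e1 : ∀ t, (ψ t - m * ρ t) * f t = ψ t * f t - m * (ρ t * f t) := fun t => by ring
    have e2 : ∀ t, ψ t * (f t - a) = ψ t * f t - ψ t * a := fun t => by ring
    simp only [e1] at h4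
    rw [integral_sub (hψ.integrableOn_mul hf) ((hρ.integrableOn_mul hf).const_mul m),
      integral_const_mul, ← ha] at h4
    simp only [e2]
    rw [integral_sub (hψ.integrableOn_mul hf) ((hint _ hψ).mul_const a), integral_mul_const, ← hm]
    exact h4

theorem intervalIntegrable_zero_one_iff {g : ℝ → ℝ} :
    IntervalIntegrable g volume 0 1 ↔ IntegrableOn g (Ioo 0 1) := by
  rw [intervalIntegrable_iff_integrableOn_Ioc_of_le zero_le_one, integrableOn_Ioc_iff_integrableOn_Ioo]

/-- Integration by parts against a test function. -/
theorem IsTest.integral_deriv_mul_primitive {φ g : ℝ → ℝ} (h : IsTest φ)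
    (hg : IntegrableOn g (Ioo 0 1)) :
    ∫ t in Ioo (0 : ℝ) 1, _root_.deriv φ t * ∫ u in (0 : ℝ)..t, g u =
      -∫ t in Ioo (0 : ℝ) 1, φ t * g t := by
  have hg' := intervalIntegrable_zero_one_iff.2 hg
  have hG := hg'.absolutelyContinuousOnInterval_intervalIntegral (c := 0) (by simp)
  have key := hG.integral_mul_deriv_eq_deriv_mul (h.absolutelyContinuousOnInterval 0 1)
  rw [h.eq_zero (t := 0) (by simp), h.eq_zero (t := 1) (by simp)] at key
  have hder : ∫ t in (0 : ℝ)..1, _root_.deriv (fun x => ∫ v in (0 : ℝ)..x, g v) t * φ t =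
      ∫ t in (0 : ℝ)..1, φ t * g t := by
    refine intervalIntegral.integral_congr_ae ?_
    filter_upwards [hg'.ae_hasDerivAt_integral] with t ht h't
    rw [(ht (uIoc_subset_uIcc h't) 0 (by simp)).deriv, mul_comm]
  rw [hder] at key
  simp only [intervalIntegral.integral_of_le zero_le_one, integral_Ioc_eq_integral_Ioo] at key
  simp only [mul_comm (_root_.deriv φ _)]
  linarith

theorem integrableOn_primitive {g : ℝ → ℝ} (hg : IntegrableOn g (Ioo 0 1)) :
    IntegrableOn (fun t => ∫ u in (0 : ℝ)..t, g u) (Ioo 0 1) := by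
  have hg' := intervalIntegrable_zero_one_iff.2 hg
  have hG := hg'.absolutelyContinuousOnInterval_intervalIntegral (c := 0) (by simp)
  have := hG.continuousOn
  rw [uIcc_of_le zero_le_one] at this
  exact (this.integrableOn_Icc).mono_set Ioo_subset_Icc_self

/-- A function with an integrable weak derivative is a.e. a primitive of it. -/
theorem ae_eq_primitive_of_weakDeriv {f g : ℝ → ℝ} (hf : IntegrableOn f (Ioo 0 1))
    (hg : IntegrableOn g (Ioo 0 1))
    (h : ∀ φ, IsTest φ →
      ∫ t in Ioo (0 : ℝ) 1, deriv φ t * f t = -∫ t in Ioo (0 : ℝ) 1, φ t * g t) :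
    ∃ a, ∀ᵐ t, t ∈ Ioo (0 : ℝ) 1 → f t = a + ∫ u in (0 : ℝ)..t, g u := by
  have hG := integrableOn_primitive hg
  obtain ⟨a, ha⟩ := ae_eq_const_of_integral_deriv_mul_eq_zero (hf.sub hG) fun φ hφ => by
    have e : ∀ t, deriv φ t * (f - fun t => ∫ u in (0 : ℝ)..t, g u) t =
      deriv φ t * f t - deriv φ t * ∫ u in (0 : ℝ)..t, g u := fun t => by
        simp only [Pi.sub_apply]; ring
    simp only [e]
    rw [integral_sub (hφ.deriv.integrableOn_mul hf) (hφ.deriv.integrableOn_mul hG), h φ hφ,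
      hφ.integral_deriv_mul_primitive hg, sub_self]
  refine ⟨a, ?_⟩
  filter_upwards [ha] with t ht h't
  have := ht h't
  simp only [Pi.sub_apply] at this
  linarith

/-- If `∫ (φ' A + φ B) = 0` for all test functions `φ` of mean zero, then `A` is a.e. a primitive
of `B` minus a constant. -/
theorem ae_eq_primitive_of_mean_zero {A B : ℝ → ℝ} (hA : IntegrableOn A (Ioo 0 1))
    (hB : IntegrableOn B (Ioo 0 1))
    (h : ∀ φ, IsTest φ → ∫ t in Ioo (0 : ℝ) 1, φ t = 0 →
      ∫ t in Ioo (0 : ℝ) 1, (deriv φ t * A t + φ t * B t) = 0) :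
    ∃ a c, ∀ᵐ t, t ∈ Ioo (0 : ℝ) 1 → A t = a + ∫ u in (0 : ℝ)..t, (B u - c) := by
  obtain ⟨ρ, hρ, hρ1⟩ := IsTest.exists_integral_eq_one
  have hone : IntegrableOn (fun _ => (1 : ℝ)) (Ioo (0 : ℝ) 1) := by simp
  have hint : ∀ ψ, IsTest ψ → IntegrableOn ψ (Ioo 0 1) := fun ψ hψ => by
    simpa using hψ.integrableOn_mul hone
  -- `c` is the multiplier of the mean-zero constraint: the functional takes the value `c` at `ρ`,
  -- hence `m c` at any `φ` of mean `m`.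
  set c := (∫ t in Ioo (0 : ℝ) 1, deriv ρ t * A t) + ∫ t in Ioo (0 : ℝ) 1, ρ t * B t with hc
  obtain ⟨a, ha⟩ := ae_eq_primitive_of_weakDeriv hA
    (hB.sub (integrableOn_const (C := c) (by simp) (by simp))) fun φ hφ => by
      set m := ∫ t in Ioo (0 : ℝ) 1, φ t with hm
      have hχ : IsTest fun t => φ t - m * ρ t := hφ.sub (hρ.const_mul m)
      have h1 := h _ hχ (by
        rw [integral_sub (hint _ hφ) ((hint _ hρ).const_mul m), integral_const_mul, hρ1, ← hm]
        ring)
      have hd : ∀ t, deriv (fun t => φ t - m * ρ t) t = deriv φ t - m * deriv ρ t := fun t =>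
        ((hφ.hasDerivAt t).sub ((hρ.hasDerivAt t).const_mul m)).deriv
      have e1 : ∀ t, deriv (fun t => φ t - m * ρ t) t * A t + (φ t - m * ρ t) * B t =
        (deriv φ t * A t - m * (deriv ρ t * A t)) + (φ t * B t - m * (ρ t * B t)) := fun t => by
          rw [hd]; ring
      simp only [e1] at h1
      have i1 := hφ.deriv.integrableOn_mul hA
      have i2 := (hρ.deriv.integrableOn_mul hA).const_mul m
      have i3 := hφ.integrableOn_mul hB
      have i4 := (hρ.integrableOn_mul hB).const_mul m
      have i5 : IntegrableOn (fun t => deriv φ t * A t - m * (deriv ρ t * A t)) (Ioo 0 1) :=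
        i1.sub i2
      have i6 : IntegrableOn (fun t => φ t * B t - m * (ρ t * B t)) (Ioo 0 1) := i3.sub i4
      rw [integral_add i5 i6, integral_sub i1 i2, integral_sub i3 i4,
        integral_const_mul, integral_const_mul] at h1
      simp only [Pi.sub_apply, mul_sub]
      rw [integral_sub i3 ((hint _ hφ).mul_const c), integral_mul_const, ← hm]
      linear_combination h1 + m * hc
  exact ⟨a, c, ha⟩

/-! ### Absolute continuity, and derivatives known off a countable set -/

/-- A Lipschitz function of an absolutely continuous function is absolutely continuous. -/
theorem _root_.AbsolutelyContinuousOnInterval.comp_of_dist_le {f g : ℝ → ℝ} {a b C : ℝ}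
    (hf : AbsolutelyContinuousOnInterval f a b)
    (h : ∀ x ∈ uIcc a b, ∀ y ∈ uIcc a b, dist (g x) (g y) ≤ C * dist (f x) (f y)) :
    AbsolutelyContinuousOnInterval g a b := by
  unfold AbsolutelyContinuousOnInterval at hf ⊢
  have h2 := hf.const_mul C
  rw [mul_zero] at h2
  refine squeeze_zero' (Filter.Eventually.of_forall fun E => Finset.sum_nonneg fun i _ =>
    dist_nonneg) ?_ h2
  refine Filter.mem_inf_of_right ?_
  intro E hE
  change _ ≤ C * _
  rw [Finset.mul_sum]
  exact Finset.sum_le_sum fun i hi => h _ (hE.1 i hi).1 _ (hE.1 i hi).2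

theorem _root_.AbsolutelyContinuousOnInterval.inv_of_le {f : ℝ → ℝ} {a b m : ℝ} (hm : 0 < m)
    (hf : AbsolutelyContinuousOnInterval f a b) (h : ∀ x ∈ uIcc a b, m ≤ f x) :
    AbsolutelyContinuousOnInterval (fun x => (f x)⁻¹) a b := by
  refine hf.comp_of_dist_le (C := (m * m)⁻¹) fun x hx y hy => ?_
  have h1 := h x hx
  have h2 := h y hy
  have p1 : 0 < f x := hm.trans_le h1
  have p2 : 0 < f y := hm.trans_le h2
  rw [Real.dist_eq, Real.dist_eq, inv_sub_inv p1.ne' p2.ne', abs_div, abs_sub_comm (f y),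
    abs_of_pos (mul_pos p1 p2), div_eq_inv_mul]
  gcongr

/-- A continuous function whose derivative off a countable set is given by a continuous function
is differentiable everywhere. -/
theorem hasDerivAt_of_off_countable {E : Type*} [NormedAddCommGroup E] [NormedSpace ℝ E]
    [CompleteSpace E] {f g : ℝ → E} {S : Set ℝ} (hS : S.Countable) (hf : Continuous f)
    (hg : Continuous g) (h : ∀ x, x ∉ S → HasDerivAt f (g x) x) (x : ℝ) :
    HasDerivAt f (g x) x := by
  have e : f = fun x => f 0 + ∫ u in (0 : ℝ)..x, g u := by
    funext x
    rw [integral_eq_of_hasDerivAt_off_countable f g hS hf.continuousOn (fun y hy => h y hy.2)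
      (hg.intervalIntegrable _ _)]
    abel
  rw [e]
  exact ((hg.integral_hasStrictDerivAt 0 x).hasDerivAt).const_add (f 0)

/-- A function that is continuous on a compact interval and has zero derivative off a countable set
is constant. -/
theorem eq_of_hasDerivAt_zero_off_countable {f : ℝ → ℝ} {a b : ℝ} {S : Set ℝ} (hS : S.Countable)
    (hf : ContinuousOn f (Icc a b)) (h : ∀ x ∈ Ioo a b, x ∉ S → HasDerivAt f 0 x) :
    ∀ x ∈ Icc a b, f x = f a := by
  intro x hx
  have := integral_eq_of_hasDerivAt_off_countable_of_le f (fun _ => 0) hx.1 hS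
    (hf.mono (Icc_subset_Icc_right hx.2))
    (fun y hy => h y ⟨hy.1.1, hy.1.2.trans_le hx.2⟩ hy.2) (by simp)
  simp at this
  linarith

/-! ### Differentiating plane curves componentwise -/

theorem hasDerivWithinAt_plane_iff {γ : ℝ → Plane} {x' y' t : ℝ} {S : Set ℝ} :
    HasDerivWithinAt γ !₂[x', y'] S t ↔
      HasDerivWithinAt (fun s => γ s 0) x' S t ∧ HasDerivWithinAt (fun s => γ s 1) y' S t := by
  have h : HasDerivWithinAt γ !₂[x', y'] S t ↔
      ∀ i, HasDerivWithinAt (fun s => γ s i) ((!₂[x', y'] : Plane) i) S t := by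
    rw [hasDerivWithinAt_iff_hasFDerivWithinAt, hasFDerivWithinAt_euclidean]
    refine forall_congr' fun i => ?_
    rw [hasDerivWithinAt_iff_hasFDerivWithinAt]
    refine iff_of_eq (congrArg (fun L => HasFDerivWithinAt (fun s => γ s i) L S t) ?_)
    ext
    simp
  rw [h, Fin.forall_fin_two]
  simp

theorem hasDerivAt_plane_iff {γ : ℝ → Plane} {x' y' t : ℝ} :
    HasDerivAt γ !₂[x', y'] t ↔
      HasDerivAt (fun s => γ s 0) x' t ∧ HasDerivAt (fun s => γ s 1) y' t := by
  simp only [← hasDerivWithinAt_univ, hasDerivWithinAt_plane_iff]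

theorem plane_eta (v : Plane) : v = !₂[v 0, v 1] := by
  ext i; fin_cases i <;> simp

theorem norm_plane (x y : ℝ) : ‖(!₂[x, y] : Plane)‖ = √(x ^ 2 + y ^ 2) := by
  simp [EuclideanSpace.norm_eq]

/-! ### Regularity of immersed curves of class `W^{2,p}` -/

/-- `(x, y)` is the continuous velocity of `γ` on `[0, 1]`, extended constantly, and `(x', y')` is
its a.e. derivative. -/
structure IsVelocity (p : ℝ) (γ : ℝ → Plane) (x y x' y' : ℝ → ℝ) : Prop where
  integrable_x : Integrable x'
  integrable_y : Integrable y'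
  memLp_x : MemLp x' (ENNReal.ofReal p) (volume.restrict (Ioo (0 : ℝ) 1))
  memLp_y : MemLp y' (ENNReal.ofReal p) (volume.restrict (Ioo (0 : ℝ) 1))
  x_eq : ∀ t, x t = x 0 + ∫ u in (0 : ℝ)..t, x' u
  y_eq : ∀ t, y t = y 0 + ∫ u in (0 : ℝ)..t, y' u
  deriv_x : ∀ t ∈ Icc (0 : ℝ) 1, HasDerivWithinAt (fun s => γ s 0) (x t) (Icc 0 1) t
  deriv_y : ∀ t ∈ Icc (0 : ℝ) 1, HasDerivWithinAt (fun s => γ s 1) (y t) (Icc 0 1) t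
  exists_pos : ∃ m > 0, ∀ t, m ≤ x t ^ 2 + y t ^ 2

theorem memLpUnit_apply {p : ℝ} {f : ℝ → Plane} (h : MemLpUnit p f) (i : Fin 2) :
    MemLp (fun t => f t i) (ENNReal.ofReal p) (volume.restrict (Ioo (0 : ℝ) 1)) :=
  (EuclideanSpace.proj (𝕜 := ℝ) i).comp_memLp' h

theorem integrableOn_of_memLpUnit {p : ℝ} (hp : 2 < p) {f : ℝ → ℝ}
    (h : MemLp f (ENNReal.ofReal p) (volume.restrict (Ioo (0 : ℝ) 1))) :
    IntegrableOn f (Ioo 0 1) :=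
  h.integrable (by rw [ENNReal.one_le_ofReal]; linarith)

theorem HasWeakDeriv.apply {p : ℝ} (hp : 2 < p) {f g : ℝ → Plane} (h : HasWeakDeriv f g)
    (hf : MemLpUnit p f) (hg : MemLpUnit p g) (i : Fin 2) (φ : ℝ → ℝ) (hφ : IsTest φ) :
    ∫ t in Ioo (0 : ℝ) 1, deriv φ t * f t i = -∫ t in Ioo (0 : ℝ) 1, φ t * g t i := by
  have aux : ∀ (ψ : ℝ → ℝ), IsTest ψ → ∀ u : ℝ → Plane, MemLpUnit p u →
      ∫ t in Ioo (0 : ℝ) 1, ψ t * u t i = (∫ t in Ioo (0 : ℝ) 1, ψ t • u t) i := by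
    intro ψ hψ u hu
    obtain ⟨C, hC⟩ := hψ.exists_bound
    have hi : Integrable (fun t => ψ t • u t) (volume.restrict (Ioo (0 : ℝ) 1)) :=
      (hu.integrable (by rw [ENNReal.one_le_ofReal]; linarith)).bdd_smul C
        hψ.continuous.aestronglyMeasurable (Filter.Eventually.of_forall hC)
    simpa using (EuclideanSpace.proj (𝕜 := ℝ) i).integral_comp_comm hi
  rw [aux _ hφ.deriv f hf, aux _ hφ g hg, h φ hφ.contDiff hφ.hasCompactSupport hφ.tsupport_subset]
  simp

/-- The primitive of an integrable function, and its derivatives. -/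
theorem continuous_of_eq_primitive {x x' : ℝ → ℝ} (h' : Integrable x')
    (h : ∀ t, x t = x 0 + ∫ u in (0 : ℝ)..t, x' u) : Continuous x := by
  rw [funext h]
  exact continuous_const.add (intervalIntegral.continuous_primitive
    (fun a b => h'.intervalIntegrable) 0)

theorem absolutelyContinuousOnInterval_of_eq_primitive {x x' : ℝ → ℝ} (h' : Integrable x')
    (h : ∀ t, x t = x 0 + ∫ u in (0 : ℝ)..t, x' u) : AbsolutelyContinuousOnInterval x 0 1 := by
  rw [funext h]
  exact (contDiff_const.contDiffOn.absolutelyContinuousOnInterval).fun_add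
    ((h'.intervalIntegrable (a := 0) (b := 1)).absolutelyContinuousOnInterval_intervalIntegral
      (c := 0) (by simp))

theorem ae_hasDerivAt_of_eq_primitive {x x' : ℝ → ℝ} (h' : Integrable x')
    (h : ∀ t, x t = x 0 + ∫ u in (0 : ℝ)..t, x' u) : ∀ᵐ t, HasDerivAt x (x' t) t := by
  filter_upwards [LocallyIntegrable.ae_hasDerivAt_integral h'.locallyIntegrable] with t ht
  rw [funext h]
  exact (ht 0).const_add _

/-- `f₁` is a.e. a primitive `x` of `f₂`, and `f` is a.e. a primitive of `x`; continuity of `f`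
upgrades the second statement to all of `[0, 1]`. Cutting `f₂` off outside `(0, 1)` makes `x`
constant on either side, so that later bounds hold on all of `ℝ`. -/
theorem exists_velocity_component {p : ℝ} (hp : 2 < p) {f f₁ f₂ : ℝ → ℝ}
    (hf : MemLp f (ENNReal.ofReal p) (volume.restrict (Ioo (0 : ℝ) 1)))
    (hf₁ : MemLp f₁ (ENNReal.ofReal p) (volume.restrict (Ioo (0 : ℝ) 1)))
    (hf₂ : MemLp f₂ (ENNReal.ofReal p) (volume.restrict (Ioo (0 : ℝ) 1)))
    (hc : ContinuousOn f (Icc 0 1))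
    (h₁ : ∀ φ, IsTest φ →
      ∫ t in Ioo (0 : ℝ) 1, deriv φ t * f t = -∫ t in Ioo (0 : ℝ) 1, φ t * f₁ t)
    (h₂ : ∀ φ, IsTest φ →
      ∫ t in Ioo (0 : ℝ) 1, deriv φ t * f₁ t = -∫ t in Ioo (0 : ℝ) 1, φ t * f₂ t) :
    ∃ x x' : ℝ → ℝ, Integrable x' ∧
      MemLp x' (ENNReal.ofReal p) (volume.restrict (Ioo (0 : ℝ) 1)) ∧
      (∀ t, x t = x 0 + ∫ u in (0 : ℝ)..t, x' u) ∧
      (∀ t ∈ Icc (0 : ℝ) 1, HasDerivWithinAt f (x t) (Icc 0 1) t) ∧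
      (∀ t ≤ 0, x t = x 0) ∧ (∀ t, 1 ≤ t → x t = x 1) := by
  have i₂ := integrableOn_of_memLpUnit hp hf₂
  have i₁ := integrableOn_of_memLpUnit hp hf₁
  obtain ⟨a, ha⟩ := ae_eq_primitive_of_weakDeriv i₁ i₂ h₂
  obtain ⟨b, hb⟩ := ae_eq_primitive_of_weakDeriv (integrableOn_of_memLpUnit hp hf) i₁ h₁
  set x' : ℝ → ℝ := (Ioo (0 : ℝ) 1).indicator f₂ with hx'
  set x : ℝ → ℝ := fun t => a + ∫ u in (0 : ℝ)..t, x' u with hx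
  have hint : Integrable x' := i₂.integrable_indicator measurableSet_Ioo
  have hx0 : x 0 = a := by simp [hx]
  have hxe : ∀ t, x t = x 0 + ∫ u in (0 : ℝ)..t, x' u := fun t => by rw [hx0]
  have hxc := continuous_of_eq_primitive hint hxe
  have hzero : ∀ s t : ℝ, (t ≤ 0 ∧ s ≤ 0) ∨ (1 ≤ t ∧ 1 ≤ s) → ∫ u in s..t, x' u = 0 := by
    intro s t hst
    refine intervalIntegral.integral_zero_ae (Filter.Eventually.of_forall fun u hu => ?_)
    refine indicator_of_notMem (fun hu' => ?_) _
    have h1 := hu.1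
    have h2 := hu.2
    rw [min_lt_iff] at h1
    rw [le_max_iff] at h2
    rcases hst with ⟨_, _⟩ | ⟨_, _⟩
    · rcases h2 with h2 | h2 <;> linarith [hu'.1]
    · rcases h1 with h1 | h1 <;> linarith [hu'.2]
  refine ⟨x, x', hint, ?_, hxe, ?_, ?_, ?_⟩
  · exact hf₂.ae_eq ((indicator_ae_eq_restrict measurableSet_Ioo).symm)
  · have hprim : EqOn f (fun t => b + ∫ u in (0 : ℝ)..t, x u) (Icc 0 1) := by
      refine Measure.eqOn_Icc_of_ae_eq volume zero_ne_one ?_ hc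
        (continuous_const.add (intervalIntegral.continuous_primitive
          (fun a b => hxc.intervalIntegrable a b) 0)).continuousOn
      rw [restrict_Ioo_eq_restrict_Icc.symm, Filter.EventuallyEq,
        ae_restrict_iff' measurableSet_Ioo]
      filter_upwards [hb] with t ht h't
      rw [ht h't]
      congr 1
      refine intervalIntegral.integral_congr_ae ?_
      filter_upwards [ha] with u hu h'u
      rw [uIoc_of_le h't.1.le] at h'u
      have h2u : u ∈ Ioo (0 : ℝ) 1 := ⟨h'u.1, h'u.2.trans_lt h't.2⟩
      rw [hu h2u, hx]
      dsimp only
      congr 1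
      refine intervalIntegral.integral_congr_ae (Filter.Eventually.of_forall fun v hv => ?_)
      rw [uIoc_of_le h2u.1.le] at hv
      exact (indicator_of_mem (show v ∈ Ioo (0 : ℝ) 1 from ⟨hv.1, hv.2.trans_lt h2u.2⟩) _).symm
    intro t ht
    exact (((hxc.integral_hasStrictDerivAt 0 t).hasDerivAt.const_add b).hasDerivWithinAt).congr
      hprim (hprim ht)
  · intro t ht
    rw [hxe t, hzero 0 t (Or.inl ⟨ht, le_rfl⟩), add_zero]
  · intro t ht
    rw [hxe t, hxe 1, ← intervalIntegral.integral_add_adjacent_intervals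
      (hint.intervalIntegrable (a := 0) (b := 1)) (hint.intervalIntegrable (a := 1) (b := t)),
      hzero 1 t (Or.inr ⟨ht, le_rfl⟩), add_zero]

/-- The immersion condition and compactness bound the speed below on `[0, 1]`, and the constant
extension carries the bound to `ℝ`. Negative powers of the speed are controlled by it throughout. -/
theorem IsImmersedW2p.exists_isVelocity {p : ℝ} (hp : 2 < p) {γ : ℝ → Plane}
    (h : IsImmersedW2p p γ) : ∃ x y x' y', IsVelocity p γ x y x' y' := by
  obtain ⟨⟨hc, γ₁, γ₂, hw₁, hw₂, m₀, m₁, m₂⟩, hne⟩ := h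
  have hci : ∀ i : Fin 2, ContinuousOn (fun t => γ t i) (Icc 0 1) := fun i =>
    (EuclideanSpace.proj (𝕜 := ℝ) i).continuous.comp_continuousOn hc
  have key := fun i : Fin 2 => exists_velocity_component hp (memLpUnit_apply m₀ i)
    (memLpUnit_apply m₁ i) (memLpUnit_apply m₂ i) (hci i) (hw₁.apply hp m₀ m₁ i)
    (hw₂.apply hp m₁ m₂ i)
  obtain ⟨x, x', ix, lx, ex, dx, xl, xr⟩ := key 0
  obtain ⟨y, y', iy, ly, ey, dy, yl, yr⟩ := key 1
  refine ⟨x, y, x', y', ix, iy, lx, ly, ex, ey, dx, dy, ?_⟩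
  have hpos : ∀ t ∈ Icc (0 : ℝ) 1, 0 < x t ^ 2 + y t ^ 2 := by
    intro t ht
    by_contra hle
    have h0 : x t = 0 ∧ y t = 0 := by
      constructor <;> nlinarith [sq_nonneg (x t), sq_nonneg (y t)]
    apply hne t ht
    have hd : HasDerivWithinAt γ !₂[x t, y t] (Icc 0 1) t :=
      hasDerivWithinAt_plane_iff.2 ⟨dx t ht, dy t ht⟩
    rw [hd.derivWithin (uniqueDiffOn_Icc zero_lt_one t ht), h0.1, h0.2]
    ext i; fin_cases i <;> simp
  have hcont : Continuous fun t => x t ^ 2 + y t ^ 2 :=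
    ((continuous_of_eq_primitive ix ex).pow 2).add ((continuous_of_eq_primitive iy ey).pow 2)
  obtain ⟨t₀, ht₀, hmin⟩ := isCompact_Icc.exists_isMinOn (nonempty_Icc.2 zero_le_one)
    hcont.continuousOn
  refine ⟨_, hpos t₀ ht₀, fun t => ?_⟩
  rcases le_total t 0 with h0 | h0
  · rw [xl t h0, yl t h0]
    exact hmin (by simp)
  rcases le_total t 1 with h1 | h1
  · exact hmin ⟨h0, h1⟩
  · rw [xr t h1, yr t h1]
    exact hmin (by simp)

namespace IsVelocity

variable {p : ℝ} {γ : ℝ → Plane} {x y x' y' : ℝ → ℝ}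

theorem continuous_x (h : IsVelocity p γ x y x' y') : Continuous x :=
  continuous_of_eq_primitive h.integrable_x h.x_eq

theorem continuous_y (h : IsVelocity p γ x y x' y') : Continuous y :=
  continuous_of_eq_primitive h.integrable_y h.y_eq

theorem hasDerivAt (h : IsVelocity p γ x y x' y') {t : ℝ} (ht : t ∈ Ioo (0 : ℝ) 1) :
    HasDerivAt γ !₂[x t, y t] t :=
  (hasDerivWithinAt_plane_iff.2 ⟨h.deriv_x t (Ioo_subset_Icc_self ht),
    h.deriv_y t (Ioo_subset_Icc_self ht)⟩).hasDerivAt (Icc_mem_nhds ht.1 ht.2)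

theorem exists_bound (h : IsVelocity p γ x y x' y') :
    ∃ C ≥ 1, ∀ t ∈ Ioo (0 : ℝ) 1, |x t| ≤ C ∧ |y t| ≤ C := by
  obtain ⟨C, hC⟩ := (isCompact_Icc (a := (0 : ℝ)) (b := 1)).exists_bound_of_continuousOn
    h.continuous_x.continuousOn
  obtain ⟨D, hD⟩ := (isCompact_Icc (a := (0 : ℝ)) (b := 1)).exists_bound_of_continuousOn
    h.continuous_y.continuousOn
  exact ⟨max 1 (max C D), le_max_left _ _, fun t ht =>
    ⟨(hC t (Ioo_subset_Icc_self ht)).trans ((le_max_left _ _).trans (le_max_right _ _)),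
      (hD t (Ioo_subset_Icc_self ht)).trans ((le_max_right _ _).trans (le_max_right _ _))⟩⟩

end IsVelocity

/-- Adding both endpoint values gives a bound that does not depend on the sign of the exponent. -/
theorem rpow_le_of_mem_Icc {m M N e : ℝ} (hm : 0 < m) (h1 : m ≤ N) (h2 : N ≤ M) :
    N ^ e ≤ m ^ e + M ^ e := by
  have hM : 0 < M := hm.trans_le (h1.trans h2)
  rcases le_total 0 e with he | he
  · exact (rpow_le_rpow (hm.le.trans h1) h2 he).trans (le_add_of_nonneg_left (rpow_nonneg hm.le e))
  · exact (rpow_le_rpow_of_nonpos hm h1 he).trans (le_add_of_nonneg_right (rpow_nonneg hM.le e))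

theorem hasDerivAt_abs_rpow_mul_rpow {p e : ℝ} (hp : 2 < p) {D N : ℝ → ℝ} {D' N' ε : ℝ}
    (hD : HasDerivAt D D' ε) (hN : HasDerivAt N N' ε) (h0 : 0 < N ε) :
    HasDerivAt (fun ε => |D ε| ^ p * N ε ^ e)
      (p * |D ε| ^ (p - 2) * D ε * D' * N ε ^ e + |D ε| ^ p * (e * N ε ^ (e - 1) * N')) ε := by
  have h1 := (hasDerivAt_abs_rpow (D ε) (by linarith : 1 < p)).comp ε hD
  have h2 := hN.rpow_const (p := e) (Or.inl h0.ne')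
  refine (h1.mul h2).congr_deriv ?_
  simp only [Function.comp]
  ring

/-- Differentiation under the integral sign for energies with density `|D|^p N^e`. -/
theorem hasDerivAt_integral_abs_rpow_mul_rpow {ν : Measure ℝ} {p e : ℝ} (hp : 2 < p)
    {D D' N N' : ℝ → ℝ → ℝ} {G : ℝ → ℝ} {δ m M R : ℝ} (hδ : 0 < δ) (hm : 0 < m) (hR : 0 ≤ R)
    (mD : ∀ ε, AEStronglyMeasurable (D ε) ν) (mD' : AEStronglyMeasurable (D' 0) ν)
    (mN : ∀ ε, AEStronglyMeasurable (N ε) ν) (mN' : AEStronglyMeasurable (N' 0) ν)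
    (hG : ∀ t, 1 ≤ G t) (iG : Integrable (fun t => G t ^ p) ν)
    (h : ∀ᵐ t ∂ν, ∀ ε ∈ Metric.ball (0 : ℝ) δ,
      HasDerivAt (fun ε => D ε t) (D' ε t) ε ∧ HasDerivAt (fun ε => N ε t) (N' ε t) ε ∧
      |D ε t| ≤ R * G t ∧ |D' ε t| ≤ R * G t ∧ m ≤ N ε t ∧ N ε t ≤ M ∧ |N' ε t| ≤ R) :
    Integrable (fun t => p * |D 0 t| ^ (p - 2) * D 0 t * D' 0 t * N 0 t ^ e +
        |D 0 t| ^ p * (e * N 0 t ^ (e - 1) * N' 0 t)) ν ∧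
      HasDerivAt (fun ε => ∫ t, |D ε t| ^ p * N ε t ^ e ∂ν)
        (∫ t, (p * |D 0 t| ^ (p - 2) * D 0 t * D' 0 t * N 0 t ^ e +
          |D 0 t| ^ p * (e * N 0 t ^ (e - 1) * N' 0 t)) ∂ν) 0 := by
  have mF : ∀ ε, AEStronglyMeasurable (fun t => |D ε t| ^ p * N ε t ^ e) ν := fun ε =>
    (((mD ε).norm.aemeasurable.pow_const p).mul
      ((mN ε).aemeasurable.pow_const e)).aestronglyMeasurable
  have h0 : (0 : ℝ) ∈ Metric.ball (0 : ℝ) δ := Metric.mem_ball_self hδ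
  have bD : ∀ a g, 1 ≤ g → |a| ≤ R * g → |a| ^ p ≤ R ^ p * g ^ p := fun a g hg ha => by
    rw [← mul_rpow hR (by linarith)]
    exact rpow_le_rpow (abs_nonneg _) ha (by linarith)
  refine hasDerivAt_integral_of_dominated_loc_of_deriv_le (s := Metric.ball 0 δ)
    (F' := fun ε t => p * |D ε t| ^ (p - 2) * D ε t * D' ε t * N ε t ^ e +
        |D ε t| ^ p * (e * N ε t ^ (e - 1) * N' ε t))
    (bound := fun t => (p * R ^ p * (m ^ e + M ^ e) +
      R ^ p * (|e| * (m ^ (e - 1) + M ^ (e - 1)) * R)) * G t ^ p)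
    (Metric.ball_mem_nhds _ hδ) (Filter.Eventually.of_forall mF) ?_ ?_ ?_ (iG.const_mul _) ?_
  · refine Integrable.mono' (iG.const_mul (R ^ p * (m ^ e + M ^ e))) (mF 0) ?_
    filter_upwards [h] with t ht
    obtain ⟨-, -, h1, -, h2, h3, -⟩ := ht 0 h0
    have hN := hm.trans_le h2
    rw [Real.norm_eq_abs, abs_of_nonneg (by positivity)]
    calc |D 0 t| ^ p * N 0 t ^ e ≤ (R ^ p * G t ^ p) * (m ^ e + M ^ e) := by
          have := bD _ _ (hG t) h1
          have := rpow_le_of_mem_Icc (e := e) hm h2 h3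
          have : 0 ≤ G t := by linarith [hG t]
          gcongr
      _ = _ := by ring
  · refine AEMeasurable.aestronglyMeasurable ?_
    have d := (mD 0).aemeasurable
    have d' := mD'.aemeasurable
    have n := (mN 0).aemeasurable
    have n' := mN'.aemeasurable
    have da : AEMeasurable (fun t => |D 0 t|) ν := (mD 0).norm.aemeasurable
    exact (((((da.pow_const (p - 2)).const_mul p).mul d).mul d').mul (n.pow_const e)).add
      ((da.pow_const p).mul (((n.pow_const (e - 1)).const_mul e).mul n'))
  · filter_upwards [h] with t ht ε hε
    obtain ⟨-, -, h1, h1', h2, h3, h4⟩ := ht ε hε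
    have hN := hm.trans_le h2
    have hM := hN.trans_le h3
    have hg := hG t
    have hg0 : 0 ≤ G t := by linarith
    have hp0 : 0 ≤ p := by linarith
    have e1 := rpow_le_of_mem_Icc (e := e) hm h2 h3
    have e2 := rpow_le_of_mem_Icc (e := e - 1) hm h2 h3
    have e3 := bD _ _ hg h1
    -- `D` and its derivative in `ε` are both at most `R G`, so `p - 1` factors of the one and a
    -- single factor of the other stay within the integrable `G^p`.
    have e4 : |D ε t| ^ (p - 2) * |D ε t| * |D' ε t| ≤ R ^ p * G t ^ p := by
      have k1 : |D ε t| ^ (p - 2) * |D ε t| = |D ε t| ^ (p - 1) := by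
        rcases (abs_nonneg (D ε t)).eq_or_lt with h5 | h5
        · rw [← h5, mul_zero, zero_rpow (by linarith)]
        · rw [← rpow_add_one h5.ne']
          congr 1; ring
      have k2 : |D ε t| ^ (p - 1) ≤ (R * G t) ^ (p - 1) :=
        rpow_le_rpow (abs_nonneg _) h1 (by linarith)
      have k3 : (R * G t) ^ (p - 1) * (R * G t) = R ^ p * G t ^ p := by
        rw [← mul_rpow hR hg0]
        rcases (mul_nonneg hR hg0).eq_or_lt with h5 | h5
        · rw [← h5, mul_zero, zero_rpow (by linarith)]
        · rw [← rpow_add_one h5.ne']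
          congr 1; ring
      rw [k1, ← k3]
      gcongr
    rw [Real.norm_eq_abs]
    refine (abs_add_le _ _).trans ?_
    have a1 : |p * |D ε t| ^ (p - 2) * D ε t * D' ε t * N ε t ^ e| =
        p * (|D ε t| ^ (p - 2) * |D ε t| * |D' ε t|) * N ε t ^ e := by
      rw [abs_mul, abs_mul, abs_mul, abs_mul, abs_of_nonneg hp0,
        abs_of_nonneg (rpow_nonneg (abs_nonneg (D ε t)) _), abs_of_nonneg (rpow_nonneg hN.le _)]
      ring
    have a2 : |(|D ε t| ^ p * (e * N ε t ^ (e - 1) * N' ε t))| =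
        |D ε t| ^ p * (|e| * N ε t ^ (e - 1) * |N' ε t|) := by
      rw [abs_mul, abs_mul, abs_mul, abs_of_nonneg (rpow_nonneg (abs_nonneg (D ε t)) _),
        abs_of_nonneg (rpow_nonneg hN.le _)]
    rw [a1, a2, add_mul]
    have b1 : p * (|D ε t| ^ (p - 2) * |D ε t| * |D' ε t|) * N ε t ^ e ≤
        p * (R ^ p * G t ^ p) * (m ^ e + M ^ e) := by gcongr
    have b2 : |D ε t| ^ p * (|e| * N ε t ^ (e - 1) * |N' ε t|) ≤
        (R ^ p * G t ^ p) * (|e| * (m ^ (e - 1) + M ^ (e - 1)) * R) := by gcongr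
    nlinarith [b1, b2]
  · filter_upwards [h] with t ht ε hε
    obtain ⟨h1, h2, -, -, h3, -⟩ := ht ε hε
    exact hasDerivAt_abs_rpow_mul_rpow hp h1 h2 (hm.trans_le h3)

/-! ### The first variation -/

/-- The curvature contributes the speed to the power `-3p` and the line element one more factor. In
terms of the squared speed the exponent is `(1 - 3p) / 2`, and both bases are polynomial in the
perturbation parameter. -/
theorem signedCurvature_energy_density {p X Y X' Y' : ℝ} (hN : 0 < X ^ 2 + Y ^ 2) :
    |(X * Y' - Y * X') / √(X ^ 2 + Y ^ 2) ^ 3| ^ p * √(X ^ 2 + Y ^ 2) =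
      |X * Y' - Y * X'| ^ p * (X ^ 2 + Y ^ 2) ^ ((1 - 3 * p) / 2) := by
  rw [abs_div, abs_of_nonneg (pow_nonneg (sqrt_nonneg (X ^ 2 + Y ^ 2)) 3),
    div_rpow (abs_nonneg _) (by positivity), sqrt_eq_rpow, ← rpow_natCast, ← rpow_mul hN.le,
    ← rpow_mul hN.le, div_mul_eq_mul_div, mul_div_assoc, ← rpow_sub hN]
  congr 2
  push_cast
  ring

/-- The single crude constant `8 C²` serves all upper bounds. The squared speed loses at most `4 |ε|
C²`, which the smallness of `ε` keeps below `m / 2`. -/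
theorem perturbation_bounds {x y x' y' a b a' b' C m ε : ℝ} (hC1 : 1 ≤ C) (hx : |x| ≤ C)
    (hy : |y| ≤ C) (ha : |a| ≤ C) (hb : |b| ≤ C) (ha' : |a'| ≤ C) (hb' : |b'| ≤ C) (hε1 : |ε| ≤ 1)
    (hε2 : |ε| * (8 * C ^ 2) ≤ m) (hm : m ≤ x ^ 2 + y ^ 2) :
    |(x + ε * a) * (y' + ε * b') - (y + ε * b) * (x' + ε * a')| ≤
        8 * C ^ 2 * (1 + |x'| + |y'|) ∧
      |a * (y' + ε * b') + (x + ε * a) * b' - (b * (x' + ε * a') + (y + ε * b) * a')| ≤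
        8 * C ^ 2 * (1 + |x'| + |y'|) ∧
      m / 2 ≤ (x + ε * a) ^ 2 + (y + ε * b) ^ 2 ∧
      (x + ε * a) ^ 2 + (y + ε * b) ^ 2 ≤ 8 * C ^ 2 ∧
      |2 * (x + ε * a) * a + 2 * (y + ε * b) * b| ≤ 8 * C ^ 2 := by
  have hC0 : 0 < C := by linarith
  have hadd : ∀ a b A B : ℝ, |a| ≤ A → |b| ≤ B → |a + ε * b| ≤ A + B := fun a b A B ha hb => by
    refine (abs_add_le _ _).trans (add_le_add ha ?_)
    rw [abs_mul]
    exact (mul_le_of_le_one_left (abs_nonneg b) hε1).trans hb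
  have hmul : ∀ a b A B : ℝ, 0 ≤ A → |a| ≤ A → |b| ≤ B → |a * b| ≤ A * B :=
    fun a b A B hA ha hb => by
      rw [abs_mul]
      exact mul_le_mul ha hb (abs_nonneg _) hA
  have cX : |x + ε * a| ≤ 2 * C := (hadd _ _ _ _ hx ha).trans_eq (by ring)
  have cY : |y + ε * b| ≤ 2 * C := (hadd _ _ _ _ hy hb).trans_eq (by ring)
  have cX' : |x' + ε * a'| ≤ |x'| + C := hadd _ _ _ _ le_rfl ha'
  have cY' : |y' + ε * b'| ≤ |y'| + C := hadd _ _ _ _ le_rfl hb'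
  have hCC : C ≤ C ^ 2 := by nlinarith
  have q1 : C * |x'| ≤ C ^ 2 * |x'| := by gcongr
  have q2 : C * |y'| ≤ C ^ 2 * |y'| := by gcongr
  have q3 : 0 ≤ C ^ 2 * |x'| := by positivity
  have q4 : 0 ≤ C ^ 2 * |y'| := by positivity
  have q5 : 0 ≤ C ^ 2 := by positivity
  refine ⟨?_, ?_, ?_, ?_, ?_⟩
  · have k1 := hmul _ _ _ _ (by positivity) cX cY'
    have k2 := hmul _ _ _ _ (by positivity) cY cX'
    have k3 := (abs_sub _ _).trans (add_le_add k1 k2)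
    linarith
  · have k1 := hmul _ _ _ _ hC0.le ha cY'
    have k2 := hmul _ _ _ _ (by positivity) cX hb'
    have k3 := hmul _ _ _ _ hC0.le hb cX'
    have k4 := hmul _ _ _ _ (by positivity) cY ha'
    have k5 := (abs_sub _ _).trans (add_le_add ((abs_add_le _ _).trans (add_le_add k1 k2))
      ((abs_add_le _ _).trans (add_le_add k3 k4)))
    linarith
  · have k1 := hmul _ _ _ _ hC0.le hx ha
    have k2 := hmul _ _ _ _ hC0.le hy hb
    have k3 := hmul ε _ _ _ (abs_nonneg ε) le_rfl ((abs_add_le _ _).trans (add_le_add k1 k2))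
    have k4 := (abs_le.1 k3).1
    have k5 := sq_nonneg (ε * a)
    have k6 := sq_nonneg (ε * b)
    linarith
  · have k1 := sq_le_sq' (abs_le.1 cX).1 (abs_le.1 cX).2
    have k2 := sq_le_sq' (abs_le.1 cY).1 (abs_le.1 cY).2
    linarith
  · have k1 := hmul _ _ _ _ (by positivity) cX ha
    have k2 := hmul _ _ _ _ (by positivity) cY hb
    have k3 : 2 * (x + ε * a) * a + 2 * (y + ε * b) * b =
      2 * ((x + ε * a) * a + (y + ε * b) * b) := by ring
    rw [k3, abs_mul, abs_of_pos (by norm_num : (0 : ℝ) < 2)]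
    have := (abs_add_le _ _).trans (add_le_add k1 k2)
    linarith

namespace IsVelocity

variable {p : ℝ} {γ : ℝ → Plane} {x y x' y' : ℝ → ℝ}

theorem ae_hasDerivAt (h : IsVelocity p γ x y x' y') :
    ∀ᵐ t, HasDerivAt x (x' t) t ∧ HasDerivAt y (y' t) t := by
  filter_upwards [ae_hasDerivAt_of_eq_primitive h.integrable_x h.x_eq,
    ae_hasDerivAt_of_eq_primitive h.integrable_y h.y_eq] with t h1 h2 using ⟨h1, h2⟩

theorem deriv_perturb (h : IsVelocity p γ x y x' y') {Φ : ℝ → ℝ} (hΦ : IsTest Φ) (α β ε : ℝ)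
    {t : ℝ} (ht : t ∈ Ioo (0 : ℝ) 1) :
    deriv (γ + ε • fun t => (!₂[α * Φ t, β * Φ t] : Plane)) t =
      !₂[x t + ε * (α * deriv Φ t), y t + ε * (β * deriv Φ t)] := by
  refine HasDerivAt.deriv (hasDerivAt_plane_iff.2 ?_)
  obtain ⟨h1, h2⟩ := hasDerivAt_plane_iff.1 (h.hasDerivAt ht)
  constructor
  · simpa using h1.fun_add (((hΦ.hasDerivAt t).const_mul α).const_mul ε)
  · simpa using h2.fun_add (((hΦ.hasDerivAt t).const_mul β).const_mul ε)

theorem deriv_deriv_perturb (h : IsVelocity p γ x y x' y') {Φ : ℝ → ℝ} (hΦ : IsTest Φ)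
    (α β ε : ℝ) {t : ℝ} (ht : t ∈ Ioo (0 : ℝ) 1) (hx : HasDerivAt x (x' t) t)
    (hy : HasDerivAt y (y' t) t) :
    deriv (deriv (γ + ε • fun t => (!₂[α * Φ t, β * Φ t] : Plane))) t =
      !₂[x' t + ε * (α * deriv (deriv Φ) t), y' t + ε * (β * deriv (deriv Φ) t)] := by
  have he : deriv (γ + ε • fun t => (!₂[α * Φ t, β * Φ t] : Plane)) =ᶠ[nhds t]
      fun t => !₂[x t + ε * (α * deriv Φ t), y t + ε * (β * deriv Φ t)] := by
    filter_upwards [isOpen_Ioo.mem_nhds ht] with u hu using h.deriv_perturb hΦ α β ε hu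
  rw [he.deriv_eq]
  refine HasDerivAt.deriv (hasDerivAt_plane_iff.2 ?_)
  constructor
  · simpa using hx.fun_add (((hΦ.deriv.hasDerivAt t).const_mul α).const_mul ε)
  · simpa using hy.fun_add (((hΦ.deriv.hasDerivAt t).const_mul β).const_mul ε)

theorem integrable_rpow (h : IsVelocity p γ x y x' y') (hp : 2 < p) :
    Integrable (fun t => (1 + |x' t| + |y' t|) ^ p) (volume.restrict (Ioo (0 : ℝ) 1)) := by
  have h1 : MemLp (fun t => 1 + |x' t| + |y' t|) (ENNReal.ofReal p)
      (volume.restrict (Ioo (0 : ℝ) 1)) := by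
    have h0 : MemLp (fun _ : ℝ => (1 : ℝ)) (ENNReal.ofReal p)
        (volume.restrict (Ioo (0 : ℝ) 1)) := memLp_const 1
    exact (h0.add h.memLp_x.abs).add h.memLp_y.abs
  have h2 := h1.integrable_norm_rpow (by simp; linarith) (by simp)
  rw [ENNReal.toReal_ofReal (by linarith)] at h2
  refine h2.congr (Filter.Eventually.of_forall fun t => ?_)
  have : 0 ≤ 1 + |x' t| + |y' t| := by positivity
  simp only [Real.norm_eq_abs, abs_of_nonneg this]

/-- Perturbations along a fixed vector `(α, β)` suffice. Only `Φ'` and `Φ''` occur, by translation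
invariance, and this is what allows the equation to be integrated once. -/
theorem integral_first_variation (h : IsVelocity p γ x y x' y') (hp : 2 < p) {μ : ℝ}
    (hcrit : ∀ η : ℝ → Plane, ContDiff ℝ ∞ η → HasCompactSupport η → tsupport η ⊆ Ioo 0 1 →
      HasDerivAt (fun ε : ℝ => bendingEnergy p (γ + ε • η) + μ * length (γ + ε • η)) 0 0)
    {Φ : ℝ → ℝ} (hΦ : IsTest Φ) {α β : ℝ} (hα : |α| ≤ 1) (hβ : |β| ≤ 1) :
    ∫ t in Ioo (0 : ℝ) 1,
      (p * |x t * y' t - y t * x' t| ^ (p - 2) * (x t * y' t - y t * x' t) *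
          (x t ^ 2 + y t ^ 2) ^ ((1 - 3 * p) / 2) *
          (α * deriv Φ t * y' t + x t * (β * deriv (deriv Φ) t) -
            (β * deriv Φ t * x' t + y t * (α * deriv (deriv Φ) t))) +
        ((1 - 3 * p) / 2 * |x t * y' t - y t * x' t| ^ p *
            (x t ^ 2 + y t ^ 2) ^ ((1 - 3 * p) / 2 - 1) +
          μ * (1 / 2 * (x t ^ 2 + y t ^ 2) ^ ((1 : ℝ) / 2 - 1))) *
          (2 * x t * (α * deriv Φ t) + 2 * y t * (β * deriv Φ t))) = 0 := by
  obtain ⟨C₀, hC₀, hxy⟩ := h.exists_bound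
  obtain ⟨C₁, hC₁⟩ := hΦ.deriv.exists_bound
  obtain ⟨C₂, hC₂⟩ := hΦ.deriv.deriv.exists_bound
  obtain ⟨m, hm, hmN⟩ := h.exists_pos
  set C := max C₀ (max C₁ C₂)
  have hC1 : 1 ≤ C := hC₀.trans (le_max_left _ _)
  have bx : ∀ t ∈ Ioo (0 : ℝ) 1, |x t| ≤ C := fun t ht => (hxy t ht).1.trans (le_max_left _ _)
  have by_ : ∀ t ∈ Ioo (0 : ℝ) 1, |y t| ≤ C := fun t ht => (hxy t ht).2.trans (le_max_left _ _)
  have bφ : ∀ t, |deriv Φ t| ≤ C := fun t =>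
    (hC₁ t).trans ((le_max_left _ _).trans (le_max_right _ _))
  have bφ' : ∀ t, |deriv (deriv Φ) t| ≤ C := fun t =>
    (hC₂ t).trans ((le_max_right _ _).trans (le_max_right _ _))
  clear_value C
  have hC0 : 0 < C := by linarith
  set ν := volume.restrict (Ioo (0 : ℝ) 1) with hν
  set X : ℝ → ℝ → ℝ := fun ε t => x t + ε * (α * deriv Φ t) with hX
  set Y : ℝ → ℝ → ℝ := fun ε t => y t + ε * (β * deriv Φ t) with hY
  set X' : ℝ → ℝ → ℝ := fun ε t => x' t + ε * (α * deriv (deriv Φ) t) with hX'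
  set Y' : ℝ → ℝ → ℝ := fun ε t => y' t + ε * (β * deriv (deriv Φ) t) with hY'
  set D : ℝ → ℝ → ℝ := fun ε t => X ε t * Y' ε t - Y ε t * X' ε t with hD
  set D' : ℝ → ℝ → ℝ := fun ε t => α * deriv Φ t * Y' ε t + X ε t * (β * deriv (deriv Φ) t) -
    (β * deriv Φ t * X' ε t + Y ε t * (α * deriv (deriv Φ) t)) with hD'
  set N : ℝ → ℝ → ℝ := fun ε t => X ε t ^ 2 + Y ε t ^ 2 with hN
  set N' : ℝ → ℝ → ℝ := fun ε t =>
    2 * X ε t * (α * deriv Φ t) + 2 * Y ε t * (β * deriv Φ t) with hN'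
  set G : ℝ → ℝ := fun t => 1 + |x' t| + |y' t| with hG
  have hG1 : ∀ t, 1 ≤ G t := fun t => by
    have := abs_nonneg (x' t); have := abs_nonneg (y' t)
    simp only [hG]; linarith
  set δ := min 1 (m / (8 * C ^ 2)) with hδ
  have hδ0 : 0 < δ := by positivity
  have hae : ∀ᵐ t ∂ν, ∀ ε ∈ Metric.ball (0 : ℝ) δ,
      HasDerivAt (fun ε => D ε t) (D' ε t) ε ∧ HasDerivAt (fun ε => N ε t) (N' ε t) ε ∧
      |D ε t| ≤ 8 * C ^ 2 * G t ∧ |D' ε t| ≤ 8 * C ^ 2 * G t ∧ m / 2 ≤ N ε t ∧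
      N ε t ≤ 8 * C ^ 2 ∧ |N' ε t| ≤ 8 * C ^ 2 := by
    rw [hν, ae_restrict_iff' measurableSet_Ioo]
    refine Filter.Eventually.of_forall fun t ht ε hε => ?_
    rw [Metric.mem_ball, dist_zero_right, Real.norm_eq_abs] at hε
    have hε1 : |ε| ≤ 1 := hε.le.trans (min_le_left _ _)
    have hε2 : |ε| * (8 * C ^ 2) ≤ m := by
      have := hε.le.trans (min_le_right _ _)
      rwa [le_div_iff₀ (by positivity)] at this
    have hlin : ∀ a b : ℝ, HasDerivAt (fun ε : ℝ => a + ε * b) b ε := fun a b => by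
      simpa using ((hasDerivAt_id ε).mul_const b).const_add a
    have dX : HasDerivAt (fun ε => X ε t) (α * deriv Φ t) ε := hlin _ _
    have dY : HasDerivAt (fun ε => Y ε t) (β * deriv Φ t) ε := hlin _ _
    have dX' : HasDerivAt (fun ε => X' ε t) (α * deriv (deriv Φ) t) ε := hlin _ _
    have dY' : HasDerivAt (fun ε => Y' ε t) (β * deriv (deriv Φ) t) ε := hlin _ _
    have aφ : |α * deriv Φ t| ≤ C := by
      rw [abs_mul]; nlinarith [abs_nonneg (deriv Φ t), bφ t, abs_nonneg α]
    have bφ1 : |β * deriv Φ t| ≤ C := by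
      rw [abs_mul]; nlinarith [abs_nonneg (deriv Φ t), bφ t, abs_nonneg β]
    have aφ' : |α * deriv (deriv Φ) t| ≤ C := by
      rw [abs_mul]; nlinarith [abs_nonneg (deriv (deriv Φ) t), bφ' t, abs_nonneg α]
    have bφ1' : |β * deriv (deriv Φ) t| ≤ C := by
      rw [abs_mul]; nlinarith [abs_nonneg (deriv (deriv Φ) t), bφ' t, abs_nonneg β]
    obtain ⟨k1, k2, k3, k4, k5⟩ := perturbation_bounds (x' := x' t) (y' := y' t) hC1 (bx t ht)
      (by_ t ht) aφ bφ1 aφ' bφ1' hε1 hε2 (hmN t)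
    refine ⟨?_, ?_, k1, k2, k3, k4, k5⟩
    · exact (dX.mul dY').sub (dY.mul dX')
    · refine ((dX.pow 2).add (dY.pow 2)).congr_deriv ?_
      simp only [hN']; norm_num
  have mx := h.continuous_x.aestronglyMeasurable (μ := ν)
  have my := h.continuous_y.aestronglyMeasurable (μ := ν)
  have mφ := hΦ.deriv.continuous.aestronglyMeasurable (μ := ν)
  have mφ' := hΦ.deriv.deriv.continuous.aestronglyMeasurable (μ := ν)
  have mx' := h.memLp_x.aestronglyMeasurable
  have my' := h.memLp_y.aestronglyMeasurable
  have mX : ∀ ε, AEStronglyMeasurable (X ε) ν := fun ε => mx.add ((mφ.const_mul α).const_mul ε)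
  have mY : ∀ ε, AEStronglyMeasurable (Y ε) ν := fun ε => my.add ((mφ.const_mul β).const_mul ε)
  have mX' : ∀ ε, AEStronglyMeasurable (X' ε) ν :=
    fun ε => mx'.add ((mφ'.const_mul α).const_mul ε)
  have mY' : ∀ ε, AEStronglyMeasurable (Y' ε) ν :=
    fun ε => my'.add ((mφ'.const_mul β).const_mul ε)
  have mD : ∀ ε, AEStronglyMeasurable (D ε) ν :=
    fun ε => ((mX ε).mul (mY' ε)).sub ((mY ε).mul (mX' ε))
  have mD' : AEStronglyMeasurable (D' 0) ν :=
    (((mφ.const_mul α).mul (mY' 0)).add ((mX 0).mul (mφ'.const_mul β))).sub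
      (((mφ.const_mul β).mul (mX' 0)).add ((mY 0).mul (mφ'.const_mul α)))
  have mN : ∀ ε, AEStronglyMeasurable (N ε) ν := fun ε => ((mX ε).pow 2).add ((mY ε).pow 2)
  have mN' : AEStronglyMeasurable (N' 0) ν :=
    (((mX 0).const_mul 2).mul (mφ.const_mul α)).add (((mY 0).const_mul 2).mul (mφ.const_mul β))
  have iG : Integrable (fun t => G t ^ p) ν := h.integrable_rpow hp
  obtain ⟨i₁, d₁⟩ := hasDerivAt_integral_abs_rpow_mul_rpow (e := (1 - 3 * p) / 2) hp hδ0
    (half_pos hm) (by positivity) mD mD' mN mN' hG1 iG hae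
  -- The length has a density of the same form, with `D = 1` and exponent `1 / 2`.
  obtain ⟨i₂, d₂⟩ := hasDerivAt_integral_abs_rpow_mul_rpow (e := 1 / 2) hp hδ0
    (D := fun _ _ => 1) (D' := fun _ _ => 0) (R := 8 * C ^ 2)
    (half_pos hm) (by positivity) (fun _ => aestronglyMeasurable_const) aestronglyMeasurable_const
    mN mN' hG1 iG (by
      filter_upwards [hae] with t ht ε hε
      obtain ⟨-, h2, -, -, h5, h6, h7⟩ := ht ε hε
      have : 1 ≤ 8 * C ^ 2 * G t := by nlinarith [hG1 t]
      exact ⟨hasDerivAt_const _ _, h2, by simpa using this, by simp; linarith, h5, h6, h7⟩)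
  set η : ℝ → Plane := fun t => !₂[α * Φ t, β * Φ t] with hη
  have hηeq : η = fun t => Φ t • (!₂[α, β] : Plane) := by
    funext t; ext i; fin_cases i <;> simp [hη, mul_comm]
  have hzero : tsupport η ⊆ tsupport Φ := by
    rw [hηeq]
    exact tsupport_smul_subset_left (f := Φ) (g := fun _ => (!₂[α, β] : Plane))
  have hcr := hcrit η (by rw [hηeq]; exact hΦ.contDiff.smul contDiff_const)
    (hΦ.hasCompactSupport.mono' ((subset_tsupport _).trans hzero))
    (hzero.trans hΦ.tsupport_subset)
  have hball : Metric.ball (0 : ℝ) δ ∈ nhds (0 : ℝ) := Metric.ball_mem_nhds _ hδ0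
  have hB : ∀ ε ∈ Metric.ball (0 : ℝ) δ,
      bendingEnergy p (γ + ε • η) = ∫ t, |D ε t| ^ p * N ε t ^ ((1 - 3 * p) / 2) ∂ν := by
    intro ε hε
    rw [bendingEnergy, intervalIntegral.integral_of_le zero_le_one, integral_Ioc_eq_integral_Ioo]
    refine integral_congr_ae ?_
    rw [Filter.EventuallyEq, ← hν]
    have h1 : ∀ᵐ t ∂ν, t ∈ Ioo (0 : ℝ) 1 := ae_restrict_mem measurableSet_Ioo
    filter_upwards [hae, h1, ae_restrict_of_ae h.ae_hasDerivAt] with t ht h't hd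
    obtain ⟨-, -, -, -, h5, -⟩ := ht ε hε
    have hpos : 0 < X ε t ^ 2 + Y ε t ^ 2 := by
      have : 0 < m / 2 := half_pos hm
      exact this.trans_le h5
    simp only [signedCurvature]
    rw [h.deriv_perturb hΦ α β ε h't, h.deriv_deriv_perturb hΦ α β ε h't hd.1 hd.2, norm_plane]
    exact signedCurvature_energy_density hpos
  have hL : ∀ ε ∈ Metric.ball (0 : ℝ) δ,
      length (γ + ε • η) = ∫ t, |(1 : ℝ)| ^ p * N ε t ^ ((1 : ℝ) / 2) ∂ν := by
    intro ε hε
    rw [length, arclength, intervalIntegral.integral_of_le zero_le_one,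
      integral_Ioc_eq_integral_Ioo]
    refine setIntegral_congr_fun measurableSet_Ioo fun t ht => ?_
    rw [h.deriv_perturb hΦ α β ε ht, norm_plane, abs_one, one_rpow, one_mul, sqrt_eq_rpow]
  have hder := (d₁.add (d₂.const_mul μ)).congr_of_eventuallyEq (f₁ := fun ε : ℝ =>
    bendingEnergy p (γ + ε • η) + μ * length (γ + ε • η)) (by
      filter_upwards [hball] with ε hε
      simp only [Pi.add_apply]
      rw [hB ε hε, hL ε hε])
  have huniq := hcr.unique hder
  rw [← integral_const_mul, ← integral_add i₁ (i₂.const_mul μ)] at huniq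
  rw [huniq]
  refine integral_congr_ae (Filter.Eventually.of_forall fun t => ?_)
  simp only [hD, hD', hN, hN', hX, hY, hX', hY', zero_mul, add_zero, mul_zero, abs_one, one_rpow,
    zero_add, one_mul]
  ring

end IsVelocity

/-! ### Signed powers -/

/-- The signed power `sign x * |x| ^ a`. -/
noncomputable def spow (a x : ℝ) : ℝ := sign x * |x| ^ a

theorem spow_of_pos {a x : ℝ} (hx : 0 < x) : spow a x = x ^ a := by
  simp [spow, sign_of_pos hx, abs_of_pos hx]

@[simp] theorem spow_zero_right (a : ℝ) : spow a 0 = 0 := by simp [spow]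

theorem spow_neg (a x : ℝ) : spow a (-x) = -spow a x := by
  simp [spow, Real.sign_neg]

theorem spow_eq_abs_rpow_mul (a x : ℝ) : spow a x = |x| ^ (a - 1) * x := by
  rcases lt_trichotomy x 0 with hx | rfl | hx
  · rw [spow, sign_of_neg hx, abs_of_neg hx, rpow_sub_one (by linarith)]
    have := hx.ne
    field_simp
  · simp
  · rw [spow_of_pos hx, abs_of_pos hx, rpow_sub_one hx.ne']
    field_simp

/-- Consequently `spow (p - 1)⁻¹` inverts `spow (p - 1)`, which recovers the curvature together with
its sign from the bending moment. -/
theorem spow_spow (a b x : ℝ) : spow a (spow b x) = spow (b * a) x := by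
  rcases lt_trichotomy x 0 with hx | rfl | hx
  · obtain ⟨y, rfl⟩ : ∃ y, x = -y := ⟨-x, by ring⟩
    have hy : 0 < y := by linarith
    rw [spow_neg, spow_neg, spow_neg, spow_of_pos hy, spow_of_pos (rpow_pos_of_pos hy b),
      spow_of_pos hy, rpow_mul hy.le]
  · simp
  · rw [spow_of_pos hx, spow_of_pos (rpow_pos_of_pos hx b), spow_of_pos hx, rpow_mul hx.le]

theorem spow_one (x : ℝ) : spow 1 x = x := by simp [spow_eq_abs_rpow_mul]

theorem abs_spow {a : ℝ} (ha : 0 < a) (x : ℝ) : |spow a x| = |x| ^ a := by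
  rcases lt_trichotomy x 0 with hx | rfl | hx
  · simp [spow, sign_of_neg hx, abs_of_nonneg (rpow_nonneg (abs_nonneg x) a)]
  · simp [ha.ne']
  · simp [spow, sign_of_pos hx, abs_of_nonneg (rpow_nonneg (abs_nonneg x) a)]

theorem spow_mul_of_pos (a x : ℝ) {c : ℝ} (hc : 0 < c) : spow a (c * x) = c ^ a * spow a x := by
  have : Real.sign (c * x) = Real.sign x := by
    rcases lt_trichotomy x 0 with hx | rfl | hx
    · rw [sign_of_neg hx, sign_of_neg (mul_neg_of_pos_of_neg hc hx)]
    · simp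
    · rw [sign_of_pos hx, sign_of_pos (mul_pos hc hx)]
  rw [spow, spow, this, abs_mul, abs_of_pos hc, mul_rpow hc.le (abs_nonneg x)]
  ring

/-- Splitting into positive and negative parts removes the jump of `sign`, so continuity at 0
becomes evident. -/
theorem spow_eq_max {a : ℝ} (ha : 0 < a) (x : ℝ) :
    spow a x = max x 0 ^ a - max (-x) 0 ^ a := by
  rcases lt_trichotomy x 0 with hx | rfl | hx
  · rw [max_eq_right hx.le, max_eq_left (by linarith), zero_rpow ha.ne', ← neg_neg x, spow_neg,
      spow_of_pos (by linarith)]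
    simp
  · simp
  · rw [max_eq_left hx.le, max_eq_right (by linarith), zero_rpow ha.ne', spow_of_pos hx, sub_zero]

theorem continuous_spow {a : ℝ} (ha : 0 < a) : Continuous (spow a) := by
  rw [funext (spow_eq_max ha)]
  exact ((continuous_id.max continuous_const).rpow_const fun _ => Or.inr ha.le).sub
    ((continuous_neg.max continuous_const).rpow_const fun _ => Or.inr ha.le)

/-! ### The integrated Euler–Lagrange equation -/

theorem eqOn_Icc_of_ae {f g : ℝ → ℝ} (hf : ContinuousOn f (Icc 0 1)) (hg : ContinuousOn g (Icc 0 1))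
    (h : ∀ᵐ t, t ∈ Ioo (0 : ℝ) 1 → f t = g t) : EqOn f g (Icc 0 1) := by
  refine Measure.eqOn_Icc_of_ae_eq volume zero_ne_one ?_ hf hg
  rwa [restrict_Ioo_eq_restrict_Icc.symm, Filter.EventuallyEq, ae_restrict_iff' measurableSet_Ioo]

theorem _root_.AbsolutelyContinuousOnInterval.eq_zero_endpoint {f : ℝ → ℝ}
    (hf : AbsolutelyContinuousOnInterval f 0 1)
    (h : ∀ᵐ t, t ∈ Ioo (0 : ℝ) 1 → HasDerivAt f 0 t) : ∀ t ∈ Icc (0 : ℝ) 1, f t = f 0 := by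
  obtain ⟨C, hC⟩ := hf.const_of_ae_hasDerivAt_zero (by
    have h0 : ∀ᵐ t : ℝ, t ≠ 0 := by simp [ae_iff, measure_singleton]
    have h1 : ∀ᵐ t : ℝ, t ≠ 1 := by simp [ae_iff, measure_singleton]
    filter_upwards [h, h0, h1] with t ht a b h't
    rw [uIcc_of_le zero_le_one] at h't
    exact ht ⟨lt_of_le_of_ne h't.1 (Ne.symm a), lt_of_le_of_ne h't.2 b⟩)
  rw [uIcc_of_le zero_le_one] at hC
  intro t ht
  rw [hC t ht, hC 0 (by simp)]

/-- Here `κ` is the curvature, so that `D = κ N^(3/2)`, and everything reduces to counting powers of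
`N`. The first identity turns the coefficient of `Φ''` into the bending moment; the second evaluates
the combination that arises in the tangential component of the Euler-Lagrange equation. -/
theorem bending_moment_identities {p μ D N κ : ℝ} (hp : p ≠ 0) (hN : 0 < N)
    (hκ' : κ * √N ^ 3 = D) :
    p * |D| ^ (p - 2) * D * N ^ ((1 - 3 * p) / 2) * N = p * spow (p - 1) κ ∧
      (p * |D| ^ (p - 2) * D * N ^ ((1 - 3 * p) / 2)) * D +
        ((1 - 3 * p) / 2 * |D| ^ p * N ^ ((1 - 3 * p) / 2 - 1) +
          μ * (1 / 2 * N ^ ((1 : ℝ) / 2 - 1))) * N =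
        ((1 - p) * |κ| ^ p + μ) * √N / 2 := by
  have hs : √N ^ 3 = N ^ ((3 : ℝ) / 2) := by
    rw [sqrt_eq_rpow, ← rpow_natCast, ← rpow_mul hN.le]
    norm_num
  have hκ : κ = N ^ (-(3 : ℝ) / 2) * D := by
    rw [← hκ', hs, mul_left_comm, ← rpow_add hN]
    norm_num
  have hpos : 0 < N ^ (-(3 : ℝ) / 2) := rpow_pos_of_pos hN _
  constructor
  · rw [hκ, spow_mul_of_pos _ _ hpos, spow_eq_abs_rpow_mul, ← rpow_mul hN.le]
    have e1 : N ^ ((1 - 3 * p) / 2) * N = N ^ (-(3 : ℝ) / 2 * (p - 1)) := by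
      rw [← rpow_add_one hN.ne']
      congr 1
      ring
    rw [← e1, show p - 1 - 1 = p - 2 by ring]
    ring
  · rw [hκ, abs_mul, abs_of_pos hpos, mul_rpow hpos.le (abs_nonneg _), ← rpow_mul hN.le]
    have e1 : |D| ^ (p - 2) * D * D = |D| ^ p := by
      rcases eq_or_ne D 0 with h0 | h0
      · simp [h0, zero_rpow hp]
      · rw [mul_assoc, ← abs_mul_abs_self D, ← pow_two, ← rpow_natCast,
          ← rpow_add (abs_pos.2 h0)]
        congr 1
        norm_num
    have e2 : N ^ ((1 - 3 * p) / 2 - 1) * N = N ^ ((1 - 3 * p) / 2) := by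
      rw [← rpow_add_one hN.ne']
      congr 1
      ring
    have e3 : N ^ ((1 : ℝ) / 2 - 1) * N = √N := by
      rw [← rpow_add_one hN.ne', sqrt_eq_rpow]
      congr 1
      ring
    have e4 : N ^ (-(3 : ℝ) / 2 * p) * √N = N ^ ((1 - 3 * p) / 2) := by
      rw [sqrt_eq_rpow, ← rpow_add hN]
      congr 1
      ring
    linear_combination p * N ^ ((1 - 3 * p) / 2) * e1 + (1 - 3 * p) / 2 * |D| ^ p * e2 +
      μ / 2 * e3 - (1 - p) / 2 * |D| ^ p * e4

namespace IsVelocity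

variable {p : ℝ} {γ : ℝ → Plane} {x y x' y' : ℝ → ℝ}

/-- `(Z₀, Z₁)` is the coefficient vector of `Φ''`, namely `P` times the rotated velocity. Testing in
the two coordinate directions shows that it is a primitive of the coefficient of `Φ'` up to the
constants `c₀`, `c₁`. -/
theorem integrated_euler_lagrange (h : IsVelocity p γ x y x' y') (hp : 2 < p) {μ : ℝ}
    (hcrit : ∀ η : ℝ → Plane, ContDiff ℝ ∞ η → HasCompactSupport η → tsupport η ⊆ Ioo 0 1 →
      HasDerivAt (fun ε : ℝ => bendingEnergy p (γ + ε • η) + μ * length (γ + ε • η)) 0 0) :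
    let D : ℝ → ℝ := fun t => x t * y' t - y t * x' t
    let N : ℝ → ℝ := fun t => x t ^ 2 + y t ^ 2
    let P : ℝ → ℝ := fun t => p * |D t| ^ (p - 2) * D t * N t ^ ((1 - 3 * p) / 2)
    let Q : ℝ → ℝ := fun t => (1 - 3 * p) / 2 * |D t| ^ p * N t ^ ((1 - 3 * p) / 2 - 1) +
      μ * (1 / 2 * N t ^ ((1 : ℝ) / 2 - 1))
    ∃ c₀ c₁ : ℝ, ∃ Z₀ Z₁ : ℝ → ℝ,
      AbsolutelyContinuousOnInterval Z₀ 0 1 ∧ AbsolutelyContinuousOnInterval Z₁ 0 1 ∧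
      ∀ᵐ t, t ∈ Ioo (0 : ℝ) 1 → Z₀ t = -(P t * y t) ∧ Z₁ t = P t * x t ∧
        HasDerivAt Z₀ (P t * y' t + 2 * Q t * x t - c₀) t ∧
        HasDerivAt Z₁ (-(P t * x' t) + 2 * Q t * y t - c₁) t := by
  intro D N P Q
  obtain ⟨C, hC1, hxy⟩ := h.exists_bound
  obtain ⟨m, hm, hmN⟩ := h.exists_pos
  have hC0 : 0 ≤ C := by linarith
  set ν := volume.restrict (Ioo (0 : ℝ) 1) with hν
  set G : ℝ → ℝ := fun t => 1 + |x' t| + |y' t| with hG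
  have hG1 : ∀ t, 1 ≤ G t := fun t => by
    have := abs_nonneg (x' t); have := abs_nonneg (y' t)
    simp only [hG]; linarith
  have iG : Integrable (fun t => G t ^ p) ν := h.integrable_rpow hp
  have mx := h.continuous_x.aestronglyMeasurable (μ := ν)
  have my := h.continuous_y.aestronglyMeasurable (μ := ν)
  have mx' := h.memLp_x.aestronglyMeasurable
  have my' := h.memLp_y.aestronglyMeasurable
  have mD : AEStronglyMeasurable D ν := (mx.mul my').sub (my.mul mx')
  have mN : AEStronglyMeasurable N ν := (mx.pow 2).add (my.pow 2)
  have mDa : AEMeasurable (fun t => |D t|) ν := mD.norm.aemeasurable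
  have mP : AEStronglyMeasurable P ν :=
    ((((mDa.pow_const (p - 2)).const_mul p).mul mD.aemeasurable).mul
      (mN.aemeasurable.pow_const _)).aestronglyMeasurable
  have mQ : AEStronglyMeasurable Q ν :=
    ((((mDa.pow_const p).const_mul _).mul (mN.aemeasurable.pow_const _)).add
      (((mN.aemeasurable.pow_const _).const_mul _).const_mul _)).aestronglyMeasurable
  -- `P` grows like the power `p - 1` of the second derivatives and `Q` at most like the power `p`,
  -- so every product needed below is dominated by the integrable `G^p`.
  have hbound : ∃ K ≥ 0, ∀ t ∈ Ioo (0 : ℝ) 1, |P t| * G t ≤ K * G t ^ p ∧ |Q t| ≤ K * G t ^ p := by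
    have hN2 : ∀ t ∈ Ioo (0 : ℝ) 1, N t ≤ 2 * C ^ 2 := fun t ht => by
      have h1 := sq_le_sq' (abs_le.1 (hxy t ht).1).1 (abs_le.1 (hxy t ht).1).2
      have h2 := sq_le_sq' (abs_le.1 (hxy t ht).2).1 (abs_le.1 (hxy t ht).2).2
      simp only [N]; linarith
    have hM : 0 ≤ 2 * C ^ 2 := by positivity
    set k : ℝ → ℝ := fun e => m ^ e + (2 * C ^ 2) ^ e with hk
    have hk0 : ∀ e, 0 ≤ k e := fun e => add_nonneg (rpow_nonneg hm.le e) (rpow_nonneg hM e)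
    have hNk : ∀ e, ∀ t ∈ Ioo (0 : ℝ) 1, N t ^ e ≤ k e := fun e t ht =>
      rpow_le_of_mem_Icc hm (hmN t) (hN2 t ht)
    have hp0 : 0 ≤ p := by linarith
    have t1 : 0 ≤ p * C ^ (p - 1) * k ((1 - 3 * p) / 2) :=
      mul_nonneg (mul_nonneg hp0 (rpow_nonneg hC0 _)) (hk0 _)
    have t2 : 0 ≤ |(1 - 3 * p) / 2| * C ^ p * k ((1 - 3 * p) / 2 - 1) +
        |μ| * (1 / 2 * k ((1 : ℝ) / 2 - 1)) :=
      add_nonneg (mul_nonneg (mul_nonneg (abs_nonneg _) (rpow_nonneg hC0 _)) (hk0 _))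
        (mul_nonneg (abs_nonneg _) (mul_nonneg (by norm_num) (hk0 _)))
    refine ⟨p * C ^ (p - 1) * k ((1 - 3 * p) / 2) +
      (|(1 - 3 * p) / 2| * C ^ p * k ((1 - 3 * p) / 2 - 1) + |μ| * (1 / 2 * k ((1 : ℝ) / 2 - 1))),
      add_nonneg t1 t2, fun t ht => ?_⟩
    have hg0 : 0 < G t := by linarith [hG1 t]
    have hgp : 1 ≤ G t ^ p := one_le_rpow (hG1 t) hp0
    have hgp0 : 0 ≤ G t ^ p := by linarith
    have hN0 : 0 ≤ N t := hm.le.trans (hmN t)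
    have hD : |D t| ≤ C * G t := by
      refine (abs_sub _ _).trans ?_
      rw [abs_mul, abs_mul]
      have h1 := mul_le_mul_of_nonneg_right (hxy t ht).1 (abs_nonneg (y' t))
      have h2 := mul_le_mul_of_nonneg_right (hxy t ht).2 (abs_nonneg (x' t))
      simp only [hG]; linarith
    constructor
    · have e1 : |P t| = p * |D t| ^ (p - 1) * N t ^ ((1 - 3 * p) / 2) := by
        simp only [P]
        rw [abs_mul, abs_mul, abs_mul, abs_of_nonneg hp0,
          abs_of_nonneg (rpow_nonneg (abs_nonneg (D t)) _), abs_of_nonneg (rpow_nonneg hN0 _),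
          mul_assoc p]
        congr 2
        rcases (abs_nonneg (D t)).eq_or_lt with h5 | h5
        · rw [← h5, mul_zero, zero_rpow (by linarith)]
        · rw [← rpow_add_one h5.ne']
          congr 1; ring
      have e2 : |D t| ^ (p - 1) ≤ C ^ (p - 1) * G t ^ (p - 1) := by
        rw [← mul_rpow hC0 hg0.le]
        exact rpow_le_rpow (abs_nonneg _) hD (by linarith)
      have e3 : G t ^ (p - 1) * G t = G t ^ p := by
        rw [← rpow_add_one hg0.ne']
        congr 1; ring
      calc |P t| * G t ≤ p * (C ^ (p - 1) * G t ^ (p - 1)) * k ((1 - 3 * p) / 2) * G t := by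
            rw [e1]
            have := hNk ((1 - 3 * p) / 2) t ht
            have := rpow_nonneg hC0 (p - 1)
            gcongr
        _ = p * C ^ (p - 1) * k ((1 - 3 * p) / 2) * G t ^ p := by rw [← e3]; ring
        _ ≤ _ := by gcongr; linarith
    · have e2 : |D t| ^ p ≤ C ^ p * G t ^ p := by
        rw [← mul_rpow hC0 hg0.le]
        exact rpow_le_rpow (abs_nonneg _) hD hp0
      have e4 : |Q t| ≤ |(1 - 3 * p) / 2| * |D t| ^ p * N t ^ ((1 - 3 * p) / 2 - 1) +
          |μ| * (1 / 2 * N t ^ ((1 : ℝ) / 2 - 1)) := by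
        refine (abs_add_le _ _).trans (le_of_eq ?_)
        rw [abs_mul, abs_mul, abs_mul, abs_of_nonneg (rpow_nonneg (abs_nonneg (D t)) _),
          abs_of_nonneg (rpow_nonneg hN0 _),
          abs_of_nonneg (mul_nonneg (by norm_num) (rpow_nonneg hN0 _))]
      have f1 : |(1 - 3 * p) / 2| * |D t| ^ p * N t ^ ((1 - 3 * p) / 2 - 1) ≤
          |(1 - 3 * p) / 2| * (C ^ p * G t ^ p) * k ((1 - 3 * p) / 2 - 1) := by
        have := hNk ((1 - 3 * p) / 2 - 1) t ht
        gcongr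
      have f2 : |μ| * (1 / 2 * N t ^ ((1 : ℝ) / 2 - 1)) ≤ |μ| * (1 / 2 * k ((1 : ℝ) / 2 - 1)) := by
        have := hNk ((1 : ℝ) / 2 - 1) t ht
        gcongr
      have f3 : |μ| * (1 / 2 * k ((1 : ℝ) / 2 - 1)) ≤
          |μ| * (1 / 2 * k ((1 : ℝ) / 2 - 1)) * G t ^ p :=
        le_mul_of_one_le_right (mul_nonneg (abs_nonneg _) (mul_nonneg (by norm_num) (hk0 _))) hgp
      have f4 := mul_nonneg t1 hgp0
      linarith
  obtain ⟨K, hK, hb⟩ := hbound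
  have hint : ∀ a b : ℝ → ℝ, AEStronglyMeasurable (fun t => P t * a t + Q t * b t) ν →
      (∀ t ∈ Ioo (0 : ℝ) 1, |a t| ≤ C * G t) → (∀ t ∈ Ioo (0 : ℝ) 1, |b t| ≤ 2 * C) →
      IntegrableOn (fun t => P t * a t + Q t * b t) (Ioo 0 1) := by
    intro a b hme ha hb'
    refine Integrable.mono' (iG.const_mul (3 * C * K)) hme ?_
    rw [ae_restrict_iff' measurableSet_Ioo]
    refine Filter.Eventually.of_forall fun t ht => ?_
    obtain ⟨b1, b2⟩ := hb t ht
    refine (abs_add_le _ _).trans ?_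
    rw [abs_mul (P t), abs_mul (Q t)]
    have g1 : |P t| * |a t| ≤ |P t| * (C * G t) := by gcongr; exact ha t ht
    have g2 : |Q t| * |b t| ≤ |Q t| * (2 * C) := by gcongr; exact hb' t ht
    have g3 := mul_le_mul_of_nonneg_left b1 hC0
    have g4 := mul_le_mul_of_nonneg_left b2 hC0
    linarith
  have hGx : ∀ t, |x' t| ≤ G t ∧ |y' t| ≤ G t := fun t => by
    have := abs_nonneg (x' t); have := abs_nonneg (y' t)
    simp only [hG]; constructor <;> linarith
  have hCG : ∀ t, G t ≤ C * G t := fun t =>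
    le_mul_of_one_le_left (by linarith [hG1 t]) hC1
  have hCC : ∀ t, C ≤ C * G t := fun t => le_mul_of_one_le_right hC0 (hG1 t)
  have iA₀ : IntegrableOn (fun t => -(P t * y t)) (Ioo 0 1) := by
    have := hint (fun t => -y t) (fun _ => 0) ((mP.mul my.neg).add (mQ.mul
      aestronglyMeasurable_const)) (fun t ht => by
        rw [abs_neg]; exact (hxy t ht).2.trans (hCC t)) (fun t _ => by simp; linarith)
    simpa using this
  have iA₁ : IntegrableOn (fun t => P t * x t) (Ioo 0 1) := by
    have := hint x (fun _ => 0) ((mP.mul mx).add (mQ.mul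
      aestronglyMeasurable_const)) (fun t ht => (hxy t ht).1.trans (hCC t))
      (fun t _ => by simp; linarith)
    simpa using this
  have hC2 : ∀ a : ℝ, |a| ≤ C → |2 * a| ≤ 2 * C := fun a ha => by
    rw [abs_mul, abs_of_pos (by norm_num : (0 : ℝ) < 2)]; linarith
  have iB₀ : IntegrableOn (fun t => P t * y' t + 2 * Q t * x t) (Ioo 0 1) := by
    refine (hint y' (fun t => 2 * x t) ((mP.mul my').add (mQ.mul (mx.const_mul 2)))
      (fun t ht => (hGx t).2.trans (hCG t)) (fun t ht => hC2 _ (hxy t ht).1)).congr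
      (Filter.Eventually.of_forall fun t => ?_)
    ring
  have iB₁ : IntegrableOn (fun t => -(P t * x' t) + 2 * Q t * y t) (Ioo 0 1) := by
    refine (hint (fun t => -x' t) (fun t => 2 * y t) ((mP.mul mx'.neg).add
      (mQ.mul (my.const_mul 2))) (fun t ht => by rw [abs_neg]; exact (hGx t).1.trans (hCG t))
      (fun t ht => hC2 _ (hxy t ht).2)).congr (Filter.Eventually.of_forall fun t => ?_)
    ring
  obtain ⟨a₀, c₀, h₀⟩ := ae_eq_primitive_of_mean_zero iA₀ iB₀ fun φ hφ hφ0 => by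
    -- The perturbation is `Φ`; the mean-zero function `φ` stands for its first derivative.
    obtain ⟨Φ, hΦ, hd⟩ := hφ.exists_primitive hφ0
    have := h.integral_first_variation hp hcrit hΦ (α := 1) (β := 0) (by simp) (by simp)
    rw [hd] at this
    refine Eq.trans (integral_congr_ae (Filter.Eventually.of_forall fun t => ?_)) this
    simp only [P, Q, D, N]
    ring
  obtain ⟨a₁, c₁, h₁⟩ := ae_eq_primitive_of_mean_zero iA₁ iB₁ fun φ hφ hφ0 => by
    obtain ⟨Φ, hΦ, hd⟩ := hφ.exists_primitive hφ0
    have := h.integral_first_variation hp hcrit hΦ (α := 0) (β := 1) (by simp) (by simp)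
    rw [hd] at this
    refine Eq.trans (integral_congr_ae (Filter.Eventually.of_forall fun t => ?_)) this
    simp only [P, Q, D, N]
    ring
  have hprim : ∀ (a c : ℝ) (B : ℝ → ℝ), IntegrableOn B (Ioo 0 1) →
      AbsolutelyContinuousOnInterval (fun t => a + ∫ u in (0 : ℝ)..t, (B u - c)) 0 1 ∧
      ∀ᵐ t, t ∈ Ioo (0 : ℝ) 1 →
        HasDerivAt (fun t => a + ∫ u in (0 : ℝ)..t, (B u - c)) (B t - c) t := by
    intro a c B hB
    have hi : IntervalIntegrable (fun u => B u - c) volume 0 1 :=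
      (intervalIntegrable_zero_one_iff.2 hB).sub intervalIntegrable_const
    refine ⟨(contDiff_const.contDiffOn.absolutelyContinuousOnInterval).fun_add
      (hi.absolutelyContinuousOnInterval_intervalIntegral (c := 0) (by simp)), ?_⟩
    filter_upwards [hi.ae_hasDerivAt_integral] with t ht h't
    refine (ht ?_ 0 (by simp)).const_add a
    rw [uIcc_of_le zero_le_one]
    exact Ioo_subset_Icc_self h't
  obtain ⟨ac₀, d₀⟩ := hprim a₀ c₀ _ iB₀
  obtain ⟨ac₁, d₁⟩ := hprim a₁ c₁ _ iB₁
  refine ⟨c₀, c₁, _, _, ac₀, ac₁, ?_⟩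
  filter_upwards [h₀, h₁, d₀, d₁] with t k1 k2 k3 k4 ht
  exact ⟨(k1 ht).symm, (k2 ht).symm, k3 ht, k4 ht⟩

/-- The Euler–Lagrange equation: the curvature has a continuous representative `k`, the bending
moment `p |k|^{p-2} k` is continuously differentiable, and there is a conserved vector. -/
theorem exists_euler_lagrange (h : IsVelocity p γ x y x' y') (hp : 2 < p) {μ : ℝ}
    (hcrit : ∀ η : ℝ → Plane, ContDiff ℝ ∞ η → HasCompactSupport η → tsupport η ⊆ Ioo 0 1 →
      HasDerivAt (fun ε : ℝ => bendingEnergy p (γ + ε • η) + μ * length (γ + ε • η)) 0 0) :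
    ∃ (k : ℝ → ℝ) (c₀ c₁ : ℝ), Continuous k ∧
      (∀ t, HasDerivAt (fun t => p * spow (p - 1) (k t)) (c₀ * y t - c₁ * x t) t) ∧
      (∀ t ∈ Icc (0 : ℝ) 1,
        ((1 - p) * |k t| ^ p + μ) * √(x t ^ 2 + y t ^ 2) = c₀ * x t + c₁ * y t) ∧
      ∀ᵐ t, t ∈ Ioo (0 : ℝ) 1 → k t * √(x t ^ 2 + y t ^ 2) ^ 3 = x t * y' t - y t * x' t := by
  obtain ⟨c₀, c₁, Z₀, Z₁, ac₀, ac₁, hZ⟩ := h.integrated_euler_lagrange hp hcrit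
  obtain ⟨m, hm, hmN⟩ := h.exists_pos
  have hN : ∀ t, 0 < x t ^ 2 + y t ^ 2 := fun t => hm.trans_le (hmN t)
  have acx := absolutelyContinuousOnInterval_of_eq_primitive h.integrable_x h.x_eq
  have acy := absolutelyContinuousOnInterval_of_eq_primitive h.integrable_y h.y_eq
  have hcont : Continuous fun t => c₀ * y t - c₁ * x t :=
    (h.continuous_y.const_mul c₀).sub (h.continuous_x.const_mul c₁)
  set W : ℝ → ℝ := fun t => Z₁ 0 * x 0 - Z₀ 0 * y 0 + ∫ u in (0 : ℝ)..t, (c₀ * y u - c₁ * x u)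
    with hW
  have hWd : ∀ t, HasDerivAt W (c₀ * y t - c₁ * x t) t := fun t =>
    (hcont.integral_hasStrictDerivAt 0 t).hasDerivAt.const_add _
  have hWc : Continuous W := continuous_iff_continuousAt.2 fun t => (hWd t).continuousAt
  have acW : AbsolutelyContinuousOnInterval W 0 1 :=
    (contDiff_const.contDiffOn.absolutelyContinuousOnInterval).fun_add
      ((hcont.intervalIntegrable 0 1).absolutelyContinuousOnInterval_intervalIntegral
        (c := 0) (by simp))
  -- The left side is a.e. `P (x² + y²)`, the bending moment. All `P` and `Q` terms cancel in its
  -- derivative, and only the conserved vector remains.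
  have hWZ : ∀ t ∈ Icc (0 : ℝ) 1, Z₁ t * x t - Z₀ t * y t = W t := by
    have := AbsolutelyContinuousOnInterval.eq_zero_endpoint
      (((ac₁.fun_mul acx).fun_sub (ac₀.fun_mul acy)).fun_sub acW) (by
        filter_upwards [hZ, h.ae_hasDerivAt] with t h1 ⟨dx, dy⟩ ht
        obtain ⟨e₀, e₁, d₀, d₁⟩ := h1 ht
        refine (((d₁.fun_mul dx).fun_sub (d₀.fun_mul dy)).fun_sub (hWd t)).congr_deriv ?_
        rw [e₀, e₁]
        ring)
    intro t ht
    have h1 := this t ht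
    have h2 : W 0 = Z₁ 0 * x 0 - Z₀ 0 * y 0 := by simp [hW]
    linarith
  -- `(Z₀, Z₁)` is normal to the velocity. Differentiating this relation yields the tangential
  -- equation, so it is needed near each point and not just a.e.
  have horth : ∀ t ∈ Icc (0 : ℝ) 1, Z₀ t * x t + Z₁ t * y t = 0 := by
    have c1 := ((ac₀.fun_mul acx).fun_add (ac₁.fun_mul acy)).continuousOn
    rw [uIcc_of_le zero_le_one] at c1
    refine eqOn_Icc_of_ae c1 continuousOn_const ?_
    filter_upwards [hZ] with t h1 ht
    obtain ⟨e₀, e₁, -⟩ := h1 ht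
    simp only [e₀, e₁]
    ring
  have hp1 : 0 < p - 1 := by linarith
  have hp1' : 0 < (p - 1)⁻¹ := inv_pos.2 hp1
  -- Defining the curvature by inverting the moment makes it continuous on all of `ℝ`; the classical
  -- formula holds only a.e.
  set k : ℝ → ℝ := fun t => spow (p - 1)⁻¹ (W t / p) with hk
  have hkc : Continuous k := (continuous_spow hp1').comp (hWc.div_const p)
  have hkW : ∀ t, p * spow (p - 1) (k t) = W t := fun t => by
    rw [hk, spow_spow, inv_mul_cancel₀ hp1.ne', spow_one]
    field_simp
  have hkD : ∀ᵐ t, t ∈ Ioo (0 : ℝ) 1 →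
      k t * √(x t ^ 2 + y t ^ 2) ^ 3 = x t * y' t - y t * x' t := by
    filter_upwards [hZ] with t h1 ht
    obtain ⟨e₀, e₁, -⟩ := h1 ht
    have hs : √(x t ^ 2 + y t ^ 2) ^ 3 ≠ 0 := pow_ne_zero _ (sqrt_ne_zero'.2 (hN t))
    have h2 := (bending_moment_identities (p := p) (μ := μ) (by linarith) (hN t)
      (div_mul_cancel₀ (x t * y' t - y t * x' t) hs)).1
    have h3 := hWZ t (Ioo_subset_Icc_self ht)
    rw [e₀, e₁] at h3
    have h4 : spow (p - 1) ((x t * y' t - y t * x' t) / √(x t ^ 2 + y t ^ 2) ^ 3) = W t / p := by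
      rw [eq_div_iff (by linarith), ← h3, mul_comm, ← h2]
      ring
    rw [hk]
    dsimp only
    rw [← h4, spow_spow, mul_inv_cancel₀ hp1.ne', spow_one, div_mul_cancel₀ _ hs]
  refine ⟨k, c₀, c₁, hkc, fun t => ?_, ?_, hkD⟩
  · rw [funext hkW]
    exact hWd t
  · refine eqOn_Icc_of_ae (Continuous.continuousOn ?_) (Continuous.continuousOn ?_) ?_
    · have hc := (hkc.abs.rpow_const fun t => Or.inr (by linarith : (0 : ℝ) ≤ p))
      have hx := h.continuous_x
      have hy := h.continuous_y
      fun_prop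
    · exact (h.continuous_x.const_mul c₀).add (h.continuous_y.const_mul c₁)
    · have hev : ∀ᵐ t, t ∈ Ioo (0 : ℝ) 1 → ∀ᶠ s in nhds t, Z₀ s * x s + Z₁ s * y s = 0 :=
        Filter.Eventually.of_forall fun t ht => by
          filter_upwards [Icc_mem_nhds ht.1 ht.2] with s hs using horth s hs
      filter_upwards [hZ, h.ae_hasDerivAt, hkD, hev] with t h1 ⟨dx, dy⟩ h2 h3 ht
      obtain ⟨e₀, e₁, d₀, d₁⟩ := h1 ht
      have h4 := ((d₀.fun_mul dx).fun_add (d₁.fun_mul dy)).unique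
        ((hasDerivAt_const t (0 : ℝ)).congr_of_eventuallyEq (h3 ht))
      have h5 := (bending_moment_identities (p := p) (μ := μ) (by linarith) (hN t) (h2 ht)).2
      rw [e₀, e₁] at h4
      linear_combination -2 * h5 + h4

end IsVelocity

/-! ### Arclength parameterization -/

/-- A strictly monotone continuous surjection of `ℝ` has a continuous strictly monotone inverse. -/
theorem exists_continuous_inverse {F : ℝ → ℝ} (hm : StrictMono F)
    (hs : Function.Surjective F) :
    ∃ G : ℝ → ℝ, Continuous G ∧ StrictMono G ∧ (∀ s, F (G s) = s) ∧ ∀ t, G (F t) = t := by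
  let e := hm.orderIsoOfSurjective F hs
  exact ⟨e.symm, e.symm.continuous, e.symm.strictMono, fun s => e.apply_symm_apply s,
    fun t => e.symm_apply_apply t⟩

theorem _root_.AbsolutelyContinuousOnInterval.sqrt_of_le {f : ℝ → ℝ} {a b m : ℝ} (hm : 0 < m)
    (hf : AbsolutelyContinuousOnInterval f a b) (h : ∀ x ∈ uIcc a b, m ≤ f x) :
    AbsolutelyContinuousOnInterval (fun x => √(f x)) a b := by
  refine hf.comp_of_dist_le (C := (√m)⁻¹) fun x hx y hy => ?_
  have h1 := h x hx
  have h2 := h y hy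
  have p1 : 0 ≤ f x := hm.le.trans h1
  have p2 : 0 ≤ f y := hm.le.trans h2
  have s1 : √m ≤ √(f x) := sqrt_le_sqrt h1
  have s0 : 0 < √m := sqrt_pos.2 hm
  have s2 := sqrt_nonneg (f y)
  rw [Real.dist_eq, Real.dist_eq, inv_mul_eq_div, le_div_iff₀ s0]
  have e : f x - f y = (√(f x) - √(f y)) * (√(f x) + √(f y)) := by
    nlinarith [mul_self_sqrt p1, mul_self_sqrt p2]
  rw [e, abs_mul, abs_of_nonneg (by positivity : 0 ≤ √(f x) + √(f y))]
  gcongr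
  linarith

theorem exists_angle_of_sq_add_sq {X Y r : ℝ} (hr : 0 < r) (h : X ^ 2 + Y ^ 2 = r ^ 2) :
    ∃ θ : ℝ, X = r * cos θ ∧ Y = r * sin θ := by
  refine ⟨Complex.arg ⟨X, Y⟩, ?_⟩
  have hn : ‖(⟨X, Y⟩ : ℂ)‖ = r := by
    rw [Complex.norm_def, Complex.normSq_mk, ← pow_two, ← pow_two, h, sqrt_sq hr.le]
  have h0 : (⟨X, Y⟩ : ℂ) ≠ 0 := fun h0 => by
    rw [h0, norm_zero] at hn
    exact hr.ne hn
  rw [Complex.cos_arg h0, Complex.sin_arg, hn]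
  constructor <;> field_simp

namespace IsVelocity

variable {p : ℝ} {γ : ℝ → Plane} {x y x' y' : ℝ → ℝ}

/-- The angle is the integral of the curvature. The inner product of the unit tangent with `(cos θ,
sin θ)` is absolutely continuous with zero derivative a.e. and starts at 1; two unit vectors with
inner product 1 coincide. -/
theorem exists_angle (h : IsVelocity p γ x y x' y') {k : ℝ → ℝ} (hk : Continuous k)
    (hkD : ∀ᵐ t, t ∈ Ioo (0 : ℝ) 1 →
      k t * √(x t ^ 2 + y t ^ 2) ^ 3 = x t * y' t - y t * x' t) :
    ∃ θ : ℝ → ℝ, (∀ t, HasDerivAt θ (k t * √(x t ^ 2 + y t ^ 2)) t) ∧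
      ∀ t ∈ Icc (0 : ℝ) 1, x t = √(x t ^ 2 + y t ^ 2) * cos (θ t) ∧
        y t = √(x t ^ 2 + y t ^ 2) * sin (θ t) := by
  obtain ⟨m, hm, hmN⟩ := h.exists_pos
  set N : ℝ → ℝ := fun t => x t ^ 2 + y t ^ 2 with hNdef
  have hN : ∀ t, 0 < N t := fun t => hm.trans_le (hmN t)
  have hs : ∀ t, 0 < √(N t) := fun t => sqrt_pos.2 (hN t)
  have hx := h.continuous_x
  have hy := h.continuous_y
  have acx := absolutelyContinuousOnInterval_of_eq_primitive h.integrable_x h.x_eq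
  have acy := absolutelyContinuousOnInterval_of_eq_primitive h.integrable_y h.y_eq
  have hNc : Continuous fun t => √(N t) := by fun_prop
  have hkN : Continuous fun t => k t * √(N t) := hk.mul hNc
  obtain ⟨θ₀, hx0, hy0⟩ := exists_angle_of_sq_add_sq (hs 0)
    (show x 0 ^ 2 + y 0 ^ 2 = √(N 0) ^ 2 from (sq_sqrt (hN 0).le).symm)
  set θ : ℝ → ℝ := fun t => θ₀ + ∫ u in (0 : ℝ)..t, k u * √(N u) with hθ
  have hθd : ∀ t, HasDerivAt θ (k t * √(N t)) t := fun t =>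
    (hkN.integral_hasStrictDerivAt 0 t).hasDerivAt.const_add _
  have acθ : AbsolutelyContinuousOnInterval θ 0 1 :=
    (contDiff_const.contDiffOn.absolutelyContinuousOnInterval).fun_add
      ((hkN.intervalIntegrable 0 1).absolutelyContinuousOnInterval_intervalIntegral
        (c := 0) (by simp))
  have accos : AbsolutelyContinuousOnInterval (fun t => cos (θ t)) 0 1 :=
    acθ.comp_of_dist_le (C := 1) fun a _ b _ => by
      rw [one_mul]
      simpa using Real.lipschitzWith_cos.dist_le_mul (θ a) (θ b)
  have acsin : AbsolutelyContinuousOnInterval (fun t => sin (θ t)) 0 1 :=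
    acθ.comp_of_dist_le (C := 1) fun a _ b _ => by
      rw [one_mul]
      simpa using Real.lipschitzWith_sin.dist_le_mul (θ a) (θ b)
  have acN : AbsolutelyContinuousOnInterval N 0 1 := by
    have := (acx.fun_mul acx).fun_add (acy.fun_mul acy)
    refine this.comp_of_dist_le (C := 1) fun a _ b _ => ?_
    simp only [hNdef, pow_two, one_mul, le_refl]
  have acS := (acN.sqrt_of_le hm fun t _ => hmN t).inv_of_le (sqrt_pos.2 hm)
    fun t _ => sqrt_le_sqrt (hmN t)
  have hone : ∀ t ∈ Icc (0 : ℝ) 1,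
      (x t * cos (θ t) + y t * sin (θ t)) * (√(N t))⁻¹ = 1 := by
    have key := AbsolutelyContinuousOnInterval.eq_zero_endpoint
      (((acx.fun_mul accos).fun_add (acy.fun_mul acsin)).fun_mul acS) (by
        filter_upwards [h.ae_hasDerivAt, hkD] with t ⟨dx, dy⟩ h2 ht
        have hk' := h2 ht
        have dθ := hθd t
        have dN : HasDerivAt N (2 * x t * x' t + 2 * y t * y' t) t := by
          refine ((dx.fun_pow 2).fun_add (dy.fun_pow 2)).congr_deriv ?_
          norm_num
        have dS := (dN.sqrt (hN t).ne').fun_inv (hs t).ne'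
        refine (((dx.fun_mul dθ.cos).fun_add (dy.fun_mul dθ.sin)).fun_mul dS).congr_deriv ?_
        have hsq : √(N t) ^ 2 = x t ^ 2 + y t ^ 2 := sq_sqrt (hN t).le
        have hs0 := (hs t).ne'
        change k t * √(N t) ^ 3 = _ at hk'
        set S := √(N t)
        have hk2 : k t * S = (x t * y' t - y t * x' t) / S ^ 2 := by
          rw [eq_div_iff (pow_ne_zero 2 hs0), ← hk']; ring
        rw [hk2]
        field_simp
        rw [hsq]
        ring)
    intro t ht
    rw [key t ht]
    have hθ0 : θ 0 = θ₀ := by simp [hθ]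
    rw [hθ0, hx0, hy0]
    have := (hs 0).ne'
    field_simp
    exact cos_sq_add_sin_sq θ₀
  refine ⟨θ, hθd, fun t ht => ?_⟩
  have h1 := hone t ht
  have hsq : √(N t) ^ 2 = x t ^ 2 + y t ^ 2 := sq_sqrt (hN t).le
  have hs0 := hs t
  change x t = √(N t) * _ ∧ y t = √(N t) * _
  set S := √(N t)
  have h2 : x t * cos (θ t) + y t * sin (θ t) = S := by
    field_simp at h1
    linarith
  have h3 := sin_sq_add_cos_sq (θ t)
  have h4 : (x t - S * cos (θ t)) ^ 2 + (y t - S * sin (θ t)) ^ 2 = 0 := by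
    linear_combination -hsq - 2 * S * h2 + S ^ 2 * h3
  constructor <;> nlinarith [sq_nonneg (x t - S * cos (θ t)), sq_nonneg (y t - S * sin (θ t))]

theorem arclength_eq (h : IsVelocity p γ x y x' y') {t : ℝ} (ht : t ∈ Icc (0 : ℝ) 1) :
    arclength γ t = ∫ u in (0 : ℝ)..t, √(x u ^ 2 + y u ^ 2) := by
  rw [arclength, intervalIntegral.integral_of_le ht.1, intervalIntegral.integral_of_le ht.1,
    integral_Ioc_eq_integral_Ioo, integral_Ioc_eq_integral_Ioo]
  refine setIntegral_congr_fun measurableSet_Ioo fun u hu => ?_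
  rw [(h.hasDerivAt ⟨hu.1, hu.2.trans_le ht.2⟩).deriv, norm_plane]

end IsVelocity

/-- The arclength description of a `p`-elastica by its tangential angle `θ` and curvature `k`. -/
theorem IsPElastica.exists_arclength_data {p : ℝ} (hp : 2 < p) {γ : ℝ → Plane}
    (hγ : IsPElastica p γ) :
    ∃ (ℓ : ℝ) (θ k : ℝ → ℝ) (c₀ c₁ μ : ℝ), 0 < ℓ ∧ Continuous k ∧
      (∀ s, HasDerivAt θ (k s) s) ∧
      (∀ s ∈ Icc 0 ℓ,
        HasDerivAt (fun u => p * spow (p - 1) (k u)) (c₀ * sin (θ s) - c₁ * cos (θ s)) s ∧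
        (1 - p) * |k s| ^ p + μ = c₀ * cos (θ s) + c₁ * sin (θ s)) ∧
      ∀ t ∈ Icc (0 : ℝ) 1, arclength γ t ∈ Icc 0 ℓ ∧
        γ t = γ 0 + !₂[∫ s in (0 : ℝ)..arclength γ t, cos (θ s),
          ∫ s in (0 : ℝ)..arclength γ t, sin (θ s)] := by
  obtain ⟨him, μ, hcrit⟩ := hγ
  obtain ⟨x, y, x', y', h⟩ := him.exists_isVelocity hp
  obtain ⟨k, c₀, c₁, hk, hw, hrel, hkD⟩ := h.exists_euler_lagrange hp hcrit
  obtain ⟨θ, hθ, hxy⟩ := h.exists_angle hk hkD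
  obtain ⟨m, hm, hmN⟩ := h.exists_pos
  have hx := h.continuous_x
  have hy := h.continuous_y
  have hS : Continuous fun t => √(x t ^ 2 + y t ^ 2) := by fun_prop
  have hS0 : ∀ t, √m ≤ √(x t ^ 2 + y t ^ 2) := fun t => sqrt_le_sqrt (hmN t)
  have hm0 : 0 < √m := sqrt_pos.2 hm
  set σ : ℝ → ℝ := fun t => ∫ u in (0 : ℝ)..t, √(x u ^ 2 + y u ^ 2) with hσ
  have hσd : ∀ t, HasDerivAt σ (√(x t ^ 2 + y t ^ 2)) t := fun t =>
    (hS.integral_hasStrictDerivAt 0 t).hasDerivAt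
  have hσ0 : σ 0 = 0 := by simp [hσ]
  have hσm : StrictMono σ := strictMono_of_deriv_pos fun t => by
    rw [(hσd t).deriv]
    exact hm0.trans_le (hS0 t)
  have hσc : Continuous σ := continuous_iff_continuousAt.2 fun t => (hσd t).continuousAt
  -- The lower bound on the speed makes `σ` grow at least linearly, so it maps onto `ℝ` and its
  -- inverse is defined everywhere.
  have hmono : Monotone fun t => σ t - √m * t := by
    refine monotone_of_deriv_nonneg (fun t => ?_) fun t => ?_
    · exact ((hσd t).sub ((hasDerivAt_id t).const_mul (√m))).differentiableAt
    · rw [((hσd t).fun_sub ((hasDerivAt_id' t).const_mul (√m))).deriv]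
      linarith [hS0 t]
  have hσs : Function.Surjective σ := by
    refine hσc.surjective ?_ ?_
    · refine Filter.tendsto_atTop_mono' _ ?_
        (Filter.tendsto_id.const_mul_atTop hm0 : Filter.Tendsto (fun t => √m * t) _ _)
      filter_upwards [Filter.eventually_ge_atTop 0] with t ht
      have := hmono ht
      simp only [hσ0, mul_zero, sub_zero] at this
      linarith
    · refine Filter.tendsto_atBot_mono' _ ?_
        (Filter.tendsto_id.const_mul_atBot hm0 : Filter.Tendsto (fun t => √m * t) _ _)
      filter_upwards [Filter.eventually_le_atBot 0] with t ht
      have := hmono ht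
      simp only [hσ0, mul_zero, sub_zero] at this
      linarith
  obtain ⟨τ, hτc, hτm, hστ, hτσ⟩ := exists_continuous_inverse hσm hσs
  have hτ0 : τ 0 = 0 := by simpa [hσ0] using hτσ 0
  have hτd : ∀ s, HasDerivAt τ (√(x (τ s) ^ 2 + y (τ s) ^ 2))⁻¹ s := fun s =>
    HasDerivAt.of_local_left_inverse hτc.continuousAt (hσd _) (hm0.trans_le (hS0 _)).ne'
      (Filter.Eventually.of_forall hστ)
  have hτI : ∀ s ∈ Icc 0 (σ 1), τ s ∈ Icc (0 : ℝ) 1 := fun s hs => by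
    constructor
    · rw [← hτ0]; exact hτm.monotone hs.1
    · rw [← hτσ 1]; exact hτm.monotone hs.2
  have hθτ : ∀ s, HasDerivAt (fun s => θ (τ s)) (k (τ s)) s := fun s => by
    refine ((hθ (τ s)).comp s (hτd s)).congr_deriv ?_
    have := (hm0.trans_le (hS0 (τ s))).ne'
    field_simp
  have hθc : Continuous fun s => θ (τ s) :=
    continuous_iff_continuousAt.2 fun s => (hθτ s).continuousAt
  refine ⟨σ 1, fun s => θ (τ s), fun s => k (τ s), c₀, c₁, μ, ?_, hk.comp hτc, hθτ, ?_, ?_⟩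
  · rw [← hσ0]
    exact hσm zero_lt_one
  · intro s hs
    obtain ⟨ex, ey⟩ := hxy _ (hτI s hs)
    have hpos := hm0.trans_le (hS0 (τ s))
    constructor
    · refine ((hw (τ s)).comp s (hτd s)).congr_deriv ?_
      have e : c₀ * y (τ s) - c₁ * x (τ s) =
          (c₀ * sin (θ (τ s)) - c₁ * cos (θ (τ s))) * √(x (τ s) ^ 2 + y (τ s) ^ 2) := by
        linear_combination c₀ * ey - c₁ * ex
      rw [e, mul_inv_cancel_right₀ hpos.ne']
    · have e := hrel _ (hτI s hs)
      refine mul_right_cancel₀ hpos.ne' (e.trans ?_)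
      linear_combination c₀ * ex + c₁ * ey
  · intro t ht
    have harc : arclength γ t = σ t := h.arclength_eq ht
    rw [harc]
    refine ⟨⟨?_, hσm.monotone ht.2⟩, ?_⟩
    · rw [← hσ0]
      exact hσm.monotone ht.1
    · have hcos : Continuous fun s => cos (θ (τ s)) := continuous_cos.comp hθc
      have hsin : Continuous fun s => sin (θ (τ s)) := continuous_sin.comp hθc
      have hcomp : ∀ (i : Fin 2) (g f : ℝ → ℝ), Continuous g →
          (∀ t ∈ Icc (0 : ℝ) 1, HasDerivWithinAt (fun s => γ s i) (f t) (Icc 0 1) t) →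
          (∀ t ∈ Icc (0 : ℝ) 1, f t = √(x t ^ 2 + y t ^ 2) * g (σ t)) →
          γ t i = γ 0 i + ∫ s in (0 : ℝ)..σ t, g s := by
        intro i g f hg hf hfg
        have hd : ∀ u ∈ Icc (0 : ℝ) 1,
            HasDerivWithinAt (fun u => γ u i - ∫ s in (0 : ℝ)..σ u, g s) 0 (Icc 0 1) u := by
          intro u hu
          have h2 := ((hg.integral_hasStrictDerivAt 0 (σ u)).hasDerivAt.comp u (hσd u))
          refine ((hf u hu).fun_sub h2.hasDerivWithinAt).congr_deriv ?_
          rw [hfg u hu]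
          ring
        have := constant_of_derivWithin_zero (fun u hu => (hd u hu).differentiableWithinAt)
          (fun u hu => (hd u (Ico_subset_Icc_self hu)).derivWithin
            (uniqueDiffOn_Icc zero_lt_one u (Ico_subset_Icc_self hu))) t ht
        simp only [hσ0, intervalIntegral.integral_same, sub_zero] at this
        linarith
      have c0 := hcomp 0 _ x hcos h.deriv_x fun t ht => by
        rw [hτσ]; exact (hxy t ht).1
      have c1 := hcomp 1 _ y hsin h.deriv_y fun t ht => by
        rw [hτσ]; exact (hxy t ht).2
      ext i
      fin_cases i
      · simpa using c0
      · simpa using c1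

/-! ### Similarities and normalization -/

/-- The curve with tangential angle `ϑ` starting at the origin. -/
noncomputable def curveOfAngle (ϑ : ℝ → ℝ) (s : ℝ) : Plane :=
  !₂[∫ u in (0 : ℝ)..s, cos (ϑ u), ∫ u in (0 : ℝ)..s, sin (ϑ u)]

theorem hasDerivAt_curveOfAngle {ϑ : ℝ → ℝ} (h : Continuous ϑ) (s : ℝ) :
    HasDerivAt (curveOfAngle ϑ) !₂[cos (ϑ s), sin (ϑ s)] s := by
  refine hasDerivAt_plane_iff.2 ⟨?_, ?_⟩
  · exact ((continuous_cos.comp h).integral_hasStrictDerivAt 0 s).hasDerivAt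
  · exact ((continuous_sin.comp h).integral_hasStrictDerivAt 0 s).hasDerivAt

/-- The rotation by the angle with cosine `c` and sine `-s`, followed by a reflection if
`τ = -1`. -/
theorem exists_isometry {c s τ : ℝ} (h : c ^ 2 + s ^ 2 = 1) (hτ : τ ^ 2 = 1) :
    ∃ U : Plane ≃ₗᵢ[ℝ] Plane, ∀ v : Plane, U v = !₂[c * v 0 + s * v 1, τ * (c * v 1 - s * v 0)] := by
  let L : Plane →ₗ[ℝ] Plane :=
    { toFun := fun v => !₂[c * v 0 + s * v 1, τ * (c * v 1 - s * v 0)]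
      map_add' := fun v w => by ext i; fin_cases i <;> simp <;> ring
      map_smul' := fun a v => by ext i; fin_cases i <;> simp <;> ring }
  let I : Plane →ₗᵢ[ℝ] Plane := ⟨L, fun v => by
    conv_rhs => rw [plane_eta v]
    change ‖(!₂[c * v 0 + s * v 1, τ * (c * v 1 - s * v 0)] : Plane)‖ = _
    rw [norm_plane, norm_plane]
    congr 1
    linear_combination (v 0 ^ 2 + v 1 ^ 2) * h + (c * v 1 - s * v 0) ^ 2 * hτ⟩
  exact ⟨I.toLinearIsometryEquiv rfl, fun v => rfl⟩

/-- Up to a similarity of ratio `r`, the curve `γ` has length at most `ℓ` and tangential angle `ϑ`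
as a function of the arclength. -/
def HasSimilarAngle (γ : ℝ → Plane) (r ℓ : ℝ) (ϑ : ℝ → ℝ) : Prop :=
  ∃ (U : Plane ≃ₗᵢ[ℝ] Plane) (b : Plane), ∀ t ∈ Icc (0 : ℝ) 1,
    r * arclength γ t ∈ Icc 0 ℓ ∧ r • U (γ t) + b = curveOfAngle ϑ (r * arclength γ t)

theorem HasSimilarAngle.neg {γ : ℝ → Plane} {r ℓ : ℝ} {ϑ : ℝ → ℝ} (h : HasSimilarAngle γ r ℓ ϑ) :
    HasSimilarAngle γ r ℓ fun s => -ϑ s := by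
  obtain ⟨U, b, h⟩ := h
  obtain ⟨R, hR⟩ := exists_isometry (c := 1) (s := 0) (τ := -1) (by norm_num) (by norm_num)
  refine ⟨U.trans R, R b, fun t ht => ⟨(h t ht).1, ?_⟩⟩
  rw [LinearIsometryEquiv.trans_apply, ← map_smul, ← map_add, (h t ht).2, hR]
  ext i
  fin_cases i <;> simp [curveOfAngle]

theorem HasSimilarAngle.congr {γ : ℝ → Plane} {r ℓ : ℝ} {ϑ ϑ' : ℝ → ℝ}
    (h : HasSimilarAngle γ r ℓ ϑ)
    (he : ∀ s ∈ Icc 0 ℓ, cos (ϑ' s) = cos (ϑ s) ∧ sin (ϑ' s) = sin (ϑ s)) :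
    HasSimilarAngle γ r ℓ ϑ' := by
  obtain ⟨U, b, h⟩ := h
  refine ⟨U, b, fun t ht => ⟨(h t ht).1, ?_⟩⟩
  obtain ⟨h1, h2⟩ := h t ht
  rw [h2]
  have hu : ∀ u ∈ uIcc 0 (r * arclength γ t), u ∈ Icc 0 ℓ := fun u hu => by
    rw [uIcc_of_le h1.1] at hu
    exact ⟨hu.1, hu.2.trans h1.2⟩
  simp only [curveOfAngle]
  rw [intervalIntegral.integral_congr fun u h' => ((he u (hu u h')).1).symm,
    intervalIntegral.integral_congr fun u h' => ((he u (hu u h')).2).symm]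

theorem HasSimilarAngle.isRepresentedBy {γ γs : ℝ → Plane} {r ℓ s₀ : ℝ} {ϑ : ℝ → ℝ} {I : Set ℝ}
    {v : Plane} (hr : 0 < r) (h : HasSimilarAngle γ r ℓ ϑ)
    (hs : ∀ s ∈ Icc 0 ℓ, s + s₀ ∈ I ∧ curveOfAngle ϑ s + v = γs (s + s₀)) :
    IsRepresentedBy γ γs I := by
  obtain ⟨U, b, h⟩ := h
  refine ⟨r, hr, U, b + v, s₀, fun t ht => ?_⟩
  obtain ⟨h1, h2⟩ := h t ht
  obtain ⟨h3, h4⟩ := hs _ h1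
  exact ⟨h3, by rw [← add_assoc, h2, h4]⟩

theorem eq_add_of_hasDerivAt {f g : ℝ → Plane} {f' : ℝ → Plane} {a b : ℝ}
    (hf : ∀ s ∈ Icc a b, HasDerivWithinAt f (f' s) (Icc a b) s)
    (hg : ∀ s ∈ Icc a b, HasDerivWithinAt g (f' s) (Icc a b) s) :
    ∀ s ∈ Icc a b, f s - f a = g s - g a := by
  intro s hs
  rcases hs.1.eq_or_lt with h | hlt
  · rw [← h, sub_self, sub_self]
  have hab : a < b := hlt.trans_le hs.2
  have hd := fun u (hu : u ∈ Icc a b) => (hf u hu).sub (hg u hu)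
  have := constant_of_derivWithin_zero (fun u hu => (hd u hu).differentiableWithinAt)
    (fun u hu => by
      rw [(hd u (Ico_subset_Icc_self hu)).derivWithin
        (uniqueDiffOn_Icc hab u (Ico_subset_Icc_self hu)), sub_self]) s hs
  simp only [Pi.sub_apply] at this
  rw [sub_eq_sub_iff_sub_eq_sub]
  exact this

theorem HasSimilarAngle.isRepresentedBy_of_angle {γ γs : ℝ → Plane} {r ℓ s₀ : ℝ}
    {ϑ θs ks : ℝ → ℝ} (hr : 0 < r) (hϑ : Continuous ϑ) (h : HasSimilarAngle γ r ℓ ϑ)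
    (hs : HasAngleCurvatureOn γs θs ks univ)
    (he : ∀ s ∈ Icc 0 ℓ, cos (ϑ s) = cos (θs (s + s₀)) ∧ sin (ϑ s) = sin (θs (s + s₀))) :
    IsRepresentedBy γ γs univ := by
  refine h.isRepresentedBy (s₀ := s₀) (v := γs (0 + s₀) - curveOfAngle ϑ 0) hr
    fun s hs' => ⟨mem_univ _, ?_⟩
  have hγ : ∀ s ∈ Icc 0 ℓ, HasDerivWithinAt (fun s => γs (s + s₀))
      !₂[cos (ϑ s), sin (ϑ s)] (Icc 0 ℓ) s := by
    intro s hs''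
    have := (hs (s + s₀) (mem_univ _)).1
    rw [hasDerivWithinAt_univ] at this
    rw [(he s hs'').1, (he s hs'').2]
    exact (this.comp_add_const s s₀).hasDerivWithinAt
  have := eq_add_of_hasDerivAt (fun s _ => (hasDerivAt_curveOfAngle hϑ s).hasDerivWithinAt) hγ s hs'
  rw [sub_eq_sub_iff_add_eq_add] at this
  rw [← add_sub_assoc, this, add_sub_cancel_right]

/-- Dilation by `r` stretches the arclength, and rotation by `-ψ` shifts the angle. -/
theorem hasSimilarAngle_of_arclength {γ : ℝ → Plane} {ℓ r : ℝ} {θ : ℝ → ℝ} (hr : 0 < r)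
    (hθ : Continuous θ)
    (h : ∀ t ∈ Icc (0 : ℝ) 1, arclength γ t ∈ Icc 0 ℓ ∧
      γ t = γ 0 + curveOfAngle θ (arclength γ t)) (ψ : ℝ) :
    HasSimilarAngle γ r (r * ℓ) fun s => θ (s / r) - ψ := by
  obtain ⟨U, hU⟩ := exists_isometry (c := cos ψ) (s := sin ψ) (τ := 1) (cos_sq_add_sin_sq ψ)
    (by norm_num)
  refine ⟨U, -(r • U (γ 0)), fun t ht => ⟨⟨?_, ?_⟩, ?_⟩⟩
  · exact mul_nonneg hr.le (h t ht).1.1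
  · exact mul_le_mul_of_nonneg_left (h t ht).1.2 hr.le
  · rw [(h t ht).2, map_add, smul_add, add_neg_cancel_comm, hU]
    set a := arclength γ t
    have hcos : Continuous fun s => cos (θ s) := continuous_cos.comp hθ
    have hsin : Continuous fun s => sin (θ s) := continuous_sin.comp hθ
    have e1 : ∫ u in (0 : ℝ)..r * a, cos (θ (u / r) - ψ) =
        r * (cos ψ * (∫ s in (0 : ℝ)..a, cos (θ s)) + sin ψ * ∫ s in (0 : ℝ)..a, sin (θ s)) := by
      rw [intervalIntegral.integral_comp_div (fun s => cos (θ s - ψ)) hr.ne', zero_div,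
        mul_div_cancel_left₀ _ hr.ne', smul_eq_mul, ← intervalIntegral.integral_const_mul (cos ψ),
        ← intervalIntegral.integral_const_mul (sin ψ), ← intervalIntegral.integral_add
          ((hcos.const_mul _).intervalIntegrable _ _) ((hsin.const_mul _).intervalIntegrable _ _)]
      congr 1
      refine intervalIntegral.integral_congr fun s _ => ?_
      simp only [cos_sub]
      ring
    have e2 : ∫ u in (0 : ℝ)..r * a, sin (θ (u / r) - ψ) =
        r * (cos ψ * (∫ s in (0 : ℝ)..a, sin (θ s)) - sin ψ * ∫ s in (0 : ℝ)..a, cos (θ s)) := by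
      rw [intervalIntegral.integral_comp_div (fun s => sin (θ s - ψ)) hr.ne', zero_div,
        mul_div_cancel_left₀ _ hr.ne', smul_eq_mul, ← intervalIntegral.integral_const_mul (cos ψ),
        ← intervalIntegral.integral_const_mul (sin ψ), ← intervalIntegral.integral_sub
          ((hsin.const_mul _).intervalIntegrable _ _) ((hcos.const_mul _).intervalIntegrable _ _)]
      congr 1
      refine intervalIntegral.integral_congr fun s _ => ?_
      simp only [sin_sub]
      ring
    ext i
    fin_cases i
    · simp [curveOfAngle, e1]
    · simp [curveOfAngle, e2]

/-- The normalized equations of a `p`-elastica with tangential angle `ϑ` and curvature `2κ`. -/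
structure IsNormalElastica (p A B ℓ : ℝ) (ϑ κ : ℝ → ℝ) : Prop where
  continuous : Continuous κ
  hasDerivAt : ∀ s, HasDerivAt ϑ (2 * κ s) s
  cos_eq : ∀ s ∈ Icc 0 ℓ, cos (ϑ s) = A + B * |κ s| ^ p
  -- Where `κ` is nonzero and differentiable this follows from the preceding field. It has content
  -- at the zeros of `κ`, where it decides whether `κ` must change sign.
  hasDerivAt_spow : ∀ s ∈ Icc 0 ℓ,
    HasDerivAt (fun u => spow (p - 1) (κ u)) (-(2 * (p - 1) / (p * B)) * sin (ϑ s)) s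

theorem IsNormalElastica.continuous_angle {p A B ℓ : ℝ} {ϑ κ : ℝ → ℝ}
    (h : IsNormalElastica p A B ℓ ϑ κ) : Continuous ϑ :=
  continuous_iff_continuousAt.2 fun s => (h.hasDerivAt s).continuousAt

/-- Either the curvature is constant, or the equations can be normalized with any `B > 0`. -/
theorem IsPElastica.normalize {p : ℝ} (hp : 2 < p) {γ : ℝ → Plane} (hγ : IsPElastica p γ) :
    (∃ θ₀ k₀ : ℝ, ∀ r > 0, ∀ ψ, ∃ ℓ, HasSimilarAngle γ r ℓ fun s => θ₀ + k₀ * (s / r) - ψ) ∨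
      ∃ A, ∀ B > 0, ∃ r > 0, ∃ ℓ > 0, ∃ ϑ κ,
        HasSimilarAngle γ r ℓ ϑ ∧ IsNormalElastica p A B ℓ ϑ κ := by
  obtain ⟨ℓ, θ, k, c₀, c₁, μ, hℓ, hk, hθ, heq, hγ'⟩ := hγ.exists_arclength_data hp
  have hθc : Continuous θ := continuous_iff_continuousAt.2 fun s => (hθ s).continuousAt
  have hp0 : p ≠ 0 := by linarith
  have hp1 : p - 1 ≠ 0 := by linarith
  rcases (by positivity : 0 ≤ c₀ ^ 2 + c₁ ^ 2).eq_or_lt with h0 | h0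
  · left
    have z₀ : c₀ = 0 := by nlinarith [sq_nonneg c₀, sq_nonneg c₁]
    have z₁ : c₁ = 0 := by nlinarith [sq_nonneg c₀, sq_nonneg c₁]
    have hconst : ∀ s ∈ Icc 0 ℓ, k s = k 0 := by
      intro s hs
      have hd : ∀ u ∈ Icc 0 ℓ, HasDerivAt (fun u => p * spow (p - 1) (k u)) 0 u := fun u hu => by
        simpa [z₀, z₁] using (heq u hu).1
      have := eq_of_hasDerivAt_zero_off_countable countable_empty
        (fun u hu => (hd u hu).continuousAt.continuousWithinAt)
        (fun u hu _ => hd u (Ioo_subset_Icc_self hu)) s hs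
      have h2 := congrArg (spow (p - 1)⁻¹) (mul_left_cancel₀ hp0 this)
      simpa [spow_spow, mul_inv_cancel₀ hp1, spow_one] using h2
    have hlin : ∀ s ∈ Icc 0 ℓ, θ s = θ 0 + k 0 * s := by
      intro s hs
      have := eq_of_hasDerivAt_zero_off_countable (f := fun s => θ s - k 0 * s) (b := ℓ)
        countable_empty (by fun_prop) (fun u hu _ => by
          refine ((hθ u).fun_sub ((hasDerivAt_id' u).const_mul (k 0))).congr_deriv ?_
          rw [hconst u (Ioo_subset_Icc_self hu)]
          ring) s hs
      simp only [mul_zero, sub_zero] at this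
      linarith
    refine ⟨θ 0, k 0, fun r hr ψ => ⟨r * ℓ, (hasSimilarAngle_of_arclength hr hθc hγ' ψ).congr
      fun s hs => ?_⟩⟩
    rw [hlin (s / r) ⟨div_nonneg hs.1 hr.le, (div_le_iff₀' hr).2 hs.2⟩]
    exact ⟨rfl, rfl⟩
  · right
    set C := √(c₀ ^ 2 + c₁ ^ 2) with hC
    have hC0 : 0 < C := sqrt_pos.2 h0
    -- `ψ` is the direction of `-c`. With this sign, `C cos (θ - ψ) = (p - 1) |k|^p - μ`, and the
    -- coefficient of the curvature term is positive.
    obtain ⟨ψ, hψ₀, hψ₁⟩ := exists_angle_of_sq_add_sq (X := -c₀) (Y := -c₁) hC0 (by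
      rw [hC, sq_sqrt h0.le]; ring)
    refine ⟨-μ / C, fun B hB => ?_⟩
    -- The curvature is `k = 2 r κ`; `r` is chosen so that `(p - 1) (2 r)^p / C = B`.
    set r := (C * B / (p - 1)) ^ (p⁻¹) / 2 with hr
    have hp1' : 0 < p - 1 := by linarith
    have hr0 : 0 < r := by positivity
    have hrp : (2 * r) ^ p = C * B / (p - 1) := by
      rw [hr, mul_div_cancel₀ _ (two_ne_zero), ← rpow_mul (by positivity), inv_mul_cancel₀ hp0,
        rpow_one]
    have h2r : 0 < 2 * r := by positivity
    have hmem : ∀ s ∈ Icc 0 (r * ℓ), s / r ∈ Icc 0 ℓ := fun s hs =>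
      ⟨div_nonneg hs.1 hr0.le, (div_le_iff₀' hr0).2 hs.2⟩
    refine ⟨r, hr0, r * ℓ, by positivity, _, fun s => (2 * r)⁻¹ * k (s / r),
      hasSimilarAngle_of_arclength hr0 hθc hγ' ψ, ⟨?_, fun s => ?_, fun s hs => ?_, fun s hs => ?_⟩⟩
    · fun_prop
    · refine ((hθ (s / r)).comp s ((hasDerivAt_id' s).div_const r)).sub_const ψ |>.congr_deriv ?_
      field_simp
    · have h1 := (heq _ (hmem s hs)).2
      rw [abs_mul, abs_of_pos (inv_pos.2 h2r), mul_rpow (inv_pos.2 h2r).le (abs_nonneg _),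
        inv_rpow h2r.le, hrp, cos_sub]
      have hk1 : (1 - p) * |k (s / r)| ^ p + μ = -C * (cos ψ * cos (θ (s / r)) +
          sin ψ * sin (θ (s / r))) := by
        rw [h1]
        linear_combination -cos (θ (s / r)) * hψ₀ - sin (θ (s / r)) * hψ₁
      field_simp
      linear_combination hk1
    · have h1 := (heq _ (hmem s hs)).1
      have h2 := h1.comp s ((hasDerivAt_id' s).div_const r)
      have hfun : (fun u => spow (p - 1) ((2 * r)⁻¹ * k (u / r))) = fun u =>
          (((2 * r)⁻¹) ^ (p - 1) / p) * (p * spow (p - 1) (k (u / r))) := by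
        funext u
        rw [spow_mul_of_pos _ _ (inv_pos.2 h2r)]
        field_simp
      rw [hfun]
      refine (h2.const_mul _).congr_deriv ?_
      have e1 : c₀ * sin (θ (s / r)) - c₁ * cos (θ (s / r)) = -C * sin (θ (s / r) - ψ) := by
        rw [sin_sub]
        linear_combination cos (θ (s / r)) * hψ₁ - sin (θ (s / r)) * hψ₀
      have e2 : ((2 * r)⁻¹) ^ (p - 1) = 2 * r * (p - 1) / (C * B) := by
        rw [inv_rpow h2r.le, rpow_sub_one h2r.ne', hrp]
        field_simp
      rw [e1, e2]
      field_simp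

/-! ### Generalized amplitudes -/

theorem countable_cos_eq_zero : {x : ℝ | cos x = 0}.Countable := by
  have : {x : ℝ | cos x = 0} ⊆ range fun k : ℤ => (2 * k + 1) * π / 2 := by
    intro x hx
    obtain ⟨k, hk⟩ := Real.cos_eq_zero_iff.1 hx
    exact ⟨k, hk.symm⟩
  exact (countable_range _).mono this

/-- `G` is the inverse of the odd primitive `F` of an even density `f`, which is
positive away from the zeros of the cosine. -/
structure IsAmplitude (f F G : ℝ → ℝ) : Prop where
  continuous_F : Continuous F
  strictMono_F : StrictMono F
  F_zero : F 0 = 0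
  F_neg : ∀ x, F (-x) = -F x
  continuous_G : Continuous G
  strictMono_G : StrictMono G
  F_G : ∀ s, F (G s) = s
  G_F : ∀ x, G (F x) = x
  pos : ∀ x, cos x ≠ 0 → 0 < f x
  hasDerivAt_F : ∀ x, cos x ≠ 0 → HasDerivAt F (f x) x

/-- Positivity off a null set makes the primitive strictly increasing, and periodicity makes it
unbounded both ways. Nothing beyond nonnegativity is asked at the zeros of the cosine, where
`densityOne` is singular and takes the default value 0. -/
theorem isAmplitude_of_density {f : ℝ → ℝ} (hint : ∀ a b, IntervalIntegrable f volume a b)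
    (hnn : ∀ x, 0 ≤ f x) (hpos : ∀ x, cos x ≠ 0 → 0 < f x) (hper : Function.Periodic f π)
    (heven : ∀ x, f (-x) = f x) (hcont : ∀ x, cos x ≠ 0 → ContinuousAt f x) :
    IsAmplitude f (fun x => ∫ u in (0 : ℝ)..x, f u)
      (Function.invFun fun x => ∫ u in (0 : ℝ)..x, f u) := by
  set F : ℝ → ℝ := fun x => ∫ u in (0 : ℝ)..x, f u with hF
  have hFc : Continuous F := intervalIntegral.continuous_primitive hint 0
  have hinc : ∀ a b, a < b → 0 < ∫ u in a..b, f u := by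
    intro a b hab
    rw [intervalIntegral.integral_pos_iff_support_of_nonneg_ae
      (Filter.Eventually.of_forall hnn) (hint a b)]
    refine ⟨hab, ?_⟩
    have hsub : Ioc a b \ {x | cos x = 0} ⊆ Function.support f ∩ Ioc a b := fun x hx =>
      ⟨(hpos x hx.2).ne', hx.1⟩
    refine lt_of_lt_of_le ?_ (measure_mono hsub)
    rw [measure_sdiff_null (countable_cos_eq_zero.measure_zero volume), Real.volume_Ioc]
    simpa using hab
  have hFm : StrictMono F := fun a b hab => by
    have h1 := intervalIntegral.integral_add_adjacent_intervals (hint 0 a) (hint a b)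
    have h2 := hinc a b hab
    simp only [hF]
    linarith
  have hFs : Function.Surjective F := hFc.surjective
    (hper.tendsto_atTop_intervalIntegral_of_pos (hinc 0 π pi_pos) pi_pos)
    (hper.tendsto_atBot_intervalIntegral_of_pos (hinc 0 π pi_pos) pi_pos)
  obtain ⟨G, hGc, hGm, hFG, hGF⟩ := exists_continuous_inverse hFm hFs
  have hG : Function.invFun F = G := by
    funext s
    apply hFm.injective
    rw [Function.rightInverse_invFun hFs, hFG]
  rw [hG]
  refine ⟨hFc, hFm, by simp [hF], fun x => ?_, hGc, hGm, hFG, hGF, hpos, ?_⟩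
  · have := intervalIntegral.integral_comp_neg (a := 0) (b := x) f
    simp only [heven, neg_zero] at this
    rw [hF]
    dsimp only
    rw [this, intervalIntegral.integral_symm]
  · intro x hx
    exact intervalIntegral.integral_hasDerivAt_right (hint 0 x)
      (by
        have ho : IsOpen {x : ℝ | cos x ≠ 0} := isOpen_ne.preimage continuous_cos
        exact ContinuousOn.stronglyMeasurableAtFilter ho
          (fun y hy => (hcont y hy).continuousWithinAt) x hx) (hcont x hx)

namespace IsAmplitude

variable {f F G : ℝ → ℝ}

theorem hasDerivAt_G (h : IsAmplitude f F G) {s : ℝ} (hs : cos (G s) ≠ 0) :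
    HasDerivAt G (f (G s))⁻¹ s :=
  HasDerivAt.of_local_left_inverse h.continuous_G.continuousAt (h.hasDerivAt_F _ hs)
    (h.pos _ hs).ne' (Filter.Eventually.of_forall h.F_G)

theorem countable_cos_G (h : IsAmplitude f F G) : {s | cos (G s) = 0}.Countable := by
  have : {s | cos (G s) = 0} = F '' {x | cos x = 0} := by
    ext s
    constructor
    · exact fun hs => ⟨G s, hs, h.F_G s⟩
    · rintro ⟨x, hx, rfl⟩
      simpa [h.G_F] using hx
  rw [this]
  exact countable_cos_eq_zero.image F

/-- The factor `f` of `H'` cancels against `G' = 1 / f` off the countable set where `cos (G s) = 0`.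
Since the result is continuous, it is the derivative there as well. -/
theorem hasDerivAt_comp (h : IsAmplitude f F G) {H g : ℝ → ℝ} (hH : Continuous H)
    (hg : Continuous g) (hd : ∀ x, cos x ≠ 0 → HasDerivAt H (g x * f x) x) (s : ℝ) :
    HasDerivAt (fun s => H (G s)) (g (G s)) s := by
  refine hasDerivAt_of_off_countable (g := fun s => g (G s)) h.countable_cos_G
    (hH.comp h.continuous_G) (hg.comp h.continuous_G) (fun s hs => ?_) s
  refine ((hd _ hs).comp s (h.hasDerivAt_G hs)).congr_deriv ?_
  rw [mul_inv_cancel_right₀ (h.pos _ hs).ne']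

end IsAmplitude

/-! ### The `p`-elliptic functions -/

theorem one_sub_sq_mul_sin_sq_pos {q : ℝ} (hq : q ∈ Ioo (0 : ℝ) 1) (x : ℝ) :
    0 < 1 - q ^ 2 * sin x ^ 2 := by
  have h1 := sin_sq_le_one x
  have h2 : q ^ 2 < 1 := by nlinarith [hq.1, hq.2]
  nlinarith [sq_nonneg q, sq_nonneg (sin x)]

/-- The density of `F_{1,p}(·, q)`. -/
noncomputable def density₁ (p q x : ℝ) : ℝ := |cos x| ^ (1 - 2 / p) / √(1 - q ^ 2 * sin x ^ 2)

/-- The density of `F_{2,p}(·, q)`. -/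
noncomputable def density₂ (p q x : ℝ) : ℝ := 1 / (1 - q ^ 2 * sin x ^ 2) ^ (1 / p)

/-- The density of `F_{1,p}(·, 1) = F_{2,p}(·, 1)`. -/
noncomputable def densityOne (p x : ℝ) : ℝ := 1 / |cos x| ^ (2 / p)

theorem two_div_lt_one {p : ℝ} (hp : 2 < p) : 2 / p < 1 := by
  rw [div_lt_one (by linarith)]
  exact hp

theorem two_div_pos {p : ℝ} (hp : 2 < p) : 0 < 2 / p := by
  have : 0 < p := by linarith
  positivity

theorem isAmplitude_am₁ {p q : ℝ} (hp : 2 < p) (hq : q ∈ Ioo (0 : ℝ) 1) :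
    IsAmplitude (density₁ p q) (fun y => F₁ p y q) (fun s => am₁ p s q) := by
  have e : (fun y => F₁ p y q) = fun x => ∫ u in (0 : ℝ)..x, density₁ p q u := by
    funext y
    rw [F₁, if_neg hq.2.ne]
    rfl
  have hpos := one_sub_sq_mul_sin_sq_pos hq
  have hc : Continuous (density₁ p q) := by
    have := two_div_lt_one hp
    unfold density₁
    refine (continuous_cos.abs.rpow_const fun x => Or.inr (by linarith)).div (by fun_prop)
      fun x => (sqrt_pos.2 (hpos x)).ne'
  have := isAmplitude_of_density (fun a b => hc.intervalIntegrable a b)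
    (fun x => by unfold density₁; positivity)
    (fun x hx => div_pos (rpow_pos_of_pos (abs_pos.2 hx) _) (sqrt_pos.2 (hpos x)))
    (fun x => by simp [density₁, cos_add_pi, sin_add_pi]) (fun x => by simp [density₁])
    (fun x _ => hc.continuousAt)
  rw [← e] at this
  exact this

theorem isAmplitude_am₂ {p q : ℝ} (hq : q ∈ Ioo (0 : ℝ) 1) :
    IsAmplitude (density₂ p q) (fun y => F₂ p y q) (fun s => am₂ p s q) := by
  have e : (fun y => F₂ p y q) = fun x => ∫ u in (0 : ℝ)..x, density₂ p q u := by
    funext y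
    rw [F₂, if_neg hq.2.ne]
    rfl
  have hpos := one_sub_sq_mul_sin_sq_pos hq
  have hc : Continuous (density₂ p q) := by
    unfold density₂
    refine continuous_const.div (Continuous.rpow_const (by fun_prop) fun x => Or.inl (hpos x).ne')
      fun x => (rpow_pos_of_pos (hpos x) _).ne'
  have hp' : ∀ x, 0 < density₂ p q x := fun x => by
    have := rpow_pos_of_pos (hpos x) (1 / p)
    unfold density₂
    positivity
  have := isAmplitude_of_density (fun a b => hc.intervalIntegrable a b) (fun x => (hp' x).le)
    (fun x _ => hp' x) (fun x => by simp [density₂, sin_add_pi]) (fun x => by simp [density₂])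
    (fun x _ => hc.continuousAt)
  rw [← e] at this
  exact this

/-- The singularity at a zero of the cosine is of order `2 / p`, integrable exactly because `p > 2`;
hence loops have finite length. After a shift to the sine, `sin x ≥ 2 x / π` on a quarter period
gives a majorant; reflection and periodicity do the rest. -/
theorem intervalIntegrable_densityOne {p : ℝ} (hp : 2 < p) (a b : ℝ) :
    IntervalIntegrable (densityOne p) volume a b := by
  have h1 := two_div_lt_one hp
  have h0 := two_div_pos hp
  have hsin : IntervalIntegrable (fun x => 1 / |sin x| ^ (2 / p)) volume 0 (π / 2) := by
    have hr : IntervalIntegrable (fun x : ℝ => (2 / π) ^ (-(2 / p)) * x ^ (-(2 / p)))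
        volume 0 (π / 2) :=
      (intervalIntegral.intervalIntegrable_rpow' (by linarith)).const_mul _
    refine hr.mono_fun (measurable_const.div
      (continuous_sin.abs.measurable.pow_const _)).aestronglyMeasurable ?_
    rw [uIoc_of_le (by positivity), Filter.EventuallyLE, ae_restrict_iff' measurableSet_Ioc]
    refine Filter.Eventually.of_forall fun x hx => ?_
    have hx0 : 0 < 2 / π * x := by have := hx.1; positivity
    have hs := Real.mul_le_sin hx.1.le hx.2
    rw [norm_of_nonneg (by positivity), ← mul_rpow (by positivity) hx.1.le,
      norm_of_nonneg (by positivity), one_div, ← rpow_neg (abs_nonneg _),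
      abs_of_pos (hx0.trans_le hs)]
    exact rpow_le_rpow_of_nonpos hx0 hs (by linarith)
  have hneg : IntervalIntegrable (fun x => 1 / |sin x| ^ (2 / p)) volume (-(π / 2)) 0 := by
    have := (IntervalIntegrable.iff_comp_neg (by simp)).1 hsin
    simp only [sin_neg, abs_neg, neg_zero] at this
    exact this.symm
  have hper : Function.Periodic (fun x => 1 / |sin x| ^ (2 / p)) π := fun x => by
    simp [sin_add_pi]
  have hall := fun a b => hper.intervalIntegrable pi_ne_zero (t := -(π / 2))
    (by rw [show -(π / 2) + π = π / 2 by ring]; exact hneg.trans hsin) a b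
  have := (hall (a + π / 2) (b + π / 2)).comp_add_right (π / 2)
  change IntervalIntegrable (fun x => 1 / |cos x| ^ (2 / p)) volume a b
  simpa [sin_add_pi_div_two] using this

theorem isAmplitude_am₁_one {p : ℝ} (hp : 2 < p) :
    IsAmplitude (densityOne p) (fun y => F₁ p y 1) (fun s => am₁ p s 1) := by
  have e : (fun y => F₁ p y 1) = fun x => ∫ u in (0 : ℝ)..x, densityOne p u := by
    funext y
    rw [F₁, if_pos rfl]
    rfl
  have := isAmplitude_of_density (intervalIntegrable_densityOne hp)
    (fun x => by unfold densityOne; positivity)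
    (fun x hx => div_pos one_pos (rpow_pos_of_pos (abs_pos.2 hx) _))
    (fun x => by simp [densityOne, cos_add_pi]) (fun x => by simp [densityOne])
    (fun x hx => by
      unfold densityOne
      refine continuousAt_const.div ?_ (rpow_pos_of_pos (abs_pos.2 hx) _).ne'
      exact (continuous_cos.abs.continuousAt).rpow_const (Or.inl (abs_ne_zero.2 hx)))
  rw [← e] at this
  exact this

theorem am₁_one_eq_am₂_one (p s : ℝ) : am₁ p s 1 = am₂ p s 1 := by
  simp only [am₁, am₂, F₁, F₂, if_true]

theorem K_eq (p : ℝ) : K p = F₁ p (π / 2) 1 := by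
  rw [K, F₁, if_pos rfl]
  refine intervalIntegral.integral_congr fun x hx => ?_
  rw [uIcc_of_le (by positivity)] at hx
  rw [abs_of_nonneg (cos_nonneg_of_mem_Icc ⟨by linarith [hx.1, pi_pos], hx.2⟩)]

theorem K_pos {p : ℝ} (hp : 2 < p) : 0 < K p := by
  rw [K_eq]
  simpa [(isAmplitude_am₁_one hp).F_zero] using
    (isAmplitude_am₁_one hp).strictMono_F (half_pos pi_pos)

theorem am₁_K {p : ℝ} (hp : 2 < p) : am₁ p (K p) 1 = π / 2 := by
  rw [K_eq]
  exact (isAmplitude_am₁_one hp).G_F _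

theorem am₁_neg_K {p : ℝ} (hp : 2 < p) : am₁ p (-K p) 1 = -(π / 2) := by
  rw [K_eq]
  have h := isAmplitude_am₁_one hp
  have := h.G_F (-(π / 2))
  rwa [h.F_neg] at this

/-! ### Tangential angles and curvatures of the profile curves -/

theorem hasAngleCurvatureOn_linearCurve :
    HasAngleCurvatureOn linearCurve (fun _ => 0) (fun _ => 0) univ := by
  intro s _
  refine ⟨?_, hasDerivWithinAt_const _ _ _⟩
  refine hasDerivWithinAt_plane_iff.2 ⟨?_, ?_⟩
  · simpa [linearCurve] using hasDerivAt_id' s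
  · simpa [linearCurve] using hasDerivAt_const s (0 : ℝ)

theorem hasAngleCurvatureOn_circularCurve :
    HasAngleCurvatureOn circularCurve (fun s => s + π / 2) (fun _ => 1) univ := by
  intro s _
  refine ⟨hasDerivWithinAt_plane_iff.2 ⟨?_, ?_⟩, ((hasDerivAt_id s).add_const _).hasDerivWithinAt⟩
  · rw [cos_add_pi_div_two]
    simpa [circularCurve] using hasDerivAt_cos s
  · rw [sin_add_pi_div_two]
    simpa [circularCurve] using hasDerivAt_sin s

theorem hasDerivAt_spow {a x : ℝ} (hx : x ≠ 0) :
    HasDerivAt (spow a) (a * |x| ^ (a - 1)) x := by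
  rcases hx.lt_or_gt with h | h
  · have h1 : HasDerivAt (fun y : ℝ => -((-y) ^ a)) (a * |x| ^ (a - 1)) x := by
      refine ((hasDerivAt_neg' x).rpow_const (p := a) (Or.inl (by linarith))).fun_neg.congr_deriv ?_
      rw [abs_of_neg h]
      ring
    refine h1.congr_of_eventuallyEq ?_
    filter_upwards [gt_mem_nhds h] with y hy
    rw [← neg_neg y, spow_neg, spow_of_pos (by linarith), neg_neg]
  · have h1 : HasDerivAt (fun y : ℝ => y ^ a) (a * |x| ^ (a - 1)) x := by
      rw [abs_of_pos h]
      exact hasDerivAt_rpow_const (Or.inl hx)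
    refine h1.congr_of_eventuallyEq ?_
    filter_upwards [lt_mem_nhds h] with y hy
    exact spow_of_pos hy

theorem cn_eq (p s q : ℝ) : cn p s q = spow (2 / p) (cos (am₁ p s q)) := by
  rw [cn, spow_eq_abs_rpow_mul]

theorem sin_two_mul_arcsin {x : ℝ} (h1 : -1 ≤ x) (h2 : x ≤ 1) :
    sin (2 * arcsin x) = 2 * x * √(1 - x ^ 2) := by
  rw [sin_two_mul, sin_arcsin h1 h2, cos_arcsin]

theorem cos_two_mul_arcsin {x : ℝ} (h1 : -1 ≤ x) (h2 : x ≤ 1) :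
    cos (2 * arcsin x) = 1 - 2 * x ^ 2 := by
  rw [cos_two_mul', cos_sq', sin_arcsin h1 h2]
  ring

theorem mul_sin_mem {q : ℝ} (hq : q ∈ Ioo (0 : ℝ) 1) (x : ℝ) :
    -1 < q * sin x ∧ q * sin x < 1 := by
  have := sin_le_one x
  have := neg_one_le_sin x
  constructor <;> nlinarith [hq.1, hq.2]

theorem hasAngleCurvatureOn_wavelikeCurve {p q : ℝ} (hp : 2 < p) (hq : q ∈ Ioo (0 : ℝ) 1) :
    HasAngleCurvatureOn (wavelikeCurve p q) (fun s => 2 * arcsin (q * sn p s q))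
      (fun s => 2 * q * cn p s q) univ := by
  have ha := isAmplitude_am₁ hp hq
  have hpos := one_sub_sq_mul_sin_sq_pos hq
  have h1 := two_div_lt_one hp
  have h0 := two_div_pos hp
  have hp0 : 0 < p := by linarith
  intro s _
  simp only [hasDerivWithinAt_univ]
  obtain ⟨b1, b2⟩ := mul_sin_mem hq (am₁ p s q)
  refine ⟨hasDerivAt_plane_iff.2 ⟨?_, ?_⟩, ?_⟩
  · have hE : HasDerivAt (fun s => 2 * E₁ p (am₁ p s q) q)
        (2 * (1 - q ^ 2 * sin (am₁ p s q) ^ 2)) s := by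
      have hc : Continuous fun θ : ℝ => √(1 - q ^ 2 * sin θ ^ 2) * |cos θ| ^ (1 - 2 / p) :=
        Continuous.mul (by fun_prop) (continuous_cos.abs.rpow_const fun x => Or.inr (by linarith))
      have hd : ∀ x, HasDerivAt (fun x => 2 * E₁ p x q)
          (2 * (√(1 - q ^ 2 * sin x ^ 2) * |cos x| ^ (1 - 2 / p))) x := fun x =>
        ((hc.integral_hasStrictDerivAt 0 x).hasDerivAt).const_mul 2
      refine ha.hasDerivAt_comp (H := fun x => 2 * E₁ p x q)
        (g := fun x => 2 * (1 - q ^ 2 * sin x ^ 2))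
        (continuous_iff_continuousAt.2 fun x => (hd x).continuousAt) (by fun_prop) (fun x _ => ?_) s
      refine (hd x).congr_deriv ?_
      have hs := (sqrt_pos.2 (hpos x)).ne'
      rw [density₁]
      field_simp
      rw [sq_sqrt (hpos x).le]
    rw [sn, cos_two_mul_arcsin b1.le b2.le]
    simp only [wavelikeCurve]
    refine (hE.sub (hasDerivAt_id s)).congr_deriv ?_
    ring
  -- Since `cn` is the signed power `2 / p` of the cosine, its signed power `p - 1` has exponent `2
  -- - 2 / p > 1`.
  · have hf : (fun s => (wavelikeCurve p q s) 1) = fun s =>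
        -q * (p / (p - 1)) * spow (2 - 2 / p) (cos (am₁ p s q)) := by
      funext s
      simp only [wavelikeCurve]
      have : |cn p s q| ^ (p - 2) * cn p s q = spow (p - 1) (cn p s q) := by
        rw [spow_eq_abs_rpow_mul]
        congr 2
        ring
      rw [this, cn_eq, spow_spow]
      change -q * (p / (p - 1)) * _ = _
      congr 2
      field_simp
    rw [hf, sn, sin_two_mul_arcsin b1.le b2.le]
    refine ((ha.hasDerivAt_comp (H := fun x => spow (2 - 2 / p) (cos x))
      (g := fun x => -(2 - 2 / p) * sin x * √(1 - q ^ 2 * sin x ^ 2))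
      ((continuous_spow (by linarith)).comp continuous_cos) (by fun_prop) (fun x hx => ?_)
      s).const_mul (-q * (p / (p - 1)))).congr_deriv ?_
    · refine ((hasDerivAt_spow (a := 2 - 2 / p) hx).comp x (hasDerivAt_cos x)).congr_deriv ?_
      have hs := (sqrt_pos.2 (hpos x)).ne'
      rw [density₁, show 2 - 2 / p - 1 = 1 - 2 / p by ring]
      generalize √(1 - q ^ 2 * sin x ^ 2) = S at hs ⊢
      field_simp
    · have hp1 : p - 1 ≠ 0 := by linarith
      rw [mul_pow]
      field_simp
  · have hcn : Continuous fun x => 2 * q * spow (2 / p) (cos x) :=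
      continuous_const.mul ((continuous_spow h0).comp continuous_cos)
    have := ha.hasDerivAt_comp (H := fun x => 2 * arcsin (q * sin x))
      (g := fun x => 2 * q * spow (2 / p) (cos x))
      (continuous_const.mul (continuous_arcsin.comp (continuous_const.mul continuous_sin)))
      hcn (fun x hx => ?_) s
    · simpa only [sn, cn_eq] using this
    · obtain ⟨d1, d2⟩ := mul_sin_mem hq x
      refine (((hasDerivAt_arcsin d1.ne' d2.ne).comp x
        ((hasDerivAt_sin x).const_mul q)).const_mul 2).congr_deriv ?_
      have hs := (sqrt_pos.2 (hpos x)).ne'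
      rw [density₁, mul_pow, spow_eq_abs_rpow_mul]
      have e : |cos x| ^ (2 / p - 1) * |cos x| ^ (1 - 2 / p) = 1 := by
        rw [← rpow_add (abs_pos.2 hx), show 2 / p - 1 + (1 - 2 / p) = 0 by ring, rpow_zero]
      generalize |cos x| ^ (2 / p - 1) = a at e ⊢
      generalize |cos x| ^ (1 - 2 / p) = b at e ⊢
      generalize √(1 - q ^ 2 * sin x ^ 2) = S at hs ⊢
      field_simp
      linear_combination -q * e

theorem hasAngleCurvatureOn_orbitlikeCurve {p q : ℝ} (hp : 2 < p) (hq : q ∈ Ioo (0 : ℝ) 1) :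
    HasAngleCurvatureOn (orbitlikeCurve p q) (fun s => 2 * am₂ p s q)
      (fun s => 2 * dn p s q) univ := by
  have ha := isAmplitude_am₂ (p := p) hq
  have hpos := one_sub_sq_mul_sin_sq_pos hq
  have hp0 : 0 < p := by linarith
  have hp1 : 0 < p - 1 := by linarith
  have hq0 : q ≠ 0 := hq.1.ne'
  have hbase : Continuous fun x : ℝ => 1 - q ^ 2 * sin x ^ 2 := by fun_prop
  have hrpow : ∀ a : ℝ, Continuous fun x : ℝ => (1 - q ^ 2 * sin x ^ 2) ^ a := fun a =>
    hbase.rpow_const fun x => Or.inl (hpos x).ne'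
  intro s _
  simp only [hasDerivWithinAt_univ]
  refine ⟨hasDerivAt_plane_iff.2 ⟨?_, ?_⟩, ?_⟩
  · have hE : HasDerivAt (fun s => E₂ (p / (p - 1)) (am₂ p s q) q)
        (1 - q ^ 2 * sin (am₂ p s q) ^ 2) s := by
      have hd : ∀ x, HasDerivAt (fun x => E₂ (p / (p - 1)) x q)
          ((1 - q ^ 2 * sin x ^ 2) ^ (1 / (p / (p - 1)))) x := fun x =>
        ((hrpow _).integral_hasStrictDerivAt 0 x).hasDerivAt
      refine ha.hasDerivAt_comp (H := fun x => E₂ (p / (p - 1)) x q)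
        (g := fun x => 1 - q ^ 2 * sin x ^ 2)
        (continuous_iff_continuousAt.2 fun x => (hd x).continuousAt) hbase (fun x _ => ?_) s
      refine (hd x).congr_deriv ?_
      -- The reciprocals of the conjugate exponents `p / (p - 1)` and `p` add up to 1.
      rw [density₂, mul_one_div, eq_div_iff (rpow_pos_of_pos (hpos x) _).ne',
        ← rpow_add (hpos x)]
      conv_rhs => rw [← rpow_one (1 - q ^ 2 * sin x ^ 2)]
      congr 1
      field_simp
      ring
    have e : (fun s => (orbitlikeCurve p q s) 0) = fun s =>
        1 / q ^ 2 * (2 * E₂ (p / (p - 1)) (am₂ p s q) q + (q ^ 2 - 2) * s) := by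
      funext s
      simp [orbitlikeCurve]
    rw [e, cos_two_mul]
    refine (((hE.const_mul 2).add ((hasDerivAt_id s).const_mul (q ^ 2 - 2))).const_mul
      (1 / q ^ 2)).congr_deriv ?_
    have := sin_sq_add_cos_sq (am₂ p s q)
    field_simp
    linear_combination -2 * q ^ 2 * this
  · have e : (fun s => (orbitlikeCurve p q s) 1) = fun s =>
        -(1 / q ^ 2 * (p / (p - 1))) * (1 - q ^ 2 * sin (am₂ p s q) ^ 2) ^ ((p - 1) / p) := by
      funext s
      simp only [orbitlikeCurve, dn]
      rw [← rpow_mul (hpos _).le]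
      simp only [PiLp.smul_apply, smul_eq_mul]
      change 1 / q ^ 2 * (-(p / (p - 1)) * _) = _
      rw [show 1 / p * (p - 1) = (p - 1) / p by ring]
      ring
    rw [e, sin_two_mul]
    refine ((ha.hasDerivAt_comp (H := fun x => (1 - q ^ 2 * sin x ^ 2) ^ ((p - 1) / p))
      (g := fun x => -((p - 1) / p) * q ^ 2 * (2 * sin x * cos x)) (hrpow _) (by fun_prop)
      (fun x _ => ?_) s).const_mul _).congr_deriv ?_
    · have h1 : HasDerivAt (fun x => 1 - q ^ 2 * sin x ^ 2) (-(q ^ 2 * (2 * sin x * cos x))) x := by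
        refine ((((hasDerivAt_sin x).fun_pow 2).const_mul (q ^ 2)).const_sub 1).congr_deriv ?_
        norm_num
      refine (h1.rpow_const (Or.inl (hpos x).ne')).congr_deriv ?_
      rw [density₂, one_div, ← rpow_neg (hpos x).le, show (p - 1) / p - 1 = -(1 / p) by
        field_simp; ring]
      ring
    · field_simp
  · refine (ha.hasDerivAt_comp (H := fun x => 2 * x)
      (g := fun x => 2 * (1 - q ^ 2 * sin x ^ 2) ^ (1 / p)) (by fun_prop)
      (continuous_const.mul (hrpow _)) (fun x _ => ?_) s)
    refine ((hasDerivAt_id x).const_mul 2).congr_deriv ?_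
    rw [density₂, mul_assoc, mul_one_div_cancel (rpow_pos_of_pos (hpos x) _).ne']

/-! ### The borderline loop and the flat-core curves -/

theorem am₁_one_mem {p s : ℝ} (hp : 2 < p) (hs : s ∈ Icc (-K p) (K p)) :
    am₁ p s 1 ∈ Icc (-(π / 2)) (π / 2) := by
  have h := (isAmplitude_am₁_one hp).strictMono_G.monotone
  exact ⟨(am₁_neg_K hp).symm.le.trans (h hs.1), (h hs.2).trans (am₁_K hp).le⟩

/-- At the end points the cosine of the amplitude is 0, in agreement with the cut-off in `sech`.
Having the formula on the closed interval covers the one-sided derivatives of the loop. -/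
theorem sech_eq {p s : ℝ} (hp : 2 < p) (hs : s ∈ Icc (-K p) (K p)) :
    sech p s = |cos (am₁ p s 1)| ^ (2 / p) := by
  have h0 := two_div_pos hp
  have hc := cos_nonneg_of_mem_Icc (am₁_one_mem hp hs)
  by_cases hs' : s ∈ Ioo (-K p) (K p)
  · rw [sech, if_pos hs', cn_eq]
    rcases hc.eq_or_lt with h | h
    · simp [← h, h0.ne']
    · rw [spow_of_pos h, abs_of_pos h]
  · have : s = -K p ∨ s = K p := by
      by_contra hne
      push Not at hne
      exact hs' ⟨lt_of_le_of_ne hs.1 (Ne.symm hne.1), lt_of_le_of_ne hs.2 hne.2⟩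
    rw [sech, if_neg hs']
    rcases this with rfl | rfl
    · rw [am₁_neg_K hp, cos_neg, cos_pi_div_two, abs_zero, zero_rpow h0.ne']
    · rw [am₁_K hp, cos_pi_div_two, abs_zero, zero_rpow h0.ne']

theorem hasAngleCurvatureOn_borderlineCurve {p σ : ℝ} (hp : 2 < p) (hσ : σ = 1 ∨ σ = -1) :
    HasAngleCurvatureOn (borderlineCurve p σ) (fun s => σ * (2 * am₁ p s 1))
      (fun s => σ * (2 * sech p s)) (Icc (-K p) (K p)) := by
  have ha := isAmplitude_am₁_one hp
  have h1 := two_div_lt_one hp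
  have h0 := two_div_pos hp
  have hp0 : 0 < p := by linarith
  have hp1 : 0 < p - 1 := by linarith
  intro s hs
  have hK := K_pos hp
  refine ⟨hasDerivWithinAt_plane_iff.2 ⟨?_, ?_⟩, ?_⟩
  · have hc : Continuous fun s => cos (am₁ p s 1) ^ 2 :=
      (continuous_cos.comp ha.continuous_G).pow 2
    have ht : ∀ u ∈ Icc (-K p) (K p), (borderlineCurve p σ u) 0 =
        2 * (∫ t in (0 : ℝ)..u, cos (am₁ p t 1) ^ 2) - u := by
      intro u hu
      simp only [borderlineCurve, tanh]
      change 2 * _ - u = _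
      congr 2
      refine intervalIntegral.integral_congr fun t ht => ?_
      have hti : t ∈ Icc (-K p) (K p) := by
        have h0 : (0 : ℝ) ∈ Icc (-K p) (K p) := ⟨by linarith, hK.le⟩
        exact (ordConnected_Icc.uIcc_subset h0 hu) ht
      rw [sech_eq hp hti, ← rpow_mul (abs_nonneg _), div_mul_cancel₀ _ hp0.ne', rpow_two, sq_abs]
    have e : cos (σ * (2 * am₁ p s 1)) = 2 * cos (am₁ p s 1) ^ 2 - 1 := by
      rcases hσ with rfl | rfl
      · rw [one_mul, cos_two_mul]
      · rw [neg_one_mul, cos_neg, cos_two_mul]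
    rw [e]
    exact ((((hc.integral_hasStrictDerivAt 0 s).hasDerivAt).const_mul 2).sub
      (hasDerivAt_id s)).hasDerivWithinAt.congr ht (ht s hs)
  · have ht : ∀ u ∈ Icc (-K p) (K p), (borderlineCurve p σ u) 1 =
        -σ * (p / (p - 1)) * |cos (am₁ p u 1)| ^ (2 - 2 / p) := by
      intro u hu
      simp only [borderlineCurve]
      rw [sech_eq hp hu, ← rpow_mul (abs_nonneg _),
        show 2 / p * (p - 1) = 2 - 2 / p by field_simp]
      rfl
    have hd := ha.hasDerivAt_comp (H := fun x => |cos x| ^ (2 - 2 / p))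
      (g := fun x => -(2 - 2 / p) * (cos x * sin x))
      (continuous_cos.abs.rpow_const fun x => Or.inr (by linarith)) (by fun_prop)
      (fun x hx => by
        refine ((hasDerivAt_abs_rpow (cos x) (p := 2 - 2 / p) (by linarith)).comp x
          (hasDerivAt_cos x)).congr_deriv ?_
        rw [densityOne, mul_one_div, eq_div_iff (rpow_pos_of_pos (abs_pos.2 hx) _).ne',
          show 2 - 2 / p - 2 = -(2 / p) by ring, rpow_neg (abs_nonneg _)]
        have := (rpow_pos_of_pos (abs_pos.2 hx) (2 / p)).ne'
        field_simp) s
    have e : sin (σ * (2 * am₁ p s 1)) = σ * (2 * sin (am₁ p s 1) * cos (am₁ p s 1)) := by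
      rcases hσ with rfl | rfl
      · rw [one_mul, one_mul, sin_two_mul]
      · rw [neg_one_mul, sin_neg, sin_two_mul, neg_one_mul]
    rw [e]
    refine (((hd.const_mul (-σ * (p / (p - 1)))).hasDerivWithinAt).congr_deriv ?_).congr ht
      (ht s hs)
    field_simp
  · have hd := ha.hasDerivAt_comp (H := fun x => x) (g := fun x => |cos x| ^ (2 / p))
      continuous_id (continuous_cos.abs.rpow_const fun x => Or.inr h0.le)
      (fun x hx => by
        refine (hasDerivAt_id x).congr_deriv ?_
        rw [densityOne, mul_one_div_cancel (rpow_pos_of_pos (abs_pos.2 hx) _).ne']) s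
    beta_reduce
    rw [sech_eq hp hs]
    exact ((hd.const_mul 2).const_mul σ).hasDerivWithinAt

/-! ### Concatenation of arcs with common end tangents -/

/-- An arc with unit tangents `T`, which are `(-1, 0)` at both end points. -/
structure Arc.IsUnitSpeed (c : Arc) (T : ℝ → Plane) : Prop where
  le : c.left ≤ c.right
  norm_eq : ∀ s ∈ Icc c.left c.right, ‖T s‖ = 1
  deriv : ∀ s ∈ Icc c.left c.right, HasDerivWithinAt c.toFun (T s) (Icc c.left c.right) s
  left_eq : T c.left = !₂[-1, 0]
  right_eq : T c.right = !₂[-1, 0]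

theorem Arc.concat_apply_of_le {c₁ c₂ : Arc} {s : ℝ} (h : s ≤ c₁.right - c₁.left) :
    (c₁.concat c₂).toFun s = c₁.toFun (s + c₁.left) := by
  simp [Arc.concat, h]

theorem Arc.concat_apply_of_ge {c₁ c₂ : Arc} {s : ℝ} (h : c₁.right - c₁.left ≤ s) :
    (c₁.concat c₂).toFun s = c₂.toFun (s + c₂.left - (c₁.right - c₁.left)) +
      c₁.toFun c₁.right - c₂.toFun c₂.left := by
  rcases h.eq_or_lt with rfl | h
  · simp [Arc.concat]
  · simp [Arc.concat, not_le.2 h]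

/-- At the junction both one-sided tangents are `(-1, 0)`, so both formulas for the tangent are
valid there and the one-sided derivatives fit together. -/
theorem Arc.IsUnitSpeed.concat {c₁ c₂ : Arc} {T₁ T₂ : ℝ → Plane} (h₁ : c₁.IsUnitSpeed T₁)
    (h₂ : c₂.IsUnitSpeed T₂) : ∃ T, (c₁.concat c₂).IsUnitSpeed T ∧
      (∀ s ≤ c₁.right - c₁.left, T s = T₁ (s + c₁.left)) ∧
      ∀ s, c₁.right - c₁.left ≤ s → T s = T₂ (s + c₂.left - (c₁.right - c₁.left)) := by
  set L₁ := c₁.right - c₁.left with hL₁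
  set L₂ := c₂.right - c₂.left with hL₂
  have hL₁0 : 0 ≤ L₁ := sub_nonneg.2 h₁.le
  have hL₂0 : 0 ≤ L₂ := sub_nonneg.2 h₂.le
  have hm₁ : ∀ s ∈ Icc 0 L₁, s + c₁.left ∈ Icc c₁.left c₁.right := fun s hs =>
    ⟨by linarith [hs.1], by linarith [hs.2]⟩
  have hm₂ : ∀ s ∈ Icc L₁ (L₁ + L₂), s + c₂.left - L₁ ∈ Icc c₂.left c₂.right := fun s hs =>
    ⟨by linarith [hs.1], by linarith [hs.2]⟩
  set T : ℝ → Plane := fun s => if s ≤ L₁ then T₁ (s + c₁.left) else T₂ (s + c₂.left - L₁) with hT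
  have hT₁ : ∀ s ≤ L₁, T s = T₁ (s + c₁.left) := fun s hs => by simp [hT, hs]
  have hT₂ : ∀ s, L₁ ≤ s → T s = T₂ (s + c₂.left - L₁) := fun s hs => by
    rcases hs.eq_or_lt with h | h
    · rw [hT₁ s h.symm.le, ← h, hL₁]
      simp [h₁.right_eq, h₂.left_eq]
    · simp [hT, not_le.2 h]
  have hsplit : Icc 0 (L₁ + L₂) = Icc 0 L₁ ∪ Icc L₁ (L₁ + L₂) :=
    (Icc_union_Icc_eq_Icc hL₁0 (by linarith)).symm
  have d₁ : ∀ s ∈ Icc 0 L₁, HasDerivWithinAt (c₁.concat c₂).toFun (T s) (Icc 0 L₁) s := by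
    intro s hs
    rw [hT₁ s hs.2]
    have := (h₁.deriv _ (hm₁ s hs)).scomp s ((hasDerivWithinAt_id s (Icc 0 L₁)).add_const c₁.left)
      hm₁
    rw [one_smul] at this
    exact this.congr (fun u hu => Arc.concat_apply_of_le hu.2) (Arc.concat_apply_of_le hs.2)
  have d₂ : ∀ s ∈ Icc L₁ (L₁ + L₂),
      HasDerivWithinAt (c₁.concat c₂).toFun (T s) (Icc L₁ (L₁ + L₂)) s := by
    intro s hs
    rw [hT₂ s hs.1]
    have := ((h₂.deriv _ (hm₂ s hs)).scomp s
      (((hasDerivWithinAt_id s (Icc L₁ (L₁ + L₂))).add_const c₂.left).sub_const L₁) hm₂)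
    rw [one_smul] at this
    refine ((this.add_const (c₁.toFun c₁.right)).sub_const (c₂.toFun c₂.left)).congr
      (fun u hu => Arc.concat_apply_of_ge hu.1) (Arc.concat_apply_of_ge hs.1)
  refine ⟨T, ⟨add_nonneg hL₁0 hL₂0, fun s hs => ?_, fun s hs => ?_, ?_, ?_⟩, hT₁, hT₂⟩
  · rcases le_total s L₁ with h | h
    · rw [hT₁ s h]
      exact h₁.norm_eq _ (hm₁ s ⟨hs.1, h⟩)
    · rw [hT₂ s h]
      exact h₂.norm_eq _ (hm₂ s ⟨h, hs.2⟩)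
  · change HasDerivWithinAt _ _ (Icc 0 (L₁ + L₂)) s
    rw [hsplit]
    -- Off a closed set any derivative within it holds vacuously, so each piece matters only at its
    -- own points.
    have hmem₁ : s ∉ Icc 0 L₁ → HasDerivWithinAt (c₁.concat c₂).toFun (T s) (Icc 0 L₁) s :=
      fun h => HasFDerivWithinAt.of_notMem_closure (by rwa [isClosed_Icc.closure_eq])
    have hmem₂ : s ∉ Icc L₁ (L₁ + L₂) →
        HasDerivWithinAt (c₁.concat c₂).toFun (T s) (Icc L₁ (L₁ + L₂)) s :=
      fun h => HasFDerivWithinAt.of_notMem_closure (by rwa [isClosed_Icc.closure_eq])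
    refine HasDerivWithinAt.union ?_ ?_
    · by_cases h : s ∈ Icc 0 L₁
      · exact d₁ s h
      · exact hmem₁ h
    · by_cases h : s ∈ Icc L₁ (L₁ + L₂)
      · exact d₂ s h
      · exact hmem₂ h
  · change T 0 = _
    rw [hT₁ 0 hL₁0, zero_add, h₁.left_eq]
  · change T (L₁ + L₂) = _
    rw [hT₂ _ (by linarith), show L₁ + L₂ + c₂.left - L₁ = c₂.right by rw [hL₂]; ring, h₂.right_eq]

theorem segmentArc_isUnitSpeed {ℓ : ℝ} (hℓ : 0 ≤ ℓ) :
    (segmentArc ℓ).IsUnitSpeed fun _ => !₂[-1, 0] := by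
  refine ⟨hℓ, fun s _ => by simp [norm_plane], fun s _ => ?_, rfl, rfl⟩
  refine (hasDerivAt_plane_iff.2 ⟨?_, ?_⟩).hasDerivWithinAt
  · simpa [segmentArc] using (hasDerivAt_id' s).fun_neg
  · simpa [segmentArc] using hasDerivAt_const s (0 : ℝ)

/-- The unit tangent of the borderline loop. -/
noncomputable def loopTangent (p σ s : ℝ) : Plane :=
  !₂[cos (σ * (2 * am₁ p s 1)), sin (σ * (2 * am₁ p s 1))]

theorem loopTangent_K {p σ : ℝ} (hp : 2 < p) (hσ : σ = 1 ∨ σ = -1) :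
    loopTangent p σ (K p) = !₂[-1, 0] := by
  rw [loopTangent, am₁_K hp]
  rcases hσ with rfl | rfl <;> simp [mul_div_cancel₀]

theorem loopTangent_neg_K {p σ : ℝ} (hp : 2 < p) (hσ : σ = 1 ∨ σ = -1) :
    loopTangent p σ (-K p) = !₂[-1, 0] := by
  rw [loopTangent, am₁_neg_K hp]
  rcases hσ with rfl | rfl <;> simp [mul_div_cancel₀]

theorem loopArc_isUnitSpeed {p σ : ℝ} (hp : 2 < p) (hσ : σ = 1 ∨ σ = -1) :
    (loopArc p σ).IsUnitSpeed (loopTangent p σ) := by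
  have hK := K_pos hp
  refine ⟨by simp only [loopArc]; linarith, fun s _ => ?_, fun s hs => ?_,
    loopTangent_neg_K hp hσ, loopTangent_K hp hσ⟩
  · rw [loopTangent, norm_plane, cos_sq_add_sin_sq, sqrt_one]
  · exact (hasAngleCurvatureOn_borderlineCurve hp hσ s hs).1

theorem flatCore_succ (p : ℝ) (n : ℕ) (L σ : Fin (n + 2) → ℝ) :
    flatCore p (n + 1) L σ = (flatCore p n (fun i => L i.castSucc) fun i => σ i.castSucc).concat
      ((segmentArc (L (Fin.last (n + 1)))).concat (loopArc p (σ (Fin.last (n + 1))))) := rfl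

theorem flatCore_isUnitSpeed {p : ℝ} (hp : 2 < p) (n : ℕ) :
    ∀ L σ : Fin (n + 1) → ℝ, (∀ j, 0 ≤ L j) → (∀ j, σ j = 1 ∨ σ j = -1) →
      ∃ T, (flatCore p n L σ).IsUnitSpeed T := by
  induction n with
  | zero =>
    intro L σ hL hσ
    obtain ⟨T, h, -⟩ := (segmentArc_isUnitSpeed (hL 0)).concat (loopArc_isUnitSpeed hp (hσ 0))
    exact ⟨T, h⟩
  | succ n ih =>
    intro L σ hL hσ
    obtain ⟨T₁, h₁⟩ := ih (fun i => L i.castSucc) (fun i => σ i.castSucc) (fun j => hL _)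
      fun j => hσ _
    obtain ⟨T₂, h₂, -⟩ := (segmentArc_isUnitSpeed (hL (Fin.last (n + 1)))).concat
      (loopArc_isUnitSpeed hp (hσ (Fin.last (n + 1))))
    rw [flatCore_succ]
    obtain ⟨T, h, -⟩ := h₁.concat h₂
    exact ⟨T, h⟩

theorem flatCore_left (p : ℝ) (n : ℕ) (L σ : Fin (n + 1) → ℝ) : (flatCore p n L σ).left = 0 := by
  cases n <;> rfl

theorem flatCore_right (p : ℝ) (n : ℕ) :
    ∀ L σ : Fin (n + 1) → ℝ, (flatCore p n L σ).right = 2 * (n + 1) * K p + ∑ j, L j := by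
  induction n with
  | zero =>
    intro L σ
    simp [flatCore, Arc.bigConcat, Arc.concat, segmentArc, loopArc]
    ring
  | succ n ih =>
    intro L σ
    rw [flatCore_succ, Fin.sum_univ_castSucc]
    simp only [Arc.concat, ih, flatCore_left, segmentArc, loopArc]
    push_cast
    ring

theorem norm_derivWithin_flatCore {p : ℝ} (hp : 2 < p) {n : ℕ} {L σ : Fin (n + 1) → ℝ}
    (hL : ∀ j, 0 ≤ L j) (hσ : ∀ j, σ j = 1 ∨ σ j = -1) {s : ℝ}
    (hs : s ∈ Icc 0 (flatCore p n L σ).right) :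
    ‖derivWithin (flatCore p n L σ).toFun (Icc 0 (flatCore p n L σ).right) s‖ = 1 := by
  obtain ⟨T, hT⟩ := flatCore_isUnitSpeed hp n L σ hL hσ
  have hpos : 0 < (flatCore p n L σ).right := by
    rw [flatCore_right]
    have := K_pos hp
    have := Finset.sum_nonneg fun j (_ : j ∈ Finset.univ) => hL j
    positivity
  have hd := hT.deriv
  have hn := hT.norm_eq
  rw [flatCore_left] at hd hn
  rw [(hd s hs).derivWithin (uniqueDiffOn_Icc hpos s hs)]
  exact hn s hs

/-! ### Linear, circular, orbitlike and wavelike elasticae -/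

-- `φ` is only known to be continuous. Near `s` it is a local inverse of `g` applied to the
-- differentiable `y`.
open Filter Topology in
theorem hasDerivAt_of_comp {g φ y : ℝ → ℝ} {g' y' s : ℝ} (hg : HasStrictDerivAt g g' (φ s))
    (hg' : g' ≠ 0) (hφ : ContinuousAt φ s) (he : ∀ᶠ u in 𝓝 s, g (φ u) = y u)
    (hy : HasDerivAt y y' s) : HasDerivAt φ (y' / g') s := by
  have h1 := (hg.to_localInverse hg').hasDerivAt
  rw [he.self_of_nhds] at h1
  refine ((h1.comp s hy).congr_deriv (by rw [div_eq_inv_mul])).congr_of_eventuallyEq ?_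
  filter_upwards [he, hφ.eventually (hg.eventually_left_inverse hg')] with u h2 h3
  rw [Function.comp_apply, ← h2, h3]

-- Simple zeros are isolated, whereas infinitely many of them in a compact interval would
-- accumulate.
open Filter Topology in
theorem finite_zeros {g g' : ℝ → ℝ} {a b : ℝ} (hg : ∀ s ∈ Icc a b, HasDerivAt g (g' s) s)
    (hne : ∀ s ∈ Icc a b, g s = 0 → g' s ≠ 0) : {s ∈ Icc a b | g s = 0}.Finite := by
  by_contra hinf
  obtain ⟨x, hx, hacc⟩ := Set.Infinite.exists_accPt_of_subset_isCompact hinf isCompact_Icc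
    (sep_subset _ _)
  rw [accPt_iff_frequently_nhdsNE] at hacc
  refine hacc ?_
  by_cases h0 : g x = 0
  · filter_upwards [(hg x hx).eventually_ne (c := 0) (hne x hx h0)] with z hz h
    exact hz h.2
  · filter_upwards [((hg x hx).continuousAt.eventually_ne h0).filter_mono nhdsWithin_le_nhds]
      with z hz h
    exact hz h.2

theorem cos_eq_one_sub_two_mul_sin_half_sq (x : ℝ) : cos x = 1 - 2 * sin (x / 2) ^ 2 := by
  rw [← cos_two_mul_eq_one_sub, mul_div_cancel₀ _ two_ne_zero]

/-- Projecting `ℝ` onto `[0, ℓ]` extends the unit vector to a map `ℝ → Circle`, which lifts through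
the covering `Circle.exp`. -/
theorem exists_continuous_angle {x y : ℝ → ℝ} {ℓ : ℝ} (hℓ : 0 ≤ ℓ) (hx : Continuous x)
    (hy : Continuous y) (h : ∀ s ∈ Icc 0 ℓ, x s ^ 2 + y s ^ 2 = 1) :
    ∃ φ : ℝ → ℝ, Continuous φ ∧ ∀ s ∈ Icc 0 ℓ, cos (φ s) = x s ∧ sin (φ s) = y s := by
  let π₀ : ℝ → ℝ := fun s => projIcc 0 ℓ hℓ s
  have hπ₀ : Continuous π₀ := continuous_subtype_val.comp continuous_projIcc
  have hmem : ∀ s, (⟨x (π₀ s), y (π₀ s)⟩ : ℂ) ∈ Submonoid.unitSphere ℂ := fun s => by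
    change _ ∈ Metric.sphere (0 : ℂ) 1
    rw [mem_sphere_zero_iff_norm, ← sq_eq_sq₀ (norm_nonneg _) zero_le_one, Complex.sq_norm,
      Complex.normSq_mk, one_pow, ← sq, ← sq]
    exact h _ (projIcc 0 ℓ hℓ s).2
  let c : C(ℝ, Circle) := ⟨fun s => ⟨_, hmem s⟩, by
    refine Continuous.subtype_mk ?_ _
    have e : (fun s => (⟨x (π₀ s), y (π₀ s)⟩ : ℂ)) = fun s =>
        ((x (π₀ s) : ℝ) : ℂ) + ((y (π₀ s) : ℝ) : ℂ) * Complex.I := by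
      funext s
      apply Complex.ext <;> simp
    rw [e]
    fun_prop⟩
  obtain ⟨e₀, he₀⟩ := Circle.exp_surjective (c 0)
  obtain ⟨φ, ⟨-, hφ⟩, -⟩ := Circle.isCoveringMap_exp.existsUnique_continuousMap_lifts c 0 e₀ he₀
  refine ⟨φ, φ.continuous, fun s hs => ?_⟩
  have h1 : (Circle.exp (φ s) : ℂ) = ⟨x (π₀ s), y (π₀ s)⟩ := congrArg Subtype.val (congrFun hφ s)
  have h2 : π₀ s = s := by simp only [π₀]; rw [projIcc_of_mem hℓ hs]
  rw [Circle.coe_exp, h2] at h1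
  have hre := congrArg Complex.re h1
  have him := congrArg Complex.im h1
  rw [Complex.exp_ofReal_mul_I_re] at hre
  rw [Complex.exp_ofReal_mul_I_im] at him
  exact ⟨hre, him⟩

/-- Quadrature for `φ' = 1 / f(φ)`: it identifies `φ` with a shift of `G` and, unlike a uniqueness
theorem, needs only continuity at the points of `S`. -/
theorem IsAmplitude.F_sub_eq {f F G φ : ℝ → ℝ} {a b : ℝ} {S : Set ℝ} (h : IsAmplitude f F G)
    (hS : S.Countable) (hφ : ContinuousOn φ (Icc a b))
    (hd : ∀ s ∈ Ioo a b, s ∉ S → cos (φ s) ≠ 0 ∧ HasDerivAt φ (f (φ s))⁻¹ s) :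
    ∀ s ∈ Icc a b, F (φ s) - s = F (φ a) - a := by
  refine eq_of_hasDerivAt_zero_off_countable hS
    ((h.continuous_F.comp_continuousOn hφ).sub continuousOn_id) fun s hs hs' => ?_
  obtain ⟨h1, h2⟩ := hd s hs hs'
  refine (((h.hasDerivAt_F _ h1).comp s h2).sub (hasDerivAt_id s)).congr_deriv ?_
  rw [mul_inv_cancel₀ (h.pos _ h1).ne', sub_self]

section Normal

variable {p A B ℓ : ℝ} {ϑ κ : ℝ → ℝ}

theorem IsNormalElastica.neg (h : IsNormalElastica p A B ℓ ϑ κ) :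
    IsNormalElastica p A B ℓ (fun s => -ϑ s) fun s => -κ s := by
  refine ⟨h.continuous.neg, fun s => (h.hasDerivAt s).fun_neg.congr_deriv (by ring),
    fun s hs => ?_, fun s hs => ?_⟩
  · rw [cos_neg, abs_neg, h.cos_eq s hs]
  · simp only [spow_neg, sin_neg]
    exact (h.hasDerivAt_spow s hs).fun_neg.congr_deriv (by ring)

theorem IsNormalElastica.add_int_mul_two_pi (h : IsNormalElastica p A B ℓ ϑ κ) (m : ℤ) :
    IsNormalElastica p A B ℓ (fun s => ϑ s + m * (2 * π)) κ := by
  refine ⟨h.continuous, fun s => (h.hasDerivAt s).add_const _, fun s hs => ?_, fun s hs => ?_⟩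
  · rw [cos_add_int_mul_two_pi, h.cos_eq s hs]
  · rw [sin_add_int_mul_two_pi]
    exact h.hasDerivAt_spow s hs

theorem HasSimilarAngle.add_int_mul_two_pi {γ : ℝ → Plane} {r : ℝ} (h : HasSimilarAngle γ r ℓ ϑ)
    (m : ℤ) : HasSimilarAngle γ r ℓ fun s => ϑ s + m * (2 * π) :=
  h.congr fun _ _ => ⟨cos_add_int_mul_two_pi _ _, sin_add_int_mul_two_pi _ _⟩

theorem isRepresentedBy_linear_or_circular {γ : ℝ → Plane} {θ₀ k₀ : ℝ}
    (h : ∀ r > 0, ∀ ψ, ∃ ℓ, HasSimilarAngle γ r ℓ fun s => θ₀ + k₀ * (s / r) - ψ) :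
    IsRepresentedBy γ linearCurve univ ∨ IsRepresentedBy γ circularCurve univ := by
  rcases lt_trichotomy k₀ 0 with hk | rfl | hk
  · right
    obtain ⟨ℓ, hℓ⟩ := h (-k₀) (by linarith) (θ₀ + π / 2)
    have hk' := hk.ne
    refine hℓ.neg.isRepresentedBy_of_angle (s₀ := 0) (by linarith) (by fun_prop)
      hasAngleCurvatureOn_circularCurve fun s _ => ?_
    rw [show -(θ₀ + k₀ * (s / -k₀) - (θ₀ + π / 2)) = s + 0 + π / 2 by field_simp; ring]
    exact ⟨rfl, rfl⟩
  · left
    obtain ⟨ℓ, hℓ⟩ := h 1 one_pos θ₀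
    refine hℓ.isRepresentedBy_of_angle (s₀ := 0) one_pos (by fun_prop)
      hasAngleCurvatureOn_linearCurve fun s _ => ?_
    simp
  · right
    obtain ⟨ℓ, hℓ⟩ := h k₀ hk (θ₀ - π / 2)
    refine hℓ.isRepresentedBy_of_angle (s₀ := 0) hk (by fun_prop)
      hasAngleCurvatureOn_circularCurve fun s _ => ?_
    rw [show θ₀ + k₀ * (s / k₀) - (θ₀ - π / 2) = s + 0 + π / 2 by field_simp; ring]
    exact ⟨rfl, rfl⟩

/-- The right side of `cos_eq` is at least 1, which forces `cos ϑ = 1`. -/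
theorem IsNormalElastica.isRepresentedBy_linear {γ : ℝ → Plane} {r : ℝ} (hr : 0 < r)
    (hγ : HasSimilarAngle γ r ℓ ϑ) (h : IsNormalElastica p A B ℓ ϑ κ) (hA : 1 ≤ A) (hB : 0 < B) :
    IsRepresentedBy γ linearCurve univ := by
  refine hγ.isRepresentedBy_of_angle (s₀ := 0) hr h.continuous_angle
    hasAngleCurvatureOn_linearCurve fun s hs => ?_
  have h1 := h.cos_eq s hs
  have h2 : 0 ≤ B * |κ s| ^ p := by positivity
  have h3 : cos (ϑ s) = 1 := le_antisymm (cos_le_one _) (by linarith)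
  have h4 : sin (ϑ s) = 0 := by
    have := sin_sq_add_cos_sq (ϑ s)
    rw [h3] at this
    nlinarith
  simp [h3, h4]

/-- Here `|κ|^p = 1 - q² sin² (ϑ / 2)` never vanishes, so `κ` keeps its sign, positive after a
reflection. Then `ϑ / 2` solves the equation of `am₂`. -/
theorem IsNormalElastica.isRepresentedBy_orbitlike {γ : ℝ → Plane} {r q : ℝ} (hp : 2 < p)
    (hq : q ∈ Ioo (0 : ℝ) 1) (hr : 0 < r) (hℓ : 0 < ℓ) (hγ : HasSimilarAngle γ r ℓ ϑ)
    (h : IsNormalElastica p (1 - 2 / q ^ 2) (2 / q ^ 2) ℓ ϑ κ) :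
    IsRepresentedBy γ (orbitlikeCurve p q) univ := by
  have ha := isAmplitude_am₂ (p := p) hq
  have hpos := one_sub_sq_mul_sin_sq_pos hq
  have hq0 : q ≠ 0 := hq.1.ne'
  have hp0 : p ≠ 0 := by linarith
  wlog hκ : 0 < κ 0 generalizing ϑ κ
  · refine this hγ.neg h.neg (lt_of_le_of_ne (by simpa using hκ) fun h0 => ?_)
    have h1 := h.cos_eq 0 ⟨le_rfl, hℓ.le⟩
    rw [zero_eq_neg.1 h0, abs_zero, zero_rpow hp0, mul_zero, add_zero] at h1
    have h2 := neg_one_le_cos (ϑ 0)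
    have h3 : 1 < 1 / q ^ 2 := by
      rw [lt_div_iff₀ (by positivity)]
      nlinarith [hq.1, hq.2]
    have h4 : 2 / q ^ 2 = 2 * (1 / q ^ 2) := by ring
    linarith
  have habs : ∀ s ∈ Icc 0 ℓ, |κ s| ^ p = 1 - q ^ 2 * sin (ϑ s / 2) ^ 2 := by
    intro s hs
    have h1 := h.cos_eq s hs
    rw [cos_eq_one_sub_two_mul_sin_half_sq] at h1
    field_simp at h1
    linarith
  have hκpos : ∀ s ∈ Icc 0 ℓ, 0 < κ s := by
    intro s hs
    by_contra hneg
    obtain ⟨u, hu, hu0⟩ := intermediate_value_Icc' hs.1 h.continuous.continuousOn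
      ⟨not_lt.1 hneg, hκ.le⟩
    have h1 := habs u ⟨hu.1, hu.2.trans hs.2⟩
    rw [hu0, abs_zero, zero_rpow hp0] at h1
    exact (hpos _).ne h1
  have hd : ∀ s ∈ Icc 0 ℓ, HasDerivAt (fun s => ϑ s / 2) (density₂ p q (ϑ s / 2))⁻¹ s := by
    intro s hs
    refine ((h.hasDerivAt s).div_const 2).congr_deriv ?_
    rw [density₂, one_div, inv_inv, ← habs s hs, ← rpow_mul (abs_nonneg _), mul_one_div_cancel hp0,
      rpow_one, abs_of_pos (hκpos s hs)]
    ring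
  -- Injectivity of `ϑ / 2` makes the exceptional set `cos (ϑ / 2) = 0` countable.
  have hmono : StrictMonoOn (fun s => ϑ s / 2) (Icc 0 ℓ) := by
    refine strictMonoOn_of_deriv_pos (convex_Icc _ _)
      (h.continuous_angle.div_const 2).continuousOn fun s hs => ?_
    rw [interior_Icc] at hs
    rw [((h.hasDerivAt s).div_const 2).deriv]
    linarith [hκpos s (Ioo_subset_Icc_self hs)]
  have hS : {s ∈ Icc 0 ℓ | cos (ϑ s / 2) = 0}.Countable := by
    refine Set.countable_of_injective_of_countable_image (f := fun s => ϑ s / 2)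
      (hmono.injOn.mono (sep_subset _ _)) (countable_cos_eq_zero.mono ?_)
    rintro _ ⟨s, hs, rfl⟩
    exact hs.2
  have hF := ha.F_sub_eq hS (h.continuous_angle.div_const 2).continuousOn fun s hs hs' =>
    ⟨fun h0 => hs' ⟨Ioo_subset_Icc_self hs, h0⟩, hd s (Ioo_subset_Icc_self hs)⟩
  refine hγ.isRepresentedBy_of_angle (s₀ := F₂ p (ϑ 0 / 2) q) hr h.continuous_angle
    (hasAngleCurvatureOn_orbitlikeCurve hp hq) fun s hs => ?_
  have h1 : am₂ p (s + F₂ p (ϑ 0 / 2) q) q = ϑ s / 2 := by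
    have := hF s hs
    beta_reduce at this
    rw [show s + F₂ p (ϑ 0 / 2) q = F₂ p (ϑ s / 2) q by linarith]
    exact ha.G_F _
  rw [h1, mul_div_cancel₀ _ two_ne_zero]
  exact ⟨rfl, rfl⟩

/-- With this `B` one has `|κ / q|^p + (sin (ϑ / 2) / q)² = 1`. The polar angle of the corresponding
point of the circle passes regularly through the zeros of `κ`, and it solves the equation of `am₁`
away from them. -/
theorem IsNormalElastica.isRepresentedBy_wavelike {γ : ℝ → Plane} {r q : ℝ} (hp : 2 < p)
    (hq : q ∈ Ioo (0 : ℝ) 1) (hr : 0 < r) (hℓ : 0 < ℓ) (hγ : HasSimilarAngle γ r ℓ ϑ)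
    (h : IsNormalElastica p (1 - 2 * q ^ 2) (2 * q ^ (2 - p)) ℓ ϑ κ) :
    IsRepresentedBy γ (wavelikeCurve p q) univ := by
  have ha := isAmplitude_am₁ hp hq
  have hq0 : 0 < q := hq.1
  have hq2 : q ^ 2 < 1 := by nlinarith [hq.1, hq.2]
  have hp0 : p ≠ 0 := by linarith
  have hB : 0 < 2 * q ^ (2 - p) := by positivity
  have hlow : ∀ s ∈ Icc 0 ℓ, 1 - 2 * q ^ 2 ≤ cos (ϑ s) := fun s hs => by
    rw [h.cos_eq s hs]
    have : 0 ≤ 2 * q ^ (2 - p) * |κ s| ^ p := by positivity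
    linarith
  have hc0 : ∀ s ∈ Icc 0 ℓ, cos (ϑ s / 2) ≠ 0 := fun s hs h0 => by
    have h1 := cos_sq (ϑ s / 2)
    rw [mul_div_cancel₀ _ two_ne_zero, h0] at h1
    linarith [hlow s hs]
  -- Adding `2π` to `ϑ` leaves the curve unchanged and reverses the sign of `cos (ϑ / 2)`.
  wlog hc : 0 < cos (ϑ 0 / 2) generalizing ϑ
  · have e : ∀ s, (ϑ s + (1 : ℤ) * (2 * π)) / 2 = ϑ s / 2 + π := fun s => by push_cast; ring
    refine this (hγ.add_int_mul_two_pi 1) (h.add_int_mul_two_pi 1) (fun s hs => ?_)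
      (fun s hs => ?_) ?_
    · rw [cos_add_int_mul_two_pi]
      exact hlow s hs
    · rw [e, cos_add_pi, neg_ne_zero]
      exact hc0 s hs
    · rw [e, cos_add_pi, neg_pos]
      exact lt_of_le_of_ne (not_lt.1 hc) (hc0 0 ⟨le_rfl, hℓ.le⟩)
  have hϑ2 : Continuous fun s => ϑ s / 2 := h.continuous_angle.div_const 2
  have hcpos : ∀ s ∈ Icc 0 ℓ, 0 < cos (ϑ s / 2) := by
    intro s hs
    by_contra hneg
    obtain ⟨u, hu, hu0⟩ := intermediate_value_Icc' hs.1 (continuous_cos.comp hϑ2).continuousOn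
      ⟨not_lt.1 hneg, hc.le⟩
    exact hc0 u ⟨hu.1, hu.2.trans hs.2⟩ hu0
  have habs : ∀ s ∈ Icc 0 ℓ, |κ s / q| ^ p = 1 - (sin (ϑ s / 2) / q) ^ 2 := by
    intro s hs
    have h1 := h.cos_eq s hs
    rw [cos_eq_one_sub_two_mul_sin_half_sq, rpow_sub hq0, rpow_two] at h1
    rw [abs_div, abs_of_pos hq0, div_rpow (abs_nonneg _) hq0.le]
    field_simp at h1 ⊢
    linarith
  -- The signed power squares to `|κ / q|^p` and still records the sign of `κ`, so `φ` can run
  -- through whole turns.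
  obtain ⟨φ, hφc, hφ⟩ := exists_continuous_angle (x := fun s => spow (p / 2) (κ s / q))
    (y := fun s => sin (ϑ s / 2) / q) hℓ.le
    ((continuous_spow (by linarith)).comp (h.continuous.div_const q))
    ((continuous_sin.comp hϑ2).div_const q) (fun s hs => by
      rw [← sq_abs (spow _ _), abs_spow (by linarith), ← rpow_natCast (|κ s / q| ^ (p / 2)),
        ← rpow_mul (abs_nonneg _), Nat.cast_two, div_mul_cancel₀ _ two_ne_zero, habs s hs]
      ring)
  -- At a zero of `κ`, `cos ϑ = 1 - 2 q²` lies strictly between -1 and 1, so `sin ϑ ≠ 0` and the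
  -- zero of the moment is simple.
  have hS : {s ∈ Icc 0 ℓ | spow (p - 1) (κ s) = 0}.Finite := by
    refine finite_zeros h.hasDerivAt_spow fun s hs h0 h1 => ?_
    have hκ : κ s = 0 := by
      have := congrArg abs h0
      rw [abs_spow (by linarith), abs_zero, rpow_eq_zero (abs_nonneg _) (by linarith)] at this
      exact abs_eq_zero.1 this
    have hs0 : sin (ϑ s) = 0 := by
      refine (mul_eq_zero.1 h1).resolve_left (neg_ne_zero.2 (div_ne_zero ?_ ?_))
      · have : p - 1 ≠ 0 := by linarith
        positivity
      · positivity
    have h2 := h.cos_eq s hs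
    rw [hκ, abs_zero, zero_rpow hp0, mul_zero, add_zero] at h2
    have h3 := sin_sq_add_cos_sq (ϑ s)
    rw [hs0, h2] at h3
    nlinarith [mul_pos (pow_pos hq0 2) (sub_pos.2 hq2)]
  have hsinφ : ∀ s ∈ Icc 0 ℓ, q * sin (φ s) = sin (ϑ s / 2) := fun s hs => by
    rw [(hφ s hs).2, mul_div_cancel₀ _ hq0.ne']
  have hsqrt : ∀ s ∈ Icc 0 ℓ, √(1 - q ^ 2 * sin (φ s) ^ 2) = cos (ϑ s / 2) := fun s hs => by
    rw [← mul_pow, hsinφ s hs, ← cos_sq', sqrt_sq (hcpos s hs).le]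
  have hd : ∀ s ∈ Ioo 0 ℓ, κ s ≠ 0 → cos (φ s) ≠ 0 ∧ HasDerivAt φ (density₁ p q (φ s))⁻¹ s := by
    intro s hs hκ
    have hs' := Ioo_subset_Icc_self hs
    have habs0 : 0 < |κ s / q| := abs_pos.2 (div_ne_zero hκ hq0.ne')
    have hcos0 : cos (φ s) ≠ 0 := by
      rw [(hφ s hs').1, ← abs_pos, abs_spow (by linarith)]
      positivity
    refine ⟨hcos0, (hasDerivAt_of_comp (hasStrictDerivAt_sin _) hcos0 hφc.continuousAt
      (y := fun s => sin (ϑ s / 2) / q) ?_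
      ((((h.hasDerivAt s).div_const 2).sin).div_const q)).congr_deriv ?_⟩
    · filter_upwards [Ioo_mem_nhds hs.1 hs.2] with u hu
      exact (hφ u (Ioo_subset_Icc_self hu)).2
    · rw [density₁, inv_div, hsqrt s hs', (hφ s hs').1, abs_spow (by linarith),
        ← rpow_mul habs0.le, spow_eq_abs_rpow_mul,
        show p / 2 * (1 - 2 / p) = p / 2 - 1 by field_simp]
      field_simp
  have hF := ha.F_sub_eq hS.countable hφc.continuousOn fun s hs hs' =>
    hd s hs fun h0 => hs' ⟨Ioo_subset_Icc_self hs, by rw [h0, spow_zero_right]⟩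
  refine hγ.isRepresentedBy_of_angle (s₀ := F₁ p (φ 0) q) hr h.continuous_angle
    (hasAngleCurvatureOn_wavelikeCurve hp hq) fun s hs => ?_
  have h1 : am₁ p (s + F₁ p (φ 0) q) q = φ s := by
    have := hF s hs
    beta_reduce at this
    rw [show s + F₁ p (φ 0) q = F₁ p (φ s) q by linarith]
    exact ha.G_F _
  have hm := mul_sin_mem hq (φ s)
  rw [sn, h1, cos_two_mul_arcsin hm.1.le hm.2.le, sin_two_mul_arcsin hm.1.le hm.2.le, mul_pow,
    hsqrt s hs, ← mul_pow, hsinφ s hs, ← sin_two_mul, mul_div_cancel₀ _ two_ne_zero]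
  exact ⟨cos_eq_one_sub_two_mul_sin_half_sq _, rfl⟩

end Normal

/-! ### Flat-core elasticae -/

theorem am₁_one_mem_Ioo {p s : ℝ} (hp : 2 < p) (hs : s ∈ Ioo (-K p) (K p)) :
    am₁ p s 1 ∈ Ioo (-(π / 2)) (π / 2) := by
  have h := (isAmplitude_am₁_one hp).strictMono_G
  exact ⟨(am₁_neg_K hp).symm.le.trans_lt (h hs.1), (h hs.2).trans_le (am₁_K hp).le⟩

theorem IsAmplitude.G_neg {f F G : ℝ → ℝ} (h : IsAmplitude f F G) (s : ℝ) : G (-s) = -G s :=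
  h.strictMono_F.injective (by rw [h.F_neg, h.F_G, h.F_G])

/-- The amplitude stays in the open interval where the cosine is positive. The tangent thus detects
the interior of a loop, which is what prevents loops from overlapping. -/
theorem loopTangent_ne {p σ s : ℝ} (hp : 2 < p) (hσ : σ = 1 ∨ σ = -1)
    (hs : s ∈ Ioo (-K p) (K p)) : loopTangent p σ s ≠ !₂[-1, 0] := by
  intro h
  have h1 : cos (σ * (2 * am₁ p s 1)) = -1 := congrArg (fun v : Plane => v 0) h
  have h2 : cos (σ * (2 * am₁ p s 1)) = 2 * cos (am₁ p s 1) ^ 2 - 1 := by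
    rcases hσ with rfl | rfl
    · rw [one_mul, cos_two_mul]
    · rw [neg_one_mul, cos_neg, cos_two_mul]
  have h3 := cos_pos_of_mem_Ioo (am₁_one_mem_Ioo hp hs)
  nlinarith

theorem loopTangent_neg {p : ℝ} (hp : 2 < p) (σ s : ℝ) :
    loopTangent p (-σ) (-s) = loopTangent p σ s := by
  have h := (isAmplitude_am₁_one hp).G_neg s
  beta_reduce at h
  rw [loopTangent, h, loopTangent, mul_neg, neg_mul_neg]

/-- On `[a, b]`, the tangent `X` is `(-1, 0)` except on translates of the borderline loop. -/
def IsLoopTangent (p a b : ℝ) (X : ℝ → Plane) : Prop :=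
  ∀ t ∈ Icc a b, X t ≠ !₂[-1, 0] → ∃ c σ : ℝ, (σ = 1 ∨ σ = -1) ∧ t ∈ Ioo (c - K p) (c + K p) ∧
    ∀ s ∈ Icc a b, s ∈ Icc (c - K p) (c + K p) → X s = loopTangent p σ (s - c)

section Normal

variable {p ℓ : ℝ} {ϑ κ : ℝ → ℝ}

theorem IsNormalElastica.abs_rpow_eq (h : IsNormalElastica p (-1) 2 ℓ ϑ κ) {s : ℝ}
    (hs : s ∈ Icc 0 ℓ) : |κ s| ^ p = cos (ϑ s / 2) ^ 2 := by
  have h1 := h.cos_eq s hs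
  have h2 := cos_sq (ϑ s / 2)
  rw [mul_div_cancel₀ _ two_ne_zero] at h2
  linarith

theorem IsNormalElastica.eq_zero_iff (hp : 2 < p) (h : IsNormalElastica p (-1) 2 ℓ ϑ κ) {s : ℝ}
    (hs : s ∈ Icc 0 ℓ) : κ s = 0 ↔ cos (ϑ s / 2) = 0 := by
  rw [← sq_eq_zero_iff (a := cos _), ← h.abs_rpow_eq hs,
    rpow_eq_zero (abs_nonneg _) (by linarith), abs_eq_zero]

/-- Quadrature is continued by connectedness. Wherever `F₁ p (ϑ / 2) 1 = s - c` within the open loop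
interval, `ϑ / 2` lies in `(-π/2, π/2)` and `κ ≠ 0`; so the solution set with `κ ≥ 0` is open as
well as closed. -/
theorem IsNormalElastica.exists_center (hp : 2 < p) (h : IsNormalElastica p (-1) 2 ℓ ϑ κ) {t : ℝ}
    (hℓ : 0 < ℓ) (ht : t ∈ Icc 0 ℓ) (hκ : 0 < κ t) :
    ∃ c, t ∈ Ioo (c - K p) (c + K p) ∧ ∀ s ∈ Icc 0 ℓ, s ∈ Icc (c - K p) (c + K p) →
      cos (ϑ s) = cos (2 * am₁ p (s - c) 1) ∧ sin (ϑ s) = sin (2 * am₁ p (s - c) 1) := by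
  have ha := isAmplitude_am₁_one hp
  have hp0 : p ≠ 0 := by linarith
  wlog ht2 : ϑ t / 2 ∈ Ioo (-(π / 2)) (π / 2) generalizing ϑ
  · obtain ⟨m, hm, -⟩ := existsUnique_add_zsmul_mem_Ioc two_pi_pos (ϑ t) (-π)
    rw [zsmul_eq_mul] at hm
    have hm' := h.add_int_mul_two_pi m
    obtain ⟨c, hc1, hc2⟩ := this hm' ⟨by linarith [hm.1], by
      refine lt_of_le_of_ne (by linarith [hm.2]) fun h0 => hκ.ne' ((hm'.eq_zero_iff hp ht).2 ?_)
      rw [h0, cos_pi_div_two]⟩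
    refine ⟨c, hc1, fun s hs hs' => ?_⟩
    have := hc2 s hs hs'
    rwa [cos_add_int_mul_two_pi, sin_add_int_mul_two_pi] at this
  have hφ : Continuous fun s => ϑ s / 2 := h.continuous_angle.div_const 2
  -- `c` is the parameter at which the loop through `t` has angle 0.
  set c := t - F₁ p (ϑ t / 2) 1 with hc
  have hFK : F₁ p (π / 2) 1 = K p := (K_eq p).symm
  have hFK' : F₁ p (-(π / 2)) 1 = -K p := by
    have := ha.F_neg (π / 2)
    beta_reduce at this
    rw [this, hFK]
  have ht1 : t ∈ Ioo (c - K p) (c + K p) := by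
    have h1 := ha.strictMono_F ht2.1
    have h2 := ha.strictMono_F ht2.2
    beta_reduce at h1 h2
    rw [hFK'] at h1
    rw [hFK] at h2
    exact ⟨by linarith, by linarith⟩
  have key : ∀ s ∈ Icc 0 ℓ ∩ Ioo (c - K p) (c + K p), F₁ p (ϑ s / 2) 1 = s - c := by
    set J := Icc 0 ℓ ∩ Ioo (c - K p) (c + K p) with hJ
    have hJo : J.OrdConnected := ordConnected_Icc.inter ordConnected_Ioo
    have : PreconnectedSpace J := Subtype.preconnectedSpace hJo.isPreconnected
    let S : Set J := {u | F₁ p (ϑ u / 2) 1 = u - c ∧ 0 ≤ κ u}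
    have hcl : IsClosed S := by
      have hF := ha.continuous_F
      have hF' : Continuous fun s => F₁ p (ϑ s / 2) 1 := hF.comp hφ
      have hk := h.continuous
      exact (isClosed_eq (hF'.comp continuous_subtype_val)
        (continuous_subtype_val.sub continuous_const)).inter
        (isClosed_le continuous_const (hk.comp continuous_subtype_val))
    have hop : IsOpen S := by
      rw [Metric.isOpen_iff]
      rintro ⟨x, hx⟩ ⟨hx1, hx2⟩
      simp only at hx1 hx2
      have hxφ : ϑ x / 2 ∈ Ioo (-(π / 2)) (π / 2) := by
        have h1 := ha.strictMono_F
        constructor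
        · rw [← h1.lt_iff_lt]
          rw [hFK', hx1]
          linarith [hx.2.1]
        · rw [← h1.lt_iff_lt]
          rw [hFK, hx1]
          linarith [hx.2.2]
      have hx0 : 0 < κ x := lt_of_le_of_ne hx2 fun h0 =>
        (cos_pos_of_mem_Ioo hxφ).ne' ((h.eq_zero_iff hp hx.1).1 h0.symm)
      obtain ⟨ε, hε, hball⟩ := Metric.isOpen_iff.1 (isOpen_lt continuous_const h.continuous) x hx0
      refine ⟨ε, hε, ?_⟩
      rintro ⟨u, hu⟩ hux
      replace hux : u ∈ Metric.ball x ε := hux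
      refine ⟨?_, (hball hux).le⟩
      have hsub : Icc (min x u) (max x u) ⊆ Metric.ball x ε := by
        have : (Metric.ball x ε).OrdConnected := by
          rw [Real.ball_eq_Ioo]
          exact ordConnected_Ioo
        exact this.uIcc_subset (Metric.mem_ball_self hε) hux
      have hF := ha.F_sub_eq (a := min x u) (b := max x u) countable_empty hφ.continuousOn
        fun v hv _ => by
          have hv1 := hsub (Ioo_subset_Icc_self hv)
          have hvJ : v ∈ J := hJo.uIcc_subset hx hu (Ioo_subset_Icc_self hv)
          have hv0 : 0 < κ v := hball hv1
          refine ⟨fun h0 => hv0.ne' ((h.eq_zero_iff hp hvJ.1).2 h0), ?_⟩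
          refine ((h.hasDerivAt v).div_const 2).congr_deriv ?_
          have h1 := h.abs_rpow_eq hvJ.1
          rw [densityOne, one_div, inv_inv, div_eq_mul_one_div 2 p, rpow_mul (abs_nonneg _),
            rpow_two, sq_abs, ← h1, ← rpow_mul (abs_nonneg _), mul_one_div_cancel hp0, rpow_one,
            abs_of_pos hv0]
          ring
      have h1 := hF x ⟨min_le_left _ _, le_max_left _ _⟩
      have h2 := hF u ⟨min_le_right _ _, le_max_right _ _⟩
      beta_reduce at h1 h2
      simp only
      linarith
    have huniv := IsClopen.eq_univ ⟨hcl, hop⟩ ⟨⟨t, ht, ht1⟩, by simp only [hc]; ring, hκ.le⟩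
    intro s hs
    have : (⟨s, hs⟩ : J) ∈ S := huniv ▸ mem_univ _
    exact this.1
  -- Both sides are continuous, so the identity passes to the closure of the nonempty open interval.
  have key' : ∀ s ∈ Icc 0 ℓ, s ∈ Icc (c - K p) (c + K p) → F₁ p (ϑ s / 2) 1 = s - c := by
    intro s hs hs'
    have hab : max 0 (c - K p) < min ℓ (c + K p) := by
      rw [max_lt_iff, lt_min_iff, lt_min_iff]
      exact ⟨⟨hℓ, ht.1.trans_lt ht1.2⟩, ht1.1.trans_le ht.2, ht1.1.trans ht1.2⟩
    have hcl : IsClosed {s | F₁ p (ϑ s / 2) 1 = s - c} :=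
      isClosed_eq (ha.continuous_F.comp hφ) (by fun_prop)
    have hsub : Ioo (max 0 (c - K p)) (min ℓ (c + K p)) ⊆ {s | F₁ p (ϑ s / 2) 1 = s - c} := by
      intro u hu
      rw [mem_Ioo, max_lt_iff, lt_min_iff] at hu
      exact key u ⟨⟨hu.1.1.le, hu.2.1.le⟩, hu.1.2, hu.2.2⟩
    have := hcl.closure_subset_iff.2 hsub
    rw [closure_Ioo hab.ne] at this
    exact this ⟨max_le hs.1 hs'.1, le_min hs.2 hs'.2⟩
  refine ⟨c, ht1, fun s hs hs' => ?_⟩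
  have h1 : am₁ p (s - c) 1 = ϑ s / 2 := by
    rw [← key' s hs hs']
    exact ha.G_F _
  rw [h1, mul_div_cancel₀ _ two_ne_zero]
  exact ⟨rfl, rfl⟩

/-- Zero curvature forces `cos ϑ = -1`, so any other tangent lies on a loop whose sign is that of
`κ`; negative `κ` is reduced to positive by reflection. -/
theorem IsNormalElastica.isLoopTangent (hp : 2 < p) (hℓ : 0 < ℓ)
    (h : IsNormalElastica p (-1) 2 ℓ ϑ κ) :
    IsLoopTangent p 0 ℓ fun s => !₂[cos (ϑ s), sin (ϑ s)] := by
  intro t ht hne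
  rcases lt_trichotomy (κ t) 0 with hκ | hκ | hκ
  · obtain ⟨c, hc, hs⟩ := h.neg.exists_center hp hℓ ht (neg_pos.2 hκ)
    refine ⟨c, -1, Or.inr rfl, hc, fun s h1 h2 => ?_⟩
    obtain ⟨h3, h4⟩ := hs s h1 h2
    rw [cos_neg] at h3
    rw [sin_neg] at h4
    rw [loopTangent, neg_one_mul, cos_neg, sin_neg, ← h3, ← h4, neg_neg]
  · exfalso
    refine hne ?_
    have h1 := h.cos_eq t ht
    rw [hκ, abs_zero, zero_rpow (by linarith), mul_zero, add_zero] at h1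
    have h2 := sin_sq_add_cos_sq (ϑ t)
    rw [h1] at h2
    have h3 : sin (ϑ t) = 0 := by nlinarith
    change (!₂[cos (ϑ t), sin (ϑ t)] : Plane) = _
    rw [h1, h3]
  · obtain ⟨c, hc, hs⟩ := h.exists_center hp hℓ ht hκ
    refine ⟨c, 1, Or.inl rfl, hc, fun s h1 h2 => ?_⟩
    obtain ⟨h3, h4⟩ := hs s h1 h2
    rw [loopTangent, one_mul, ← h3, ← h4]

end Normal

/-! ### Decomposition of a tangent field into loops and segments -/

section Loops

variable {p a b : ℝ} {X : ℝ → Plane}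

theorem IsLoopTangent.mono {a' b' : ℝ} (h : IsLoopTangent p a b X) (ha : a ≤ a') (hb : b' ≤ b) :
    IsLoopTangent p a' b' X := by
  intro t ht hne
  obtain ⟨c, σ, hσ, hc, hs⟩ := h t (Icc_subset_Icc ha hb ht) hne
  exact ⟨c, σ, hσ, hc, fun s h1 => hs s (Icc_subset_Icc ha hb h1)⟩

/-- Reversal exchanges the two ends, so that completing loops on the right also serves the left;
signs flip because `am₁` is odd. -/
theorem IsLoopTangent.comp_neg (hp : 2 < p) (h : IsLoopTangent p a b X) :
    IsLoopTangent p (-b) (-a) fun s => X (-s) := by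
  have hneg : ∀ {x y s : ℝ}, s ∈ Icc (-y) (-x) → -s ∈ Icc x y := fun hs =>
    ⟨by linarith [hs.2], by linarith [hs.1]⟩
  intro t ht hne
  obtain ⟨c, σ, hσ, hc, hs⟩ := h (-t) (hneg ht) hne
  refine ⟨-c, -σ, by rcases hσ with rfl | rfl <;> simp, ⟨by linarith [hc.2], by linarith [hc.1]⟩,
    fun s h1 h2 => ?_⟩
  beta_reduce
  rw [hs (-s) (hneg h1) ⟨by linarith [h2.2], by linarith [h2.1]⟩, ← loopTangent_neg hp]
  congr 1
  ring

/-- A loop that starts at or before `b` and reaches beyond `b` can be completed. -/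
theorem IsLoopTangent.exists_extension (hp : 2 < p) (hab : a ≤ b) (h : IsLoopTangent p a b X) :
    ∃ c σ : ℝ, ∃ Y, (σ = 1 ∨ σ = -1) ∧ b ∈ Ico (c - K p) (c + K p) ∧
      IsLoopTangent p a (c + K p) Y ∧ (∀ s ∈ Icc a b, Y s = X s) ∧
      ∀ s ∈ Icc a (c + K p), c - K p ≤ s → Y s = loopTangent p σ (s - c) := by
  have hK := K_pos hp
  obtain ⟨c, σ, hσ, hb, hX⟩ : ∃ c σ : ℝ, (σ = 1 ∨ σ = -1) ∧ b ∈ Ico (c - K p) (c + K p) ∧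
      ∀ s ∈ Icc a b, c - K p ≤ s → X s = loopTangent p σ (s - c) := by
    by_cases hne : X b = !₂[-1, 0]
    -- If `b` lies inside no loop, a complete new loop is attached at `b`, so the extension always
    -- ends with a loop, as flat-core curves do.
    · refine ⟨b + K p, 1, Or.inl rfl, ⟨by linarith, by linarith⟩, fun s hs hs' => ?_⟩
      have e : s = b := by linarith [hs.2]
      rw [e, hne, show b - (b + K p) = -K p by ring, loopTangent_neg_K hp (Or.inl rfl)]
    · obtain ⟨c, σ, hσ, hc, hs⟩ := h b ⟨hab, le_rfl⟩ hne
      exact ⟨c, σ, hσ, ⟨hc.1.le, hc.2⟩, fun s h1 h2 => hs s h1 ⟨h2, h1.2.trans hc.2.le⟩⟩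
  set Y : ℝ → Plane := fun s => if s ≤ b then X s else loopTangent p σ (s - c) with hY
  have hY1 : ∀ s ≤ b, Y s = X s := fun s hs => by simp [hY, hs]
  have hY2 : ∀ s ∈ Icc a (c + K p), c - K p ≤ s → Y s = loopTangent p σ (s - c) := by
    intro s h1 h2
    by_cases hs : s ≤ b
    · rw [hY1 s hs, hX s ⟨h1.1, hs⟩ h2]
    · simp [hY, hs]
  refine ⟨c, σ, Y, hσ, hb, fun t ht hne => ?_, fun s hs => hY1 s hs.2, hY2⟩
  by_cases htc : c - K p < t
  · refine ⟨c, σ, hσ, ⟨htc, lt_of_le_of_ne ht.2 fun h0 => hne ?_⟩, fun s h1 h2 => hY2 s h1 h2.1⟩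
    rw [hY2 t ht htc.le, h0, add_sub_cancel_left, loopTangent_K hp hσ]
  · have htb : t ≤ b := (not_lt.1 htc).trans hb.1
    rw [hY1 t htb] at hne
    obtain ⟨c', σ', hσ', hc', hs'⟩ := h t ⟨ht.1, htb⟩ hne
    -- Loops do not overlap: the start of the last loop has tangent `(-1, 0)` and cannot be interior
    -- to another loop.
    have hle : c' + K p ≤ c - K p := by
      by_contra hlt
      have hm : c - K p ∈ Icc a b := ⟨ht.1.trans (not_lt.1 htc), hb.1⟩
      have hm' : c - K p ∈ Ioo (c' - K p) (c' + K p) :=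
        ⟨hc'.1.trans_le (not_lt.1 htc), not_le.1 hlt⟩
      have h1 := hX _ hm le_rfl
      rw [hs' _ hm (Ioo_subset_Icc_self hm'), show c - K p - c = -K p by ring,
        loopTangent_neg_K hp hσ] at h1
      exact loopTangent_ne hp hσ' ⟨by linarith [hm'.1], by linarith [hm'.2]⟩ h1
    refine ⟨c', σ', hσ', hc', fun s h1 h2 => ?_⟩
    have hsb : s ≤ b := by linarith [h2.2, hb.1]
    rw [hY1 s hsb, hs' s ⟨h1.1, hsb⟩ h2]

/-- An interval whose end points lie on no loop contains every loop that it meets. -/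
theorem IsLoopTangent.le_of_eq (hp : 2 < p) (h : IsLoopTangent p a b X) (ha : X a = !₂[-1, 0])
    (hb : X b = !₂[-1, 0]) {t : ℝ} (ht : t ∈ Icc a b) (hne : X t ≠ !₂[-1, 0]) :
    ∃ c σ : ℝ, (σ = 1 ∨ σ = -1) ∧ t ∈ Ioo (c - K p) (c + K p) ∧ a ≤ c - K p ∧ c + K p ≤ b ∧
      ∀ s ∈ Icc (c - K p) (c + K p), X s = loopTangent p σ (s - c) := by
  obtain ⟨c, σ, hσ, hc, hs⟩ := h t ht hne
  have hout : ∀ s ∈ Icc a b, X s = !₂[-1, 0] → s ∉ Ioo (c - K p) (c + K p) := by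
    intro s h1 h2 h3
    rw [hs s h1 (Ioo_subset_Icc_self h3)] at h2
    exact loopTangent_ne hp hσ ⟨by linarith [h3.1], by linarith [h3.2]⟩ h2
  have hab := ht.1.trans ht.2
  have h1 : a ≤ c - K p := by
    by_contra hlt
    exact hout a ⟨le_rfl, hab⟩ ha ⟨not_le.1 hlt, ht.1.trans_lt hc.2⟩
  have h2 : c + K p ≤ b := by
    by_contra hlt
    exact hout b ⟨hab, le_rfl⟩ hb ⟨hc.1.trans_le ht.2, not_le.1 hlt⟩
  exact ⟨c, σ, hσ, hc, h1, h2, fun s h3 => hs s ⟨h1.trans h3.1, h3.2.trans h2⟩ h3⟩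

theorem IsLoopTangent.exists_last (hp : 2 < p) (h : IsLoopTangent p a b X)
    (ha : X a = !₂[-1, 0]) (hb : X b = !₂[-1, 0]) (hne : ∃ t ∈ Icc a b, X t ≠ !₂[-1, 0]) :
    ∃ c σ : ℝ, (σ = 1 ∨ σ = -1) ∧ a ≤ c - K p ∧ c + K p ≤ b ∧
      (∀ s ∈ Icc (c - K p) (c + K p), X s = loopTangent p σ (s - c)) ∧
      ∀ s ∈ Icc (c + K p) b, X s = !₂[-1, 0] := by
  have hK := K_pos hp
  set S := {t ∈ Icc a b | X t ≠ !₂[-1, 0]} with hS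
  have hbdd : BddAbove S := ⟨b, fun t ht => ht.1.2⟩
  -- The supremum need not be attained; a point less than one loop length below it already lies on
  -- the last loop, since a later loop would contain a point of `S` beyond `t + 2 * K p`.
  obtain ⟨t, ht, htS⟩ := exists_lt_of_lt_csSup (s := S) (b := sSup S - 2 * K p) hne (by linarith)
  obtain ⟨c, σ, hσ, hc, h1, h2, h3⟩ := h.le_of_eq hp ha hb ht.1 ht.2
  refine ⟨c, σ, hσ, h1, h2, h3, fun s hs => ?_⟩
  by_contra hs0
  have hsm : s ∈ Icc a b := ⟨by linarith [hs.1], hs.2⟩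
  obtain ⟨c', σ', hσ', hc', h1', h2', h3'⟩ := h.le_of_eq hp ha hb hsm hs0
  have hle : c + K p ≤ c' - K p := by
    by_contra hlt
    have hm : c + K p ∈ Ioo (c' - K p) (c' + K p) := ⟨not_le.1 hlt, hs.1.trans_lt hc'.2⟩
    have h4 := h3 (c + K p) ⟨by linarith, le_rfl⟩
    rw [h3' _ (Ioo_subset_Icc_self hm), add_sub_cancel_left, loopTangent_K hp hσ] at h4
    exact loopTangent_ne hp hσ' ⟨by linarith [hm.1], by linarith [hm.2]⟩ h4
  set u := max s (t + 2 * K p) with hu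
  have hu1 : u ∈ Ioo (c' - K p) (c' + K p) :=
    ⟨hc'.1.trans_le (le_max_left _ _), max_lt hc'.2 (by linarith [hc.2])⟩
  have huS : u ∈ S := by
    refine ⟨⟨by linarith [hu1.1], by linarith [hu1.2]⟩, ?_⟩
    rw [h3' u (Ioo_subset_Icc_self hu1)]
    exact loopTangent_ne hp hσ' ⟨by linarith [hu1.1], by linarith [hu1.2]⟩
  linarith [le_csSup hbdd huS, le_max_right s (t + 2 * K p)]

theorem exists_segment_concat_loop {σ L c : ℝ} (hp : 2 < p) (hσ : σ = 1 ∨ σ = -1) (hL : 0 ≤ L)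
    (h1 : ∀ s ∈ Icc a (a + L), X s = !₂[-1, 0]) (hc : c = a + L + K p)
    (h2 : ∀ s ∈ Icc (c - K p) (c + K p), X s = loopTangent p σ (s - c)) :
    ∃ T, ((segmentArc L).concat (loopArc p σ)).IsUnitSpeed T ∧
      ∀ s ∈ Icc a (c + K p), T (s - a) = X s := by
  obtain ⟨T, hT, hT1, hT2⟩ := (segmentArc_isUnitSpeed hL).concat (loopArc_isUnitSpeed hp hσ)
  simp only [segmentArc, loopArc, sub_zero] at hT1 hT2
  refine ⟨T, hT, fun s hs => ?_⟩
  rcases le_total (s - a) L with hsL | hsL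
  · rw [hT1 _ hsL, h1 s ⟨hs.1, by linarith⟩]
  · rw [hT2 _ hsL, h2 s ⟨by linarith, hs.2⟩]
    congr 1
    rw [hc]
    ring

/-- `N` bounds the length in units of a loop. Removing the final loop and the segment before it
lowers the bound by one, and what remains either carries no loop or ends with one after trimming. -/
theorem IsLoopTangent.exists_flatCore (hp : 2 < p) (N : ℕ) :
    ∀ {b c σ : ℝ}, b - a ≤ N * (2 * K p) → IsLoopTangent p a b X → X a = !₂[-1, 0] →
      (σ = 1 ∨ σ = -1) → a ≤ c - K p → c + K p = b →
      (∀ s ∈ Icc (c - K p) (c + K p), X s = loopTangent p σ (s - c)) →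
      ∃ (n : ℕ) (L τ : Fin (n + 1) → ℝ) (T : ℝ → Plane), (∀ j, 0 ≤ L j) ∧
        (∀ j, τ j = 1 ∨ τ j = -1) ∧ (flatCore p n L τ).IsUnitSpeed T ∧
        (flatCore p n L τ).right = b - a ∧ ∀ s ∈ Icc a b, T (s - a) = X s := by
  have hK := K_pos hp
  induction N with
  | zero =>
    intro b c σ hN _ _ _ hac hcb _
    rw [Nat.cast_zero, zero_mul] at hN
    linarith
  | succ N ih =>
    intro b c σ hN h ha hσ hac hcb hs
    push_cast at hN
    have hc : X (c - K p) = !₂[-1, 0] := by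
      rw [hs _ ⟨le_rfl, by linarith⟩, show c - K p - c = -K p by ring, loopTangent_neg_K hp hσ]
    have h' : IsLoopTangent p a (c - K p) X := h.mono le_rfl (by linarith)
    by_cases hne : ∃ t ∈ Icc a (c - K p), X t ≠ !₂[-1, 0]
    · obtain ⟨c', σ', hσ', h1, h2, h3, h4⟩ := h'.exists_last hp ha hc hne
      obtain ⟨n, L, τ, T₁, hL, hτ, hT₁, hr, hX₁⟩ := ih (b := c' + K p) (c := c') (σ := σ')
        (by linarith) (h'.mono le_rfl h2) ha hσ' h1 rfl h3
      set l := c - K p - (c' + K p) with hl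
      obtain ⟨T₂, hT₂, hX₂⟩ := exists_segment_concat_loop (X := X) (a := c' + K p) (L := l) (c := c)
        hp hσ (by linarith) (fun s hs' => h4 s ⟨hs'.1, by linarith [hs'.2]⟩) (by rw [hl]; ring) hs
      obtain ⟨T, hT, hT1, hT2⟩ := hT₁.concat hT₂
      refine ⟨n + 1, Fin.snoc L l, Fin.snoc τ σ, T, fun j => ?_, fun j => ?_, ?_, ?_,
        fun s hs' => ?_⟩
      · refine Fin.lastCases ?_ (fun i => ?_) j
        · rw [Fin.snoc_last]
          linarith
        · rw [Fin.snoc_castSucc]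
          exact hL i
      · refine Fin.lastCases ?_ (fun i => ?_) j
        · rwa [Fin.snoc_last]
        · rw [Fin.snoc_castSucc]
          exact hτ i
      · rw [flatCore_succ]
        simpa only [Fin.snoc_castSucc, Fin.snoc_last] using hT
      · rw [flatCore_succ]
        simp only [Fin.snoc_castSucc, Fin.snoc_last, Arc.concat, segmentArc, loopArc, hr,
          flatCore_left]
        linarith
      · rw [flatCore_left, sub_zero, hr] at hT1 hT2
        rcases le_total s (c' + K p) with hle | hle
        · rw [hT1 _ (by linarith), add_zero, hX₁ s ⟨hs'.1, hle⟩]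
        · rw [hT2 _ (by linarith), ← hX₂ s ⟨hle, by linarith [hs'.2]⟩]
          congr 1
          simp only [Arc.concat]
          ring
    · push Not at hne
      obtain ⟨T, hT, hX⟩ := exists_segment_concat_loop (X := X) (a := a) (L := c - K p - a) (c := c)
        hp hσ (by linarith) (fun s hs' => hne s ⟨hs'.1, by linarith [hs'.2]⟩) (by ring) hs
      refine ⟨0, fun _ => c - K p - a, fun _ => σ, T, fun _ => by linarith, fun _ => hσ, hT, ?_,
        fun s hs' => hX s (by rwa [hcb])⟩
      rw [flatCore_right]
      simp
      linarith

end Loops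

/-- The given arc may begin and end inside loops. Completing it at both ends, on the left by
reversal, gives a field that decomposes entirely; the arc is the part that starts at parameter `-a`.
-/
theorem IsNormalElastica.isRepresentedBy_flatCore {p ℓ r : ℝ} {ϑ κ : ℝ → ℝ} {γ : ℝ → Plane}
    (hp : 2 < p) (hr : 0 < r) (hℓ : 0 < ℓ) (hγ : HasSimilarAngle γ r ℓ ϑ)
    (h : IsNormalElastica p (-1) 2 ℓ ϑ κ) :
    ∃ (n : ℕ) (L σ : Fin (n + 1) → ℝ), (∀ j, 0 ≤ L j) ∧ (∀ j, σ j = 1 ∨ σ j = -1) ∧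
      IsRepresentedBy γ (flatCore p n L σ).toFun (Icc 0 (flatCore p n L σ).right) := by
  have hK := K_pos hp
  have h0 := h.isLoopTangent hp hℓ
  obtain ⟨c₁, σ₁, Y₁, hσ₁, hc₁, hY₁, hX₁, hl₁⟩ :=
    (h0.comp_neg hp).exists_extension hp (neg_le_neg hℓ.le)
  rw [neg_zero] at hc₁ hX₁
  have h1 := hY₁.comp_neg hp
  rw [neg_neg] at h1
  set a := -(c₁ + K p) with ha
  have ha0 : a ≤ 0 := by linarith [hc₁.2]
  have hYa : Y₁ (-a) = !₂[-1, 0] := by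
    rw [ha, neg_neg, hl₁ _ ⟨by linarith [hc₁.2], le_rfl⟩ (by linarith), add_sub_cancel_left,
      loopTangent_K hp hσ₁]
  obtain ⟨c, σ, Y, hσ, hc, hY, hX, hl⟩ := h1.exists_extension hp (by linarith)
  have hYa' : Y a = !₂[-1, 0] := by rw [hX a ⟨le_rfl, by linarith⟩, hYa]
  have hac : a ≤ c - K p := by
    by_contra hlt
    rw [hl a ⟨le_rfl, by linarith [hc.2]⟩ (not_le.1 hlt).le] at hYa'
    exact loopTangent_ne hp hσ ⟨by linarith, by linarith [hc.2]⟩ hYa'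
  obtain ⟨N, hN⟩ := exists_nat_ge ((c + K p - a) / (2 * K p))
  rw [div_le_iff₀ (by linarith)] at hN
  obtain ⟨n, L, τ, T, hL, hτ, hT, hright, hTX⟩ := hY.exists_flatCore hp N hN hYa' hσ hac rfl
    fun s hs => hl s ⟨hac.trans hs.1, hs.2⟩ hs.1
  refine ⟨n, L, τ, hL, hτ, ?_⟩
  have hmem : ∀ s ∈ Icc 0 ℓ, s + -a ∈ Icc 0 (flatCore p n L τ).right := fun s hs =>
    ⟨by linarith [hs.1], by linarith [hs.2, hc.2]⟩
  have hd : ∀ s ∈ Icc 0 ℓ, HasDerivWithinAt (fun s => (flatCore p n L τ).toFun (s + -a))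
      !₂[cos (ϑ s), sin (ϑ s)] (Icc 0 ℓ) s := by
    intro s hs
    have h2 := hT.deriv (s + -a)
    rw [flatCore_left] at h2
    have h3 := (h2 (hmem s hs)).scomp s ((hasDerivWithinAt_id s (Icc 0 ℓ)).add_const (-a)) hmem
    rw [one_smul, ← sub_eq_add_neg, hTX s ⟨by linarith [hs.1], by linarith [hs.2, hc.2]⟩,
      hX s ⟨by linarith [hs.1], hs.2⟩, hX₁ (-s) ⟨by linarith [hs.2], by linarith [hs.1]⟩,
      neg_neg s] at h3
    exact h3
  refine hγ.isRepresentedBy (s₀ := -a) (v := (flatCore p n L τ).toFun (0 + -a) - curveOfAngle ϑ 0)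
    hr fun s hs => ⟨hmem s hs, ?_⟩
  have := eq_add_of_hasDerivAt
    (fun s _ => (hasDerivAt_curveOfAngle h.continuous_angle s).hasDerivWithinAt) hd s hs
  rw [sub_eq_sub_iff_add_eq_add] at this
  rw [← add_sub_assoc, this, add_sub_cancel_right]

theorem IsPElastica.classification {p : ℝ} (hp : 2 < p) {γ : ℝ → Plane} (hγ : IsPElastica p γ) :
    IsRepresentedBy γ linearCurve univ ∨
      (∃ q ∈ Ioo (0 : ℝ) 1, IsRepresentedBy γ (wavelikeCurve p q) univ) ∨
      (∃ q ∈ Ioo (0 : ℝ) 1, IsRepresentedBy γ (orbitlikeCurve p q) univ) ∨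
      IsRepresentedBy γ circularCurve univ ∨
      (∃ (n : ℕ) (L σ : Fin (n + 1) → ℝ), (∀ j, 0 ≤ L j) ∧ (∀ j, σ j = 1 ∨ σ j = -1) ∧
        IsRepresentedBy γ (flatCore p n L σ).toFun (Icc 0 (flatCore p n L σ).right)) := by
  rcases hγ.normalize hp with ⟨θ₀, k₀, h⟩ | ⟨A, h⟩
  · rcases isRepresentedBy_linear_or_circular h with h | h
    · exact Or.inl h
    · exact Or.inr (Or.inr (Or.inr (Or.inl h)))
  · rcases le_or_gt 1 A with hA | hA
    · obtain ⟨r, hr, ℓ, -, ϑ, κ, h1, h2⟩ := h 1 one_pos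
      exact Or.inl (h2.isRepresentedBy_linear hr h1 hA one_pos)
    rcases lt_trichotomy A (-1) with hA' | rfl | hA'
    · have hq2 : 0 < 2 / (1 - A) := div_pos two_pos (by linarith)
      have hq1 : 2 / (1 - A) < 1 := by
        rw [div_lt_one (by linarith)]
        linarith
      -- This solves `A = 1 - 2 / q²`, and `A < -1` amounts to `q < 1`.
      set q := √(2 / (1 - A)) with hq
      have hqq : q ^ 2 = 2 / (1 - A) := sq_sqrt hq2.le
      have hqm : q ∈ Ioo (0 : ℝ) 1 := ⟨sqrt_pos.2 hq2, by
        rw [hq, sqrt_lt' one_pos, one_pow]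
        exact hq1⟩
      obtain ⟨r, hr, ℓ, hℓ, ϑ, κ, h1, h2⟩ := h (2 / q ^ 2) (by rw [hqq]; positivity)
      have e : A = 1 - 2 / q ^ 2 := by
        rw [hqq]
        have : 1 - A ≠ 0 := by linarith
        field_simp
        ring
      rw [e] at h2
      exact Or.inr (Or.inr (Or.inl ⟨q, hqm, h2.isRepresentedBy_orbitlike hp hqm hr hℓ h1⟩))
    · obtain ⟨r, hr, ℓ, hℓ, ϑ, κ, h1, h2⟩ := h 2 two_pos
      exact Or.inr (Or.inr (Or.inr (Or.inr (h2.isRepresentedBy_flatCore hp hr hℓ h1))))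
    · have hq2 : 0 < (1 - A) / 2 := by linarith
      -- This solves `A = 1 - 2 q²`, and `-1 < A < 1` amounts to `0 < q < 1`.
      set q := √((1 - A) / 2) with hq
      have hqq : q ^ 2 = (1 - A) / 2 := sq_sqrt hq2.le
      have hqm : q ∈ Ioo (0 : ℝ) 1 := ⟨sqrt_pos.2 hq2, by
        rw [hq, sqrt_lt' one_pos, one_pow]
        linarith⟩
      have hqp := hqm.1
      obtain ⟨r, hr, ℓ, hℓ, ϑ, κ, h1, h2⟩ := h (2 * q ^ (2 - p)) (by positivity)
      have e : A = 1 - 2 * q ^ 2 := by linarith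
      rw [e] at h2
      exact Or.inr (Or.inl ⟨q, hqm, h2.isRepresentedBy_wavelike hp hqm hr hℓ h1⟩)

end PElastica

theorem theorem1p2 (p : ℝ) (hp : 2 < p) :
    -- classification
    (∀ γ : ℝ → PElastica.Plane, PElastica.IsPElastica p γ →
      PElastica.IsRepresentedBy γ PElastica.linearCurve univ ∨
      (∃ q ∈ Ioo (0 : ℝ) 1,
        PElastica.IsRepresentedBy γ (PElastica.wavelikeCurve p q) univ) ∨
      (∃ q ∈ Ioo (0 : ℝ) 1,
        PElastica.IsRepresentedBy γ (PElastica.orbitlikeCurve p q) univ) ∨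
      PElastica.IsRepresentedBy γ PElastica.circularCurve univ ∨
      (∃ (n : ℕ) (L σ : Fin (n + 1) → ℝ), (∀ j, 0 ≤ L j) ∧ (∀ j, σ j = 1 ∨ σ j = -1) ∧
        PElastica.IsRepresentedBy γ (PElastica.flatCore p n L σ).toFun
          (Icc 0 (PElastica.flatCore p n L σ).right))) ∧
    -- arclength parameterization, tangential angle and curvature of the profile curves
    PElastica.HasAngleCurvatureOn PElastica.linearCurve (fun _ => 0) (fun _ => 0) univ ∧
    (∀ q ∈ Ioo (0 : ℝ) 1, PElastica.HasAngleCurvatureOn (PElastica.wavelikeCurve p q)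
      (fun s => 2 * arcsin (q * PElastica.sn p s q)) (fun s => 2 * q * PElastica.cn p s q) univ) ∧
    (∀ q ∈ Ioo (0 : ℝ) 1, PElastica.HasAngleCurvatureOn (PElastica.orbitlikeCurve p q)
      (fun s => 2 * PElastica.am₂ p s q) (fun s => 2 * PElastica.dn p s q) univ) ∧
    PElastica.HasAngleCurvatureOn PElastica.circularCurve (fun s => s + π / 2) (fun _ => 1) univ ∧
    (∀ σ : ℝ, σ = 1 ∨ σ = -1 →
      PElastica.HasAngleCurvatureOn (PElastica.borderlineCurve p σ)
        (fun s => σ * (2 * PElastica.am₁ p s 1)) (fun s => σ * (2 * PElastica.sech p s))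
        (Icc (-PElastica.K p) (PElastica.K p))) ∧
    (∀ s ∈ Icc (-PElastica.K p) (PElastica.K p), PElastica.am₁ p s 1 = PElastica.am₂ p s 1) ∧
    -- the flat-core curves are parameterized by arclength
    (∀ (n : ℕ) (L σ : Fin (n + 1) → ℝ), (∀ j, 0 ≤ L j) → (∀ j, σ j = 1 ∨ σ j = -1) →
      (PElastica.flatCore p n L σ).right = 2 * (n + 1) * PElastica.K p + ∑ j, L j ∧
      ∀ s ∈ Icc 0 (PElastica.flatCore p n L σ).right,
        ‖derivWithin (PElastica.flatCore p n L σ).toFun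
          (Icc 0 (PElastica.flatCore p n L σ).right) s‖ = 1) := by
  refine ⟨fun γ hγ => hγ.classification hp, PElastica.hasAngleCurvatureOn_linearCurve,
    fun q hq => PElastica.hasAngleCurvatureOn_wavelikeCurve hp hq,
    fun q hq => PElastica.hasAngleCurvatureOn_orbitlikeCurve hp hq,
    PElastica.hasAngleCurvatureOn_circularCurve,
    fun σ hσ => PElastica.hasAngleCurvatureOn_borderlineCurve hp hσ,
    fun s _ => PElastica.am₁_one_eq_am₂_one p s,
    fun n L σ hL hσ => ⟨PElastica.flatCore_right p n L σ,
      fun s hs => PElastica.norm_derivWithin_flatCore hp hL hσ hs⟩⟩
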